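/- Let $\lambda_b,R_L,L,P_b,\sigma,C,\alpha_c,r_c>0$, $\alpha_t>2$, $\rho_a\in(0,1)$, $\rho_t\in[0,1]$, $a_c>a_t>0$ with $a_c+a_t=1$, thresholds $\gamma_{SIC}^{th},\gamma_t^{th}>0$ with $a_t\gamma_{SIC}^{th}<a_c$, and integers $m_t,m_c\ge1$. **Model.** The typical user is at the origin of $\mathbb R^2$. The base stations form a homogeneous Poisson point process $\Phi$ of density $\lambda_b$ on $\mathbb R^2$; the RIS position $\mathbf x_R$ is uniform in the disc of radius $R_L$ around the origin and independent of $\Phi$; the associated base station $\mathbf x_B$ is the point of $\Phi$ nearest to $\mathbf x_R$; the connected user is at a random point $\mathbf x_c$ with $\|\mathbf x_B-\mathbf x_c\|=r_c$. The fading coefficients $h_{t,\mathbf x},h_{c,\mathbf x}$ ($\mathbf x\in\Phi$) are independent of each other and of all positions, and $|h_{t,\mathbf x}|^2$, $|h_{c,\mathbf x}|^2$ have the Gamma law with shape and rate $m_t$, respectively $m_c$ (Nakagami fading with unit mean power). The path loss of the link from $\mathbf x$ through the RIS to the typical user is $P_t(\mathbf x)=\overline{C}\,(\|\mathbf x-\mathbf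 x_R\|\,\|\mathbf x_R\|)^{-\alpha_t}$, where $$\overline{C}=\frac1\pi\int_0^\pi\Big(\frac{L}{4\pi}\big(\cos(\rho_a\theta)+\cos((1-\rho_a)\theta)\big)\Big)^2d\theta$$ is the angle average of the squared RIS coefficient. With $S=P_b|h_{t,\mathbf x_B}|^2P_t(\mathbf x_B)$ and $I_t=\rho_t\sum_{\mathbf x\in\Phi\setminus\mathbf x_B}P_b|h_{t,\mathbf x}|^2P_t(\mathbf x)$ put $$\gamma_{SIC}=\frac{a_cS}{a_tS+I_t+\sigma^2},\qquad \gamma_t=\frac{a_tS}{I_t+\sigma^2},\qquad \gamma_t^{OMA}=\frac{S}{I_t+\sigma^2},$$ $$\gamma_c^{E}=\mathbb E\left[\frac{P_b|h_{c,\mathbf x_B}|^2Cr_c^{-\alpha_c}}{I_c+\sigma^2}\right],\qquad I_c=\sum_{\mathbf x\in\Phi\setminus\mathbf x_B}P_bC|h_{c,\mathbf x}|^2\|\mathbf x-\mathbf x_c\|^{-\alpha_c}.$$ The coverage probability of the typical user is $\mathbb P_t=\Pr\{\gamma_{SIC}>\gamma_{SIC}^{th},\ \gamma_t>\gamma_t^{th},\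 \gamma_t^{OMA}>\gamma_c^E\}$. **Theorem.** Let $\Upsilon=\max\Big(\frac{\gamma_{SIC}^{th}}{a_c-\gamma_{SIC}^{th}a_t},\frac{\gamma_t^{th}}{a_t},\gamma_c^E\Big)$, $\eta_t=m_t(m_t!)^{-1/m_t}$, $f_{r_{RU}}(y)=2y/R_L^2$ and $$\mathcal F=2\pi\lambda_b\int_0^{R_L}\int_0^\infty\sum_{n=1}^{m_t}(-1)^{n+1}\binom{m_t}{n}\,x\,e^{-\beta_0(y)x^{\alpha_t}}e^{-\beta_2x^2}\,dx\,f_{r_{RU}}(y)\,dy,$$ where, for the summand $n$, $\beta_0(y)=\beta_1y^{\alpha_t}$, $\beta_1=\dfrac{n\eta_t\Upsilon\sigma^2}{P_b\overline C}$ and $$\beta_2=\pi\lambda_b\,{}_2F_1\Big(-\frac2{\alpha_t},m_t;1-\frac2{\alpha_t};-\frac{\rho_tn\eta_t\Upsilon}{m_t}\Big)$$ (analytically continued along the negative axis). Then $\gamma_c^E<\infty$, $I_t<\infty$ almost surely, and $\mathbb P_t\approx\mathcal F$ in the following sense. The expression $\mathcal F$ is exactly what results from $\mathbb P_t$ on replacing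 the distribution function $F_{m_t}$ of the normalized Gamma law (shape and rate $m_t$) by $x\mapsto(1-e^{-\eta_tx})^{m_t}$, i.e. $$\mathcal F=\mathbb E\big[1-(1-e^{-\eta_tT})^{m_t}\big],\qquad T=\frac{\Upsilon(I_t+\sigma^2)}{P_bP_t(\mathbf x_B)};$$ it is an upper bound for the coverage probability; and its error is at most the largest error of that replacement: $$0\le\mathcal F-\mathbb P_t\le\sup_{x>0}\Big(F_{m_t}(x)-(1-e^{-\eta_tx})^{m_t}\Big).$$ -/

import Mathlib

open MeasureTheory ProbabilityTheory Set
open scoped ENNReal NNReal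

namespace RISNoma

noncomputable section

/-- The plane in which users, surfaces and base stations are located. -/
abbrev Plane : Type := EuclideanSpace ℝ (Fin 2)

/-! ### Special functions -/

/-- The Gauss hypergeometric function `₂F₁(a, b; c; z)` for real `z < 1`.  For `-1 < z < 1` it is
the hypergeometric series (Mathlib's `ordinaryHypergeometric`, which is meaningful only there); for
`z ≤ -1` it is the analytic continuation of that series along the negative axis, written through
Pfaff's transformation, whose argument `z / (z - 1)` then lies in `[1/2, 1)`. -/
def gaussHyp (a b c z : ℝ) : ℝ :=
  if -1 < z then ordinaryHypergeometric a b c z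
  else (1 - z) ^ (-a) * ordinaryHypergeometric a (c - b) c (z / (z - 1))

/-- The constant `η = m (m!)^(-1/m)`. -/
def eta (m : ℕ) : ℝ := (m : ℝ) * (Nat.factorial m : ℝ) ^ (-(1 / (m : ℝ)))

/-- The largest difference on `(0, ∞)` between the distribution function of the normalized Gamma
law (shape `m`, rate `m`, hence mean one) and the function `(1 - exp (-η x)) ^ m` replacing it. -/
def gammaGap (m : ℕ) : ℝ :=
  ⨆ x : Ioi (0 : ℝ),
    (cdf (gammaMeasure m m) (x : ℝ) - (1 - Real.exp (-(eta m * (x : ℝ)))) ^ m)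

/-! ### Poisson point process and fading -/

/-- Number of points of the (enumerated) configuration `x` in the set `B`. -/
def count {E : Type*} (x : ℕ → E) (B : Set E) : ℕ∞ := {i | x i ∈ B}.encard

/-- The random points `X 0, X 1, …` enumerate a Poisson point process of intensity measure `Λ`:
numbers of points in sets of finite intensity are Poisson distributed, and numbers of points in
disjoint sets are independent.  (The process has infinitely many points, as it must when `Λ` is
a diffuse measure of infinite total mass, finite on bounded sets.) -/
structure IsPoissonProcess {Ω E : Type*} [MeasurableSpace Ω] [MeasurableSpace E]
    (X : ℕ → Ω → E) (Λ : Measure E) (P : Measure Ω) : Prop where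
  measurable : ∀ i, Measurable (X i)
  poisson : ∀ B : Set E, MeasurableSet B → Λ B < ∞ → ∀ k : ℕ,
    P {ω | count (fun i => X i ω) B = k} = poissonMeasure (Λ B).toNNReal {k}
  indep : ∀ (n : ℕ) (B : Fin n → Set E), (∀ j, MeasurableSet (B j)) → (∀ j, Λ (B j) < ∞) →
    (Pairwise fun j k => Disjoint (B j) (B k)) →
    iIndepFun (fun j ω => count (fun i => X i ω) (B j)) P

/-- Independent Nakagami-`m` fading coefficients with unit mean power: the power gains `|h i|²`
have the Gamma law with shape `m` and rate `m`. -/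
structure IsNakagamiFading {Ω : Type*} [MeasurableSpace Ω]
    (m : ℕ) (h : ℕ → Ω → ℂ) (P : Measure Ω) : Prop where
  measurable : ∀ i, Measurable (h i)
  law : ∀ i, P.map (fun ω => ‖h i ω‖ ^ 2) = gammaMeasure m m
  indep : iIndepFun h P

/-! ### Parameters of the network -/

/-- Deterministic parameters. -/
structure Params where
  /-- density of base stations -/
  lam : ℝ
  lam_pos : 0 < lam
  /-- radius of the disc around the typical user in which the surface lies -/
  RL : ℝ
  RL_pos : 0 < RL
  /-- half-length of the surface -/
  L : ℝ
  L_pos : 0 < L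
  /-- fraction of the angle base station - surface - user that is the angle of incidence -/
  rhoA : ℝ
  rhoA_pos : 0 < rhoA
  rhoA_lt : rhoA < 1
  /-- path loss exponent of the reflected links -/
  alphaT : ℝ
  alphaT_gt : 2 < alphaT
  /-- fraction of the interference that reaches the typical user -/
  rhoT : ℝ
  rhoT_nonneg : 0 ≤ rhoT
  rhoT_le : rhoT ≤ 1
  /-- transmit power -/
  Pb : ℝ
  Pb_pos : 0 < Pb
  /-- standard deviation of the noise -/
  sigma : ℝ
  sigma_pos : 0 < sigma
  /-- power share of the typical user -/
  aT : ℝ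
  aT_pos : 0 < aT
  /-- power share of the connected user -/
  aC : ℝ
  aT_lt_aC : aT < aC
  aC_add_aT : aC + aT = 1
  /-- threshold of the interference cancellation step -/
  thSIC : ℝ
  thSIC_pos : 0 < thSIC
  thSIC_lt : thSIC * aT < aC
  /-- decoding threshold of the typical user -/
  thT : ℝ
  thT_pos : 0 < thT
  /-- intercept of the direct link of the connected user -/
  C : ℝ
  C_pos : 0 < C
  /-- path loss exponent of the direct link -/
  alphaC : ℝ
  alphaC_pos : 0 < alphaC
  /-- distance between the connected user and its base station -/
  rC : ℝ
  rC_pos : 0 < rC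
  /-- Nakagami parameter at the typical user -/
  mT : ℕ
  mT_pos : 1 ≤ mT
  /-- Nakagami parameter at the connected user -/
  mC : ℕ
  mC_pos : 1 ≤ mC

namespace Params

variable (p : Params)

/-- Angle average of the squared coefficient
`(L / (4 π)) * (cos (θ_incidence) + cos (θ_reflection))` of the surface, where
`θ_incidence = rhoA * θ`, `θ_reflection = (1 - rhoA) * θ` and `θ` is uniform on `(0, π)`. -/
def meanC : ℝ :=
  (1 / Real.pi) * ∫ θ in (0 : ℝ)..Real.pi,
    (p.L / (4 * Real.pi) * (Real.cos (p.rhoA * θ) + Real.cos ((1 - p.rhoA) * θ))) ^ 2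

/-- Path loss from a base station at `x` to the typical user at the origin, through the surface
at `z` (product-of-distances model, averaged over the angles). -/
def lossT (x z : Plane) : ℝ := p.meanC * (dist x z * ‖z‖) ^ (-p.alphaT)

/-- Path loss of the direct link from a base station at `x` to the connected user at `y`. -/
def lossC (x y : Plane) : ℝ := p.C * dist x y ^ (-p.alphaC)

end Params

/-! ### Powers and signal-to-interference-plus-noise ratios

Here `x` is the configuration of base stations, `z` the position of the surface, `y` the
position of the connected user, `h` and `g` are the fading coefficients at the typical user and at
the connected user. Interference and ratios are valued in `[0, ∞]`. -/

/-- Index of the base station nearest to the surface (the associated base station). -/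
def serving (x : ℕ → Plane) (z : Plane) : ℕ := sInf {i | ∀ j, dist (x i) z ≤ dist (x j) z}

namespace Params

variable (p : Params)

/-- Power received by the typical user from its base station, before power allocation. -/
def signalT (x : ℕ → Plane) (z : Plane) (h : ℕ → ℂ) : ℝ :=
  p.Pb * ‖h (serving x z)‖ ^ 2 * p.lossT (x (serving x z)) z

/-- Interference at the typical user. -/
def interfT (x : ℕ → Plane) (z : Plane) (h : ℕ → ℂ) : ℝ≥0∞ :=
  ENNReal.ofReal p.rhoT * ∑' i : ℕ, if i = serving x z then 0 else
    ENNReal.ofReal (p.Pb * ‖h i‖ ^ 2 * p.lossT (x i) z)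

/-- Ratio of the interference cancellation step at the typical user. -/
def sinrSIC (x : ℕ → Plane) (z : Plane) (h : ℕ → ℂ) : ℝ≥0∞ :=
  ENNReal.ofReal (p.aC * p.signalT x z h) /
    (ENNReal.ofReal (p.aT * p.signalT x z h) + p.interfT x z h + ENNReal.ofReal (p.sigma ^ 2))

/-- Ratio with which the typical user decodes its own data. -/
def sinrT (x : ℕ → Plane) (z : Plane) (h : ℕ → ℂ) : ℝ≥0∞ :=
  ENNReal.ofReal (p.aT * p.signalT x z h) / (p.interfT x z h + ENNReal.ofReal (p.sigma ^ 2))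

/-- Ratio of the typical user in the orthogonal scenario. -/
def omaT (x : ℕ → Plane) (z : Plane) (h : ℕ → ℂ) : ℝ≥0∞ :=
  ENNReal.ofReal (p.signalT x z h) / (p.interfT x z h + ENNReal.ofReal (p.sigma ^ 2))

/-- Interference at the connected user. -/
def interfC (x : ℕ → Plane) (z y : Plane) (g : ℕ → ℂ) : ℝ≥0∞ :=
  ∑' i : ℕ, if i = serving x z then 0 else
    ENNReal.ofReal (p.Pb * ‖g i‖ ^ 2 * p.lossC (x i) y)

/-- Ratio of the connected user in the orthogonal scenario. -/
def omaC (x : ℕ → Plane) (z y : Plane) (g : ℕ → ℂ) : ℝ≥0∞ :=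
  ENNReal.ofReal (p.Pb * ‖g (serving x z)‖ ^ 2 * p.lossC (x (serving x z)) y) /
    (p.interfC x z y g + ENNReal.ofReal (p.sigma ^ 2))

end Params

/-! ### The random network -/

/-- A random network with parameters `p` on the probability space `(Ω, P)`: `X` enumerates the base
stations, `Z` is the position of the surface, `Y` that of the connected user, `h` and `g` are the
fading coefficients at the typical and at the connected user. -/
structure Network (p : Params) {Ω : Type*} [MeasurableSpace Ω] (P : Measure Ω) where
  X : ℕ → Ω → Plane
  Z : Ω → Plane
  Y : Ω → Plane
  h : ℕ → Ω → ℂ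
  g : ℕ → Ω → ℂ
  /-- The base stations form a homogeneous Poisson process of density `lam`. -/
  poisson : IsPoissonProcess X (ENNReal.ofReal p.lam • (volume : Measure Plane)) P
  /-- The surface is uniformly distributed in the disc of radius `RL` around the typical user. -/
  measurable_Z : Measurable Z
  uniform_Z : pdf.IsUniform Z (Metric.ball (0 : Plane) p.RL) P volume
  /-- The connected user is at distance `rC` from the associated base station. -/
  measurable_Y : Measurable Y
  dist_Y : ∀ᵐ ω ∂P, dist (X (serving (fun i => X i ω) (Z ω)) ω) (Y ω) = p.rC
  nakagami_h : IsNakagamiFading p.mT h P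
  nakagami_g : IsNakagamiFading p.mC g P
  /-- The surface is placed independently of the base stations, the fading is independent of all
  positions, and the fading coefficients at the two users are independent. -/
  indep_XZ : IndepFun (fun ω i => X i ω) Z P
  indep_h : IndepFun (fun ω i => h i ω) (fun ω => ((fun i => X i ω), Z ω, Y ω)) P
  indep_g : IndepFun (fun ω i => g i ω)
    (fun ω => ((fun i => X i ω), Z ω, Y ω, (fun i => h i ω))) P

namespace Network

variable {p : Params} {Ω : Type*} [MeasurableSpace Ω] {P : Measure Ω} (N : Network p P)

/-- Interference at the typical user. -/
def interf (ω : Ω) : ℝ≥0∞ := p.interfT (fun i => N.X i ω) (N.Z ω) (fun i => N.h i ω)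

/-- Mean ratio of the connected user in the orthogonal scenario. -/
def meanOmaC : ℝ≥0∞ :=
  ∫⁻ ω, p.omaC (fun i => N.X i ω) (N.Z ω) (N.Y ω) (fun i => N.g i ω) ∂P

/-- Coverage probability of the typical user: interference cancellation succeeds, its own data are
decoded, and its orthogonal ratio exceeds the mean orthogonal ratio of the connected user. -/
def coverage : ℝ :=
  P.real {ω |
    ENNReal.ofReal p.thSIC < p.sinrSIC (fun i => N.X i ω) (N.Z ω) (fun i => N.h i ω) ∧
    ENNReal.ofReal p.thT < p.sinrT (fun i => N.X i ω) (N.Z ω) (fun i => N.h i ω) ∧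
    N.meanOmaC < p.omaT (fun i => N.X i ω) (N.Z ω) (fun i => N.h i ω)}

/-- The overall threshold `Υ`. -/
def upsilon : ℝ :=
  max (max (p.thSIC / (p.aC - p.thSIC * p.aT)) (p.thT / p.aT)) N.meanOmaC.toReal

/-- The level `Υ (I + σ²) / (P_b P_RIS)` with which the fading gain of the associated base station
is compared. -/
def level (ω : Ω) : ℝ :=
  N.upsilon * ((N.interf ω).toReal + p.sigma ^ 2) /
    (p.Pb * p.lossT (N.X (serving (fun i => N.X i ω) (N.Z ω)) ω) (N.Z ω))

/-- `β₁` (for the summand `n`). -/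
def beta1 (n : ℕ) : ℝ := n * eta p.mT * N.upsilon * p.sigma ^ 2 / (p.Pb * p.meanC)

/-- `β₀` (for the summand `n`). -/
def beta0 (n : ℕ) (y : ℝ) : ℝ := N.beta1 n * y ^ p.alphaT

/-- `β₂` (for the summand `n`). -/
def beta2 (n : ℕ) : ℝ :=
  Real.pi * p.lam * gaussHyp (-(2 / p.alphaT)) p.mT (1 - 2 / p.alphaT)
    (-(p.rhoT * n * eta p.mT * N.upsilon / p.mT))

/-- Density of the distance between the surface and the typical user, on `[0, RL]`. -/
def densityRU (_N : Network p P) (y : ℝ) : ℝ := 2 * y / p.RL ^ 2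

/-- The analytic expression for the coverage probability. -/
def formula : ℝ :=
  2 * Real.pi * p.lam * ∫ y in (0 : ℝ)..p.RL,
    (∫ x in Ioi (0 : ℝ), ∑ n ∈ Finset.Icc 1 p.mT,
      (-1 : ℝ) ^ (n + 1) * (p.mT.choose n : ℝ) * x *
        Real.exp (-(N.beta0 n y * x ^ p.alphaT)) * Real.exp (-(N.beta2 n * x ^ 2))) *
      N.densityRU y

end Network

end

end RISNoma

namespace RISNoma

noncomputable section

open Filter Topology

/-! ### The exponential `x ↦ exp (-x)` on `[0, ∞]` -/

/-! Almost surely each of the three coverage inequalities is linear in the signal `S`; the one for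
`γ_SIC` can be solved because `a_t γ_SIC^th < a_c`. Together they say that the gain of the serving
station exceeds the level `T` (`ae_coverage_iff`). Given the positions, this gain is independent of
`T` and has the Gamma law, so coverage equals `E[1 - F_m(T)]` (`coverage_eq`). Alzer's inequality
`(1 - e^{-ηx})^m ≤ F_m(x)` then gives the upper bound, and the pointwise gap bounds the error.

It remains to compute `E[1 - (1 - e^{-ηT})^m]`. The binomial theorem turns it into an alternating
sum of Laplace transforms `E e^{-nηT}`, each evaluated by three successive averages
(`integral_exp_neg_level`).

Fading: the Gamma Laplace transform gives each interferer a factor `(1 + κ u^{-α})^{-m}`, where `u`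
is its distance to the surface relative to that of the serving station; the distance from surface to
user survives only in the noise term.

Base stations: given the nearest distance `r`, the other points act as a Poisson process outside the
disc of radius `r`. No Palm calculus is used: the nearest distance is discretized, the event that a
disc is empty is put into the Laplace functional by letting the integrand be `∞` there, and the mesh
tends to zero (`lintegral_interfererFactor`). By scaling, the interferers contribute
`exp(-πλ(G-1)r²)`; with the Rayleigh law of `r` this makes `exp(-πλG r²)`. That `G` is the
hypergeometric value follows from a first-order differential equation satisfied by both branches of
`gaussHyp` (`integral_eq_gaussHyp`).

Surface: its distance to the user has density `2y/R²`.

Alzer's inequality is proved by a sign argument: the difference of the two sides vanishes at `0` and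
at `∞`, and by Jensen's inequality its derivative, once negative, never becomes positive again. -/

/-- The function `x ↦ exp (-x)` on `[0, ∞]`, with value `0` at `∞`. -/
def expNeg (x : ℝ≥0∞) : ℝ≥0∞ := EReal.exp (-(x : EReal))

@[simp] lemma expNeg_zero : expNeg 0 = 1 := by simp [expNeg]

@[simp] lemma expNeg_top : expNeg ∞ = 0 := by simp [expNeg]

lemma expNeg_coe (x : ℝ≥0) : expNeg x = ENNReal.ofReal (Real.exp (-x)) := by
  have : -(((x : ℝ≥0∞)) : EReal) = ((-(x : ℝ) : ℝ) : EReal) := by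
    rw [EReal.coe_neg]; rfl
  rw [expNeg, this, EReal.exp_coe]

lemma expNeg_ofReal {x : ℝ} (hx : 0 ≤ x) :
    expNeg (ENNReal.ofReal x) = ENNReal.ofReal (Real.exp (-x)) := by
  rw [ENNReal.ofReal, expNeg_coe, Real.coe_toNNReal _ hx]

lemma expNeg_of_ne_top {x : ℝ≥0∞} (hx : x ≠ ∞) :
    expNeg x = ENNReal.ofReal (Real.exp (-x.toReal)) := by
  rw [← expNeg_ofReal ENNReal.toReal_nonneg, ENNReal.ofReal_toReal hx]

lemma expNeg_add (x y : ℝ≥0∞) : expNeg (x + y) = expNeg x * expNeg y := by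
  rw [expNeg, EReal.coe_ennreal_add, EReal.neg_add, sub_eq_add_neg, EReal.exp_add, expNeg, expNeg]
  · exact Or.inl (EReal.coe_ennreal_ne_bot _)
  · exact Or.inr (EReal.coe_ennreal_ne_bot _)

lemma expNeg_antitone : Antitone expNeg := fun x y h => by
  simpa [expNeg] using h

lemma expNeg_le_one (x : ℝ≥0∞) : expNeg x ≤ 1 := by
  simpa using expNeg_antitone (zero_le (a := x))

lemma expNeg_ne_top (x : ℝ≥0∞) : expNeg x ≠ ∞ := ((expNeg_le_one x).trans_lt (by simp)).ne

lemma continuous_expNeg : Continuous expNeg :=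
  EReal.expHomeomorph.continuous.comp (continuous_neg.comp continuous_coe_ennreal_ereal)

lemma measurable_expNeg : Measurable expNeg := continuous_expNeg.measurable

lemma expNeg_sum {ι : Type*} (s : Finset ι) (f : ι → ℝ≥0∞) :
    expNeg (∑ i ∈ s, f i) = ∏ i ∈ s, expNeg (f i) := by
  induction s using Finset.cons_induction with
  | empty => simp
  | cons a s ha ih => rw [Finset.sum_cons, Finset.prod_cons, expNeg_add, ih]

lemma expNeg_mul_natCast (c : ℝ≥0∞) (k : ℕ) : expNeg (c * k) = expNeg c ^ k := by
  induction k with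
  | zero => simp
  | succ k ih => rw [Nat.cast_succ, mul_add, mul_one, expNeg_add, ih, pow_succ]

lemma one_sub_expNeg_le (x : ℝ≥0∞) : 1 - expNeg x ≤ x := by
  by_cases hx : x = ∞
  · simp [hx]
  · rw [expNeg_of_ne_top hx, ← ENNReal.ofReal_one, ← ENNReal.ofReal_sub _ (Real.exp_nonneg _)]
    refine ENNReal.ofReal_le_of_le_toReal ?_
    have := Real.add_one_le_exp (-x.toReal)
    linarith

/-! ### Counts of points -/

lemma tsum_indicator_one_eq_count {E : Type*} (x : ℕ → E) (B : Set E) :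
    ∑' i, B.indicator (1 : E → ℝ≥0∞) (x i) = ((count x B : ℕ∞) : ℝ≥0∞) := by
  have : ∀ i, B.indicator (1 : E → ℝ≥0∞) (x i) = ({i | x i ∈ B} : Set ℕ).indicator 1 i := by
    intro i; simp [indicator]
  simp_rw [this]
  rw [← tsum_subtype]
  simp [count]

variable {Ω E : Type*} [MeasurableSpace Ω] [MeasurableSpace E] {X : ℕ → Ω → E} {Λ : Measure E}
  {P : Measure Ω}

lemma measurable_tsum_comp (hX : ∀ i, Measurable (X i)) {f : E → ℝ≥0∞} (hf : Measurable f) :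
    Measurable fun ω => ∑' i, f (X i ω) :=
  Measurable.tsum fun i => hf.comp (hX i)

lemma measurable_count (hX : ∀ i, Measurable (X i)) {B : Set E} (hB : MeasurableSet B) :
    Measurable fun ω => count (fun i => X i ω) B := by
  refine measurable_to_countable' fun n => ?_
  have h := measurable_tsum_comp hX (measurable_one.indicator hB : Measurable (B.indicator (1 : E → ℝ≥0∞)))
  simp_rw [tsum_indicator_one_eq_count (fun i => X i _)] at h
  have : (fun ω => count (fun i => X i ω) B) ⁻¹' {n} =
      (fun ω => ((count (fun i => X i ω) B : ℕ∞) : ℝ≥0∞)) ⁻¹' {(n : ℝ≥0∞)} := by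
    ext ω; simp
  rw [this]
  exact h (measurableSet_singleton _)

/-- Finite expectation formula: the law of a count is a Poisson law on `ℕ`. -/
lemma lintegral_count [IsProbabilityMeasure P] (h : IsPoissonProcess X Λ P) {B : Set E}
    (hB : MeasurableSet B) (hΛ : Λ B < ∞) (F : ℕ∞ → ℝ≥0∞) :
    ∫⁻ ω, F (count (fun i => X i ω) B) ∂P = ∑' k : ℕ, F k * poissonMeasure (Λ B).toNNReal {k} := by
  have hm := measurable_count h.measurable hB
  have hk : ∀ k : ℕ, P.map (fun ω => count (fun i => X i ω) B) {(k : ℕ∞)} =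
      poissonMeasure (Λ B).toNNReal {k} := fun k => by
    rw [Measure.map_apply hm (measurableSet_singleton _), ← h.poisson B hB hΛ k]; rfl
  -- An infinite count is null because the Poisson masses on `ℕ` already sum to one.
  have htop : P.map (fun ω => count (fun i => X i ω) B) {(⊤ : ℕ∞)} = 0 := by
    have hU : P.map (fun ω => count (fun i => X i ω) B) (⋃ k : ℕ, {(k : ℕ∞)}) = 1 := by
      rw [measure_iUnion (fun i j hij => by simpa using hij) (fun _ => measurableSet_singleton _)]
      simp_rw [hk]
      rw [← measure_iUnion (fun i j hij => by simpa using hij) (fun _ => measurableSet_singleton _),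
        iUnion_of_singleton, measure_univ]
    have := Measure.isProbabilityMeasure_map (μ := P) hm.aemeasurable
    rw [← prob_compl_eq_zero_iff (MeasurableSet.iUnion fun _ => measurableSet_singleton _)] at hU
    refine measure_mono_null ?_ hU
    simp
  rw [← lintegral_map (f := F) (measurable_from_top) hm, lintegral_countable']
  symm
  refine Function.Injective.tsum_eq (g := ((↑) : ℕ → ℕ∞)) Nat.cast_injective
    (f := fun n => F n * P.map (fun ω => count (fun i => X i ω) B) {n}) ?_ |>.symm ▸ ?_
  · intro n hn
    induction n with
    | top => simp [htop] at hn
    | coe n => exact ⟨n, rfl⟩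
  · simp_rw [hk]

/-- The generating function of the Poisson law at `q = e^{-c}`. The value `c = ∞` is allowed and
yields the void probability. -/
lemma lintegral_expNeg_count [IsProbabilityMeasure P] (h : IsPoissonProcess X Λ P) {B : Set E}
    (hB : MeasurableSet B) (hΛ : Λ B < ∞) (c : ℝ≥0∞) :
    ∫⁻ ω, expNeg (c * (count (fun i => X i ω) B : ℕ∞)) ∂P = expNeg ((1 - expNeg c) * Λ B) := by
  rw [lintegral_count h hB hΛ (fun n => expNeg (c * n))]
  set q := (expNeg c).toReal
  have hq1 : q ≤ 1 := ENNReal.toReal_le_of_le_ofReal zero_le_one (by simpa using expNeg_le_one c)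
  have hq : expNeg c = ENNReal.ofReal q := (ENNReal.ofReal_toReal (expNeg_ne_top c)).symm
  have hq0 : 0 ≤ q := ENNReal.toReal_nonneg
  set r := (Λ B).toReal
  have hr0 : 0 ≤ r := ENNReal.toReal_nonneg
  have hr : Λ B = ENNReal.ofReal r := (ENNReal.ofReal_toReal hΛ.ne).symm
  have hrn : (((Λ B).toNNReal : ℝ≥0) : ℝ) = r := rfl
  have : ∀ k : ℕ, expNeg (c * ((k : ℕ∞) : ℝ≥0∞)) * poissonMeasure (Λ B).toNNReal {k} =
      ENNReal.ofReal (Real.exp (-r) * ((r * q) ^ k / (Nat.factorial k : ℝ))) := fun k => by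
    rw [poissonMeasure_singleton, ENat.toENNReal_coe, expNeg_mul_natCast, hq,
      ← ENNReal.ofReal_pow hq0, hrn, ← ENNReal.ofReal_mul (by positivity)]
    congr 1
    rw [mul_pow]; ring
  simp_rw [this]
  have hs : HasSum (fun k : ℕ => Real.exp (-r) * ((r * q) ^ k / (Nat.factorial k : ℝ)))
      (Real.exp (-r) * Real.exp (r * q)) := by
    refine HasSum.mul_left _ ?_
    rw [Real.exp_eq_exp_ℝ]
    exact NormedSpace.expSeries_div_hasSum_exp (r * q)
  rw [← ENNReal.ofReal_tsum_of_nonneg (fun k => by positivity) hs.summable, hs.tsum_eq, hq, hr,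
    ← ENNReal.ofReal_one, ← ENNReal.ofReal_sub _ hq0, ← ENNReal.ofReal_mul (by linarith),
    expNeg_ofReal (mul_nonneg (by linarith) hr0), ← Real.exp_add]
  congr 2; ring

end

end RISNoma

namespace RISNoma

noncomputable section

open Filter Topology

/-! ### The Laplace functional of a Poisson process -/

variable {Ω E : Type*} [MeasurableSpace Ω] [MeasurableSpace E] {X : ℕ → Ω → E} {Λ : Measure E}
  {P : Measure Ω}

/-- The sum over the points is a finite combination of counts in disjoint level sets, so
independence factors the exponential into Poisson generating functions. The level set of `0` may
have infinite intensity but contributes nothing. -/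
lemma lintegral_expNeg_tsum_simpleFunc [IsProbabilityMeasure P] (h : IsPoissonProcess X Λ P)
    (φ : SimpleFunc E ℝ≥0∞) (hφ : ∀ c, c ≠ 0 → Λ (φ ⁻¹' {c}) < ∞) :
    ∫⁻ ω, expNeg (∑' i, φ (X i ω)) ∂P = expNeg (∫⁻ x, (1 - expNeg (φ x)) ∂Λ) := by
  classical
  set s := φ.range.filter (· ≠ 0) with hs
  set n := s.card
  let c : Fin n → ℝ≥0∞ := fun j => (s.equivFin.symm j : ℝ≥0∞)
  have hc : ∀ j, c j ≠ 0 := fun j => (Finset.mem_filter.1 (s.equivFin.symm j).2).2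
  have hcinj : Function.Injective c := fun i j hij =>
    s.equivFin.symm.injective (Subtype.ext hij)
  let B : Fin n → Set E := fun j => φ ⁻¹' {c j}
  have hB : ∀ j, MeasurableSet (B j) := fun j => φ.measurableSet_preimage _
  have hBfin : ∀ j, Λ (B j) < ∞ := fun j => hφ _ (hc j)
  have hdisj : Pairwise fun j k => Disjoint (B j) (B k) := fun j k hjk =>
    Disjoint.preimage _ (by simpa using hcinj.ne hjk)
  have hdecomp : ∀ (F : ℝ≥0∞ → ℝ≥0∞), F 0 = 0 → ∀ x,
      F (φ x) = ∑ j, F (c j) * (B j).indicator (1 : E → ℝ≥0∞) x := by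
    intro F hF x
    by_cases hx : φ x = 0
    · rw [hx, hF, eq_comm]
      refine Finset.sum_eq_zero fun j _ => ?_
      have : x ∉ B j := fun hxj => hc j (by rw [← hx]; exact hxj.symm)
      simp [this]
    · have hxs : φ x ∈ s := Finset.mem_filter.2 ⟨SimpleFunc.mem_range_self φ x, hx⟩
      have hcj : c (s.equivFin ⟨φ x, hxs⟩) = φ x := by simp [c]
      rw [Finset.sum_eq_single (s.equivFin ⟨φ x, hxs⟩)]
      · rw [hcj, indicator_of_mem (by simp [B, hcj])]; simp
      · intro j _ hj
        have : x ∉ B j := fun hxj => hj (hcinj (by rw [hcj]; exact hxj.symm))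
        simp [this]
      · simp
  have hsum : ∀ ω, ∑' i, φ (X i ω) =
      ∑ j, c j * ((count (fun i => X i ω) (B j) : ℕ∞) : ℝ≥0∞) := fun ω => by
    rw [tsum_congr fun i => hdecomp (fun t => t) rfl (X i ω), Summable.tsum_finsetSum (fun _ _ => ENNReal.summable)]
    refine Finset.sum_congr rfl fun j _ => ?_
    rw [ENNReal.tsum_mul_left, tsum_indicator_one_eq_count (fun i => X i ω)]
  simp_rw [hsum, expNeg_sum]
  have hind := h.indep n B hB hBfin hdisj
  have hind' := hind.comp (fun j (k : ℕ∞) => expNeg (c j * (k : ℝ≥0∞))) (fun j => measurable_from_top)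
  have := lintegral_prod_eq_prod_lintegral_of_indepFun Finset.univ _ hind'
    (fun j => measurable_from_top.comp (measurable_count h.measurable (hB j)))
  simp only [Function.comp_def] at this
  rw [this]
  simp_rw [fun j => lintegral_expNeg_count h (hB j) (hBfin j) (c j)]
  rw [← expNeg_sum]
  congr 1
  simp_rw [fun x => hdecomp (fun t => 1 - expNeg t) (by simp) x]
  rw [lintegral_finsetSum _ (fun j _ => (measurable_one.indicator (hB j)).const_mul _)]
  refine Finset.sum_congr rfl fun j _ => ?_
  rw [lintegral_const_mul _ (measurable_one.indicator (hB j)), lintegral_indicator_one (hB j)]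

/-- The Laplace functional of a Poisson process; `f` may take the value `∞`. -/
theorem lintegral_expNeg_tsum [IsProbabilityMeasure P] [SigmaFinite Λ]
    (h : IsPoissonProcess X Λ P) {f : E → ℝ≥0∞} (hf : Measurable f) :
    ∫⁻ ω, expNeg (∑' i, f (X i ω)) ∂P = expNeg (∫⁻ x, (1 - expNeg (f x)) ∂Λ) := by
  -- Cutting off to spanning sets gives the nonzero level sets finite intensity.
  let φ : ℕ → SimpleFunc E ℝ≥0∞ := fun n =>
    (SimpleFunc.eapprox f n).restrict (spanningSets Λ n)
  have hφapp : ∀ n x, φ n x = (spanningSets Λ n).indicator (SimpleFunc.eapprox f n) x := fun n x => by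
    rw [SimpleFunc.restrict_apply _ (measurableSet_spanningSets Λ n)]
  have hmono : ∀ x, Monotone fun n => φ n x := fun x m n hmn => by
    simp only [hφapp]
    refine (indicator_le_indicator_of_subset (monotone_spanningSets Λ hmn) (fun _ => zero_le) x).trans ?_
    exact indicator_le_indicator (SimpleFunc.monotone_eapprox f hmn x)
  have htend : ∀ x, Tendsto (fun n => φ n x) atTop (𝓝 (f x)) := fun x => by
    have h1 : Tendsto (fun n => SimpleFunc.eapprox f n x) atTop (𝓝 (f x)) :=
      SimpleFunc.tendsto_eapprox hf x
    refine h1.congr' ?_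
    filter_upwards [eventually_ge_atTop (spanningSetsIndex Λ x)] with n hn
    rw [hφapp, indicator_of_mem (mem_spanningSets_of_index_le Λ x hn)]
  have hfin : ∀ n c, c ≠ 0 → Λ (φ n ⁻¹' {c}) < ∞ := fun n c hc =>
    (measure_mono fun x hx => by
      by_contra hxs
      apply hc
      have : φ n x = c := hx
      rw [← this, hφapp, indicator_of_notMem hxs]).trans_lt (measure_spanningSets_lt_top Λ n)
  have hL : Tendsto (fun n => ∫⁻ ω, expNeg (∑' i, φ n (X i ω)) ∂P) atTop
      (𝓝 (∫⁻ ω, expNeg (∑' i, f (X i ω)) ∂P)) := by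
    refine tendsto_lintegral_of_dominated_convergence (fun _ => 1)
      (fun n => measurable_expNeg.comp (measurable_tsum_comp h.measurable (φ n).measurable))
      (fun n => ae_of_all _ fun ω => expNeg_le_one _) (by simp) (ae_of_all _ fun ω => ?_)
    refine (continuous_expNeg.tendsto _).comp ?_
    -- The series over the points becomes an integral against counting measure, so that monotone
    -- convergence applies.
    simp_rw [← MeasureTheory.lintegral_count]
    exact lintegral_tendsto_of_tendsto_of_monotone (fun n => measurable_from_top.aemeasurable)
      (ae_of_all _ fun i => hmono (X i ω)) (ae_of_all _ fun i => htend (X i ω))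
  have hR : Tendsto (fun n => expNeg (∫⁻ x, (1 - expNeg (φ n x)) ∂Λ)) atTop
      (𝓝 (expNeg (∫⁻ x, (1 - expNeg (f x)) ∂Λ))) := by
    refine (continuous_expNeg.tendsto _).comp ?_
    refine lintegral_tendsto_of_tendsto_of_monotone
      (fun n => (measurable_const.sub (measurable_expNeg.comp (φ n).measurable)).aemeasurable)
      (ae_of_all _ fun x m n hmn => tsub_le_tsub_left (expNeg_antitone (hmono x hmn)) _)
      (ae_of_all _ fun x => ?_)
    exact ENNReal.Tendsto.sub tendsto_const_nhds ((continuous_expNeg.tendsto _).comp (htend x))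
      (Or.inl ENNReal.one_ne_top)
  simp_rw [fun n => lintegral_expNeg_tsum_simpleFunc h (φ n) (hfin n)] at hL
  exact tendsto_nhds_unique hL hR

/-- If `E exp (-t Y)` tends to one as `t` tends to zero, then `Y` is almost surely finite. -/
lemma ae_lt_top_of_le_lintegral_expNeg [IsProbabilityMeasure P] {Y : Ω → ℝ≥0∞} (hY : Measurable Y)
    {K : ℝ≥0∞} (hK : K ≠ ∞)
    (hle : ∀ n : ℕ, expNeg ((n + 1 : ℝ≥0∞)⁻¹ * K) ≤ ∫⁻ ω, expNeg ((n + 1 : ℝ≥0∞)⁻¹ * Y ω) ∂P) :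
    ∀ᵐ ω ∂P, Y ω < ∞ := by
  have hm : MeasurableSet {ω | Y ω = ∞} := hY (measurableSet_singleton _)
  -- For `t > 0` the variable `exp(-tY)` vanishes where `Y = ∞`, so its mean is at most `P(Y < ∞)`.
  -- Since `K` is finite, the lower bound tends to one as `t` tends to zero.
  have hb : ∀ n : ℕ, expNeg ((n + 1 : ℝ≥0∞)⁻¹ * K) ≤ P {ω | Y ω = ∞}ᶜ := fun n => by
    refine (hle n).trans ?_
    rw [← lintegral_indicator_one hm.compl]
    refine lintegral_mono fun ω => ?_
    by_cases hω : Y ω = ∞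
    · have : ω ∉ {ω | Y ω = ∞}ᶜ := by simpa using hω
      simp [hω, ENNReal.mul_top]
    · have : ω ∈ {ω | Y ω = ∞}ᶜ := hω
      simpa [this] using expNeg_le_one _
  have hlim : Tendsto (fun n : ℕ => expNeg ((n + 1 : ℝ≥0∞)⁻¹ * K)) atTop (𝓝 (expNeg (0 * K))) := by
    refine (continuous_expNeg.tendsto _).comp ?_
    refine ENNReal.Tendsto.mul_const ?_ (Or.inr hK)
    have := (ENNReal.tendsto_inv_nat_nhds_zero).comp (tendsto_add_atTop_nat 1)
    refine this.congr fun n => ?_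
    simp
  have h1 : 1 ≤ P {ω | Y ω = ∞}ᶜ := by
    refine le_of_tendsto' (x := atTop) ?_ hb
    simpa using hlim
  have : P {ω | Y ω = ∞}ᶜ = 1 := le_antisymm prob_le_one h1
  rw [prob_compl_eq_one_iff hm] at this
  rw [ae_iff]
  simpa using this

/-- By `1 - e^{-x} ≤ x` the Laplace functional of `t f` is at least `exp(-t ∫ f dΛ)`, which tends to
one with `t → 0`. -/
lemma ae_tsum_lt_top [IsProbabilityMeasure P] [SigmaFinite Λ]
    (h : IsPoissonProcess X Λ P) {f : E → ℝ≥0∞} (hf : Measurable f) (hfin : ∫⁻ x, f x ∂Λ ≠ ∞) :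
    ∀ᵐ ω ∂P, ∑' i, f (X i ω) < ∞ := by
  refine ae_lt_top_of_le_lintegral_expNeg (measurable_tsum_comp h.measurable hf) hfin fun n => ?_
  simp_rw [← ENNReal.tsum_mul_left]
  rw [lintegral_expNeg_tsum h (hf.const_mul _), ← lintegral_const_mul _ hf]
  exact expNeg_antitone (lintegral_mono fun x => one_sub_expNeg_le _)

end

end RISNoma

namespace RISNoma

noncomputable section

open Filter Topology

/-! ### The homogeneous planar process -/

/-- The measure of intensity `lam` on the plane. -/
abbrev planeIntensity (lam : ℝ) : Measure Plane := ENNReal.ofReal lam • volume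

instance sigmaFinite_planeIntensity (lam : ℝ) : SigmaFinite (planeIntensity lam) :=
  inferInstanceAs (SigmaFinite ((Real.toNNReal lam : ℝ≥0) • (volume : Measure Plane)))

lemma volume_ball_plane (z : Plane) {r : ℝ} (hr : 0 ≤ r) :
    volume (Metric.ball z r) = ENNReal.ofReal (Real.pi * r ^ 2) := by
  rw [EuclideanSpace.volume_ball_fin_two, ← ENNReal.ofReal_pow hr, ← ENNReal.ofReal_mul (by positivity),
    mul_comm]

lemma planeIntensity_ball {lam : ℝ} (hlam : 0 ≤ lam) (z : Plane) {r : ℝ} (hr : 0 ≤ r) :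
    planeIntensity lam (Metric.ball z r) = ENNReal.ofReal (lam * Real.pi * r ^ 2) := by
  rw [Measure.smul_apply, volume_ball_plane z hr, smul_eq_mul, ← ENNReal.ofReal_mul hlam, mul_assoc]

/-- Area scales quadratically; hence the interferers' exponent is proportional to the square of the
nearest distance. -/
lemma lintegral_comp_dist_div (ψ : ℝ → ℝ≥0∞) (z : Plane) {s : ℝ} (hs : 0 < s) :
    ∫⁻ x, ψ (dist x z / s) = ENNReal.ofReal (s ^ 2) * ∫⁻ x : Plane, ψ ‖x‖ := by
  have h1 : ∫⁻ x : Plane, ψ (dist x z / s) = ∫⁻ x : Plane, ψ (‖x‖ / s) := by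
    simp_rw [dist_eq_norm]
    exact lintegral_sub_right_eq_self (fun x : Plane => ψ (‖x‖ / s)) z
  have h2 := Measure.map_addHaar_smul (volume : Measure Plane) (inv_ne_zero hs.ne')
  have he : MeasurableEmbedding (fun x : Plane => s⁻¹ • x) :=
    (Homeomorph.smulOfNeZero s⁻¹ (inv_ne_zero hs.ne')).measurableEmbedding
  have h3 : ∫⁻ x : Plane, ψ (‖x‖ / s) = ∫⁻ x, ψ ‖x‖ ∂(volume.map (fun x : Plane => s⁻¹ • x)) := by
    rw [he.lintegral_map]
    refine lintegral_congr fun x => ?_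
    rw [norm_smul, Real.norm_of_nonneg (inv_nonneg.2 hs.le), div_eq_inv_mul]
  rw [h1, h3, show (fun x : Plane => s⁻¹ • x) = (s⁻¹ • · : Plane → Plane) from rfl, h2, lintegral_smul_measure]
  congr 2
  simp only [finrank_euclideanSpace, Fintype.card_fin]
  rw [abs_of_pos (by positivity)]
  field_simp

variable {Ω E : Type*} [MeasurableSpace Ω] [MeasurableSpace E] {Λ : Measure E}
  {P : Measure Ω} {lam : ℝ}

/-- Infimum of the distances of the points of a configuration to `z`. -/
def minDist (x : ℕ → Plane) (z : Plane) : ℝ := ⨅ i, dist (x i) z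

lemma le_minDist_iff {x : ℕ → Plane} {z : Plane} {a : ℝ} :
    a ≤ minDist x z ↔ ∀ i, a ≤ dist (x i) z :=
  le_ciInf_iff ⟨0, by rintro _ ⟨i, rfl⟩; exact dist_nonneg⟩

lemma minDist_nonneg (x : ℕ → Plane) (z : Plane) : 0 ≤ minDist x z :=
  le_minDist_iff.2 fun _ => dist_nonneg

lemma measurable_minDist : Measurable fun q : (ℕ → Plane) × Plane => minDist q.1 q.2 := by
  refine measurable_of_Ici fun a => ?_
  have : (fun q : (ℕ → Plane) × Plane => minDist q.1 q.2) ⁻¹' Ici a =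
      ⋂ i, {q | a ≤ dist (q.1 i) q.2} := by
    ext q; simp [le_minDist_iff]
  rw [this]
  refine MeasurableSet.iInter fun i => measurableSet_le measurable_const ?_
  fun_prop

/-- The Poisson mass at `k + 2` is at most `Λ(B)²` times the mass at `k`. Being quadratic, the bound
becomes negligible when summed over a fine partition. -/
lemma measure_two_le_count {X : ℕ → Ω → E} [IsProbabilityMeasure P]
    (h : IsPoissonProcess X Λ P) {B : Set E} (hB : MeasurableSet B) (hΛ : Λ B < ∞) :
    P {ω | 2 ≤ count (fun i => X i ω) B} ≤ Λ B ^ 2 := by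
  have hm : MeasurableSet {ω | 2 ≤ count (fun i => X i ω) B} :=
    measurable_count h.measurable hB (MeasurableSet.of_discrete (s := Ici (2 : ℕ∞)))
  have h1 := lintegral_count h hB hΛ (fun n => if 2 ≤ n then 1 else 0)
  have h2 : ∫⁻ ω, (if 2 ≤ count (fun i => X i ω) B then 1 else 0) ∂P =
      P {ω | 2 ≤ count (fun i => X i ω) B} := by
    rw [← lintegral_indicator_one hm]
    refine lintegral_congr fun ω => ?_
    by_cases hω : 2 ≤ count (fun i => X i ω) B <;> simp [hω]
  rw [← h2, h1, tsum_eq_zero_add' ENNReal.summable, tsum_eq_zero_add' ENNReal.summable]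
  simp only [Nat.cast_zero, zero_add, Nat.cast_one, nonpos_iff_eq_zero, OfNat.ofNat_ne_zero,
    if_false, zero_mul]
  rw [if_neg (by norm_num), zero_mul, zero_add]
  set r := (Λ B).toNNReal
  have hr : Λ B = ENNReal.ofReal r := by
    rw [ENNReal.ofReal_coe_nnreal, ENNReal.coe_toNNReal hΛ.ne]
  calc ∑' k : ℕ, (if (2 : ℕ∞) ≤ ((k + 1 + 1 : ℕ) : ℕ∞) then (1 : ℝ≥0∞) else 0) * poissonMeasure r {k + 1 + 1}
      ≤ ∑' k : ℕ, Λ B ^ 2 * poissonMeasure r {k} := by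
        refine ENNReal.tsum_le_tsum fun k => ?_
        rw [if_pos (by norm_cast; omega), one_mul, poissonMeasure_singleton, poissonMeasure_singleton,
          hr, ← ENNReal.ofReal_pow (by positivity), ← ENNReal.ofReal_mul (by positivity)]
        refine ENNReal.ofReal_le_ofReal ?_
        rw [mul_div_assoc, mul_div_assoc, mul_left_comm]
        refine mul_le_mul_of_nonneg_left ?_ (Real.exp_nonneg _)
        rw [← mul_div_assoc, ← pow_add, add_comm 2 k]
        refine div_le_div_of_nonneg_left (by positivity) (by positivity) ?_
        exact_mod_cast Nat.factorial_le (by omega)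
    _ = Λ B ^ 2 := by
        rw [ENNReal.tsum_mul_left,
          ← measure_iUnion (fun i j hij => by simpa using hij) (fun _ => measurableSet_singleton _),
          iUnion_of_singleton, measure_univ, mul_one]

lemma two_le_count {F : Type*} {x : ℕ → F} {B : Set F} {i j : ℕ} (hij : i ≠ j) (hi : x i ∈ B) (hj : x j ∈ B) :
    2 ≤ count x B := by
  rw [count, ← Set.encard_pair hij]
  refine Set.encard_le_encard ?_
  rintro k (rfl | rfl)
  exacts [hi, hj]

variable {X : ℕ → Ω → Plane}

lemma ae_finite_ball [IsProbabilityMeasure P] (hlam : 0 ≤ lam)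
    (h : IsPoissonProcess X (planeIntensity lam) P) (z : Plane) :
    ∀ᵐ ω ∂P, ∀ M : ℕ, {i | dist (X i ω) z < M}.Finite := by
  refine ae_all_iff.2 fun M => ?_
  have hf : Measurable ((Metric.ball z M).indicator (1 : Plane → ℝ≥0∞)) :=
    measurable_one.indicator Metric.isOpen_ball.measurableSet
  have := ae_tsum_lt_top h hf (by
    rw [lintegral_indicator_one Metric.isOpen_ball.measurableSet,
      planeIntensity_ball hlam z (Nat.cast_nonneg M)]
    exact ENNReal.ofReal_ne_top)
  filter_upwards [this] with ω hω
  rw [tsum_indicator_one_eq_count (fun i => X i ω)] at hω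
  rw [← Set.encard_lt_top_iff]
  simpa [count] using hω

/-- The function equal to `∞` at `z` and `0` elsewhere has integral zero, yet a single point at `z`
would make its sum infinite. -/
lemma ae_ne_center [IsProbabilityMeasure P]
    (h : IsPoissonProcess X (planeIntensity lam) P) (z : Plane) :
    ∀ᵐ ω ∂P, ∀ i, X i ω ≠ z := by
  have hf : Measurable (({z} : Set Plane).indicator (fun _ => ∞ : Plane → ℝ≥0∞)) :=
    measurable_const.indicator (measurableSet_singleton z)
  have := ae_tsum_lt_top h hf (by
    rw [lintegral_indicator_const (measurableSet_singleton z), Measure.smul_apply]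
    simp)
  filter_upwards [this] with ω hω i hi
  have := (ENNReal.le_tsum i).trans_lt hω
  simp [hi] at this

/-- Cut a disc around `z` into `n + 1` annuli of equal area. Two equidistant points lie in the same
annulus, which has probability at most `(n + 1)(c/(n + 1))²`, and this tends to zero. Consequently
the nearest point is unique. -/
lemma ae_injective_dist [IsProbabilityMeasure P] (hlam : 0 ≤ lam)
    (h : IsPoissonProcess X (planeIntensity lam) P) (z : Plane) :
    ∀ᵐ ω ∂P, ∀ i j, i ≠ j → dist (X i ω) z ≠ dist (X j ω) z := by
  have key : ∀ M : ℕ, P {ω | ∃ i j, i ≠ j ∧ dist (X i ω) z = dist (X j ω) z ∧ dist (X i ω) z ^ 2 < M} = 0 := by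
    intro M
    set c : ℝ := lam * Real.pi * M
    have hc : 0 ≤ c := by positivity
    have hb : ∀ n : ℕ, P {ω | ∃ i j, i ≠ j ∧ dist (X i ω) z = dist (X j ω) z ∧ dist (X i ω) z ^ 2 < M} ≤
        ENNReal.ofReal (c ^ 2 / (n + 1)) := by
      intro n
      let a : ℕ → ℝ := fun k => M * k / (n + 1)
      have ha : ∀ k, 0 ≤ a k := fun k => by positivity
      have hmono : ∀ k, a k ≤ a (k + 1) := fun k => by
        simp only [a]; gcongr; norm_num
      let B : ℕ → Set Plane := fun k =>
        Metric.ball z (Real.sqrt (a (k + 1))) \ Metric.ball z (Real.sqrt (a k))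
      have hB : ∀ k, MeasurableSet (B k) := fun k =>
        Metric.isOpen_ball.measurableSet.diff Metric.isOpen_ball.measurableSet
      have hΛ : ∀ k, planeIntensity lam (B k) = ENNReal.ofReal (c / (n + 1)) := fun k => by
        rw [measure_sdiff (Metric.ball_subset_ball (Real.sqrt_le_sqrt (hmono k)))
          Metric.isOpen_ball.measurableSet.nullMeasurableSet
          (by rw [planeIntensity_ball hlam z (Real.sqrt_nonneg _)]; exact ENNReal.ofReal_ne_top),
          planeIntensity_ball hlam z (Real.sqrt_nonneg _), planeIntensity_ball hlam z (Real.sqrt_nonneg _),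
          Real.sq_sqrt (ha _), Real.sq_sqrt (ha _), ← ENNReal.ofReal_sub _ (by have := ha k; positivity)]
        congr 1
        simp only [a, c]
        push_cast
        field_simp
        ring
      have hsub : {ω | ∃ i j, i ≠ j ∧ dist (X i ω) z = dist (X j ω) z ∧ dist (X i ω) z ^ 2 < M} ⊆
          ⋃ k ∈ Finset.range (n + 1), {ω | 2 ≤ count (fun i => X i ω) (B k)} := by
        rintro ω ⟨i, j, hij, hd, hM⟩
        have hM0 : (0 : ℝ) < M := (sq_nonneg _).trans_lt hM
        set t : ℝ := dist (X i ω) z ^ 2 * (n + 1) / M with ht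
        have ht0 : 0 ≤ t := by positivity
        have hk1 : a ⌊t⌋₊ ≤ dist (X i ω) z ^ 2 := by
          have := Nat.floor_le ht0
          simp only [a]
          rw [div_le_iff₀ (by positivity)]
          calc (M : ℝ) * ⌊t⌋₊ ≤ M * t := by gcongr
            _ = _ := by rw [ht]; field_simp
        have hk2 : dist (X i ω) z ^ 2 < a (⌊t⌋₊ + 1) := by
          have := Nat.lt_floor_add_one t
          simp only [a]
          rw [lt_div_iff₀ (by positivity)]
          calc dist (X i ω) z ^ 2 * (n + 1) = M * t := by rw [ht]; field_simp
            _ < M * ((⌊t⌋₊ + 1 : ℕ) : ℝ) := by push_cast; gcongr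
        have hmem : ∀ l, dist (X l ω) z = dist (X i ω) z → X l ω ∈ B ⌊t⌋₊ := fun l hl => by
          refine ⟨?_, ?_⟩
          · rw [Metric.mem_ball, hl]
            exact Real.lt_sqrt_of_sq_lt hk2
          · rw [Metric.mem_ball, hl, not_lt]
            exact Real.sqrt_le_iff.2 ⟨dist_nonneg, hk1⟩
        refine mem_biUnion (x := ⌊t⌋₊) ?_ (two_le_count hij (hmem i rfl) (hmem j hd.symm))
        simp only [Finset.coe_range, mem_Iio]
        rw [Nat.floor_lt ht0, ht, div_lt_iff₀ hM0]
        push_cast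
        rw [mul_comm]
        gcongr
      calc _ ≤ P (⋃ k ∈ Finset.range (n + 1), {ω | 2 ≤ count (fun i => X i ω) (B k)}) := measure_mono hsub
        _ ≤ ∑ k ∈ Finset.range (n + 1), P {ω | 2 ≤ count (fun i => X i ω) (B k)} :=
          measure_biUnion_finset_le _ _
        _ ≤ ∑ k ∈ Finset.range (n + 1), ENNReal.ofReal (c / (n + 1)) ^ 2 := by
          refine Finset.sum_le_sum fun k _ => ?_
          rw [← hΛ k]
          exact measure_two_le_count h (hB k) (by rw [hΛ]; exact ENNReal.ofReal_lt_top)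
        _ = ENNReal.ofReal (c ^ 2 / (n + 1)) := by
          rw [Finset.sum_const, Finset.card_range, nsmul_eq_mul, ← ENNReal.ofReal_pow (by positivity),
            ← ENNReal.ofReal_natCast, ← ENNReal.ofReal_mul (by positivity)]
          congr 1
          push_cast
          field_simp
    refine le_antisymm (ge_of_tendsto' (x := atTop) ?_ hb) zero_le
    rw [← ENNReal.ofReal_zero]
    refine (ENNReal.continuous_ofReal.tendsto _).comp ?_
    exact tendsto_const_div_atTop_nhds_zero_nat (c ^ 2) |>.comp (tendsto_add_atTop_nat 1) |>.congr
      fun n => by simp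
  have h2 : ∀ᵐ ω ∂P, ∀ M : ℕ, ¬ ∃ i j, i ≠ j ∧ dist (X i ω) z = dist (X j ω) z ∧ dist (X i ω) z ^ 2 < M :=
    ae_all_iff.2 fun M => by rw [ae_iff]; simpa using key M
  filter_upwards [h2] with ω hω i j hij hd
  obtain ⟨M, hM⟩ := exists_nat_gt (dist (X i ω) z ^ 2)
  exact hω M ⟨i, j, hij, hd, hM⟩

/-- Local finiteness makes the infimum attained; without a minimizer, `serving` would be the default
value `sInf ∅ = 0`. -/
lemma dist_serving {x : ℕ → Plane} {z : Plane} (hfin : ∀ M : ℕ, {i | dist (x i) z < M}.Finite) :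
    dist (x (serving x z)) z = minDist x z := by
  obtain ⟨M, hM⟩ := exists_nat_gt (dist (x 0) z)
  obtain ⟨i, hi, hmin⟩ := Set.exists_min_image _ (fun i => dist (x i) z) (hfin M) ⟨0, hM⟩
  have hne : {i | ∀ j, dist (x i) z ≤ dist (x j) z}.Nonempty := by
    refine ⟨i, fun j => ?_⟩
    by_cases hj : dist (x j) z < M
    · exact hmin j hj
    · exact (le_of_lt hi).trans (not_lt.1 hj)
  have hs : ∀ j, dist (x (serving x z)) z ≤ dist (x j) z := Nat.sInf_mem hne
  exact le_antisymm (le_minDist_iff.2 hs) (le_minDist_iff.1 le_rfl _)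

/-- The power `d^{-α}` is not integrable near `z`. The first-moment criterion is applied to `(1 +
d)^{-α}`, integrable since `α` exceeds the dimension; this dominates the points at distance at least
one up to the factor `2^α`, and only finitely many points are closer. -/
lemma ae_tsum_dist_rpow_lt_top [IsProbabilityMeasure P] (hlam : 0 ≤ lam)
    (h : IsPoissonProcess X (planeIntensity lam) P) (z : Plane) {α : ℝ} (hα : 2 < α) :
    ∀ᵐ ω ∂P, ∑' i, ENNReal.ofReal (dist (X i ω) z ^ (-α)) < ∞ := by
  have hf : Measurable fun x : Plane => ENNReal.ofReal ((1 + dist x z) ^ (-α)) := by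
    fun_prop
  have hint : ∫⁻ x, ENNReal.ofReal ((1 + dist x z) ^ (-α)) ∂(planeIntensity lam) ≠ ∞ := by
    rw [lintegral_smul_measure]
    refine ENNReal.mul_ne_top ENNReal.ofReal_ne_top ?_
    simp_rw [dist_eq_norm]
    rw [lintegral_sub_right_eq_self (fun x : Plane => ENNReal.ofReal ((1 + ‖x‖) ^ (-α))) z]
    exact (finite_integral_one_add_norm (by simpa using hα)).ne
  filter_upwards [ae_tsum_lt_top h hf hint, ae_finite_ball hlam h z] with ω hω hfin
  have hle : ∀ i, ENNReal.ofReal (dist (X i ω) z ^ (-α)) ≤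
      {i | dist (X i ω) z < (1 : ℕ)}.indicator (fun i => ENNReal.ofReal (dist (X i ω) z ^ (-α))) i +
        ENNReal.ofReal (2 ^ α) * ENNReal.ofReal ((1 + dist (X i ω) z) ^ (-α)) := fun i => by
    by_cases hi : dist (X i ω) z < 1
    · rw [indicator_of_mem (by simpa using hi)]
      exact le_self_add
    · push Not at hi
      rw [← ENNReal.ofReal_mul (by positivity)]
      refine le_trans (ENNReal.ofReal_le_ofReal ?_) le_add_self
      have : (2 : ℝ) ^ α = (1 / 2) ^ (-α) := by
        rw [Real.rpow_neg (by norm_num), one_div, Real.inv_rpow (by norm_num), inv_inv]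
      rw [this, ← Real.mul_rpow (by norm_num) (by positivity)]
      refine Real.rpow_le_rpow_of_nonpos (by positivity) ?_ (by linarith)
      linarith
  refine (ENNReal.tsum_le_tsum hle).trans_lt ?_
  rw [ENNReal.tsum_add, ENNReal.tsum_mul_left]
  refine ENNReal.add_lt_top.2 ⟨?_, ENNReal.mul_lt_top ENNReal.ofReal_lt_top hω⟩
  rw [tsum_eq_sum (s := (hfin 1).toFinset) (fun i hi => indicator_of_notMem (by simpa using hi) _)]
  exact ENNReal.sum_lt_top.2 fun i _ =>
    (indicator_le_self' (f := fun i => ENNReal.ofReal (dist (X i ω) z ^ (-α)))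
      (fun _ _ => zero_le) i).trans_lt ENNReal.ofReal_lt_top

end

end RISNoma

namespace RISNoma

noncomputable section

open Filter Topology

/-! ### The configuration seen from its point nearest to `z` -/

variable {Ω : Type*} [MeasurableSpace Ω] {P : Measure Ω} {lam : ℝ} {X : ℕ → Ω → Plane}

/-- `∫ (1 - exp (-f ‖x‖)) dx` over the complement of the unit disc. -/
def outerIntegral (f : ℝ → ℝ≥0∞) : ℝ≥0∞ :=
  ∫⁻ x : Plane, if 1 ≤ ‖x‖ then 1 - expNeg (f ‖x‖) else 0

/-- The factor contributed by the points at distance at least `s` from `z`. -/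
def outerFactor (f : ℝ → ℝ≥0∞) (z : Plane) (s : ℝ) (x : ℕ → Plane) : ℝ≥0∞ :=
  expNeg (∑' i, if s ≤ dist (x i) z then f (dist (x i) z / s) else 0)

lemma measurable_outerFactor {f : ℝ → ℝ≥0∞} (hf : Measurable f) (z : Plane) :
    Measurable fun q : ℝ × (ℕ → Plane) => outerFactor f z q.1 q.2 := by
  refine measurable_expNeg.comp (Measurable.tsum fun i => ?_)
  refine Measurable.ite (measurableSet_le measurable_fst (by fun_prop)) ?_ measurable_const
  refine hf.comp (Measurable.div ?_ measurable_fst)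
  fun_prop

lemma measurable_minDist_comp (hX : ∀ i, Measurable (X i)) (z : Plane) :
    Measurable fun ω => minDist (fun i => X i ω) z := by
  have h1 : Measurable fun ω => ((fun i => X i ω : ℕ → Plane), z) :=
    (measurable_pi_iff.2 hX).prodMk measurable_const
  have h2 := measurable_minDist.comp h1
  exact h2

/-- The event is absorbed into the Laplace functional by giving the integrand the value `∞` on the
disc of radius `a`, where a single point kills the exponential. As `a ≤ s`, the exponent splits into
the intensity of that disc and a rescaled outer integral. -/
lemma setLIntegral_outerFactor [IsProbabilityMeasure P] (hlam : 0 ≤ lam)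
    (h : IsPoissonProcess X (planeIntensity lam) P) {f : ℝ → ℝ≥0∞} (hf : Measurable f) (z : Plane)
    {a s : ℝ} (ha : 0 ≤ a) (has : a ≤ s) (hs : 0 < s) :
    ∫⁻ ω in {ω | a ≤ minDist (fun i => X i ω) z}, outerFactor f z s (fun i => X i ω) ∂P =
      expNeg (ENNReal.ofReal (lam * Real.pi * a ^ 2)) *
        expNeg (ENNReal.ofReal (lam * s ^ 2) * outerIntegral f) := by
  have hm : MeasurableSet {ω | a ≤ minDist (fun i => X i ω) z} :=
    measurableSet_le measurable_const (measurable_minDist_comp h.measurable z)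
  let F : Plane → ℝ≥0∞ := fun x => if dist x z < a then ∞ else
    if s ≤ dist x z then f (dist x z / s) else 0
  have hF : Measurable F := by
    refine Measurable.ite (measurableSet_lt (by fun_prop) measurable_const) measurable_const ?_
    refine Measurable.ite (measurableSet_le measurable_const (by fun_prop)) ?_ measurable_const
    exact hf.comp (by fun_prop)
  have hl : ∀ ω, {ω | a ≤ minDist (fun i => X i ω) z}.indicator
      (fun ω => outerFactor f z s (fun i => X i ω)) ω = expNeg (∑' i, F (X i ω)) := fun ω => by
    by_cases hω : a ≤ minDist (fun i => X i ω) z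
    · rw [indicator_of_mem (by exact hω), outerFactor]
      congr 1
      refine tsum_congr fun i => ?_
      simp only [F]
      rw [if_neg (not_lt.2 (le_minDist_iff.1 hω i))]
    · rw [indicator_of_notMem (by exact hω)]
      rw [le_minDist_iff] at hω
      push Not at hω
      obtain ⟨i, hi⟩ := hω
      have : ∑' i, F (X i ω) = ∞ := by
        refine top_unique (le_trans ?_ (ENNReal.le_tsum i))
        simp [F, hi]
      rw [this, expNeg_top]
  rw [← lintegral_indicator hm, lintegral_congr hl, lintegral_expNeg_tsum h hF, ← expNeg_add]
  congr 1
  let ψ : ℝ → ℝ≥0∞ := fun u => if 1 ≤ u then 1 - expNeg (f u) else 0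
  have hdec : ∀ x, 1 - expNeg (F x) = (Metric.ball z a).indicator 1 x + ψ (dist x z / s) := fun x => by
    by_cases hx : dist x z < a
    · have h1 : ¬ 1 ≤ dist x z / s := by
        rw [le_div_iff₀ hs, one_mul]; linarith
      rw [indicator_of_mem (by simpa using hx)]
      simp [F, ψ, hx, h1]
    · rw [indicator_of_notMem (by simpa using hx)]
      by_cases hxs : s ≤ dist x z
      · have h1 : 1 ≤ dist x z / s := by rwa [le_div_iff₀ hs, one_mul]
        simp [F, ψ, hx, hxs, h1]
      · have h1 : ¬ 1 ≤ dist x z / s := by rwa [le_div_iff₀ hs, one_mul]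
        simp [F, ψ, hx, hxs, h1]
  simp_rw [hdec]
  rw [lintegral_add_left (measurable_one.indicator Metric.isOpen_ball.measurableSet),
    lintegral_indicator_one Metric.isOpen_ball.measurableSet, planeIntensity_ball hlam z ha,
    lintegral_smul_measure, lintegral_comp_dist_div ψ z hs, smul_eq_mul, ← mul_assoc,
    ← ENNReal.ofReal_mul hlam]
  rfl

/-- The void probability, as the case `f = 0`; the outer radius `a + 1` only has to be positive. -/
lemma measure_le_minDist [IsProbabilityMeasure P] (hlam : 0 ≤ lam)
    (h : IsPoissonProcess X (planeIntensity lam) P) (z : Plane) {a : ℝ} (ha : 0 ≤ a) :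
    P {ω | a ≤ minDist (fun i => X i ω) z} = expNeg (ENNReal.ofReal (lam * Real.pi * a ^ 2)) := by
  have := setLIntegral_outerFactor hlam h (f := fun _ => 0) measurable_const z ha
    (le_add_of_nonneg_right zero_le_one) (by positivity : 0 < a + 1)
  simpa [outerFactor, outerIntegral] using this

/-- Subtract the identity on `{s ≤ minDist}` from the one on `{a ≤ minDist}`: both carry the same
outer factor. -/
lemma setLIntegral_outerFactor_slab [IsProbabilityMeasure P] (hlam : 0 ≤ lam)
    (h : IsPoissonProcess X (planeIntensity lam) P) {f : ℝ → ℝ≥0∞} (hf : Measurable f) (z : Plane)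
    {a s : ℝ} (ha : 0 ≤ a) (has : a < s) :
    ∫⁻ ω in {ω | a ≤ minDist (fun i => X i ω) z ∧ minDist (fun i => X i ω) z < s},
        outerFactor f z s (fun i => X i ω) ∂P =
      expNeg (ENNReal.ofReal (lam * s ^ 2) * outerIntegral f) *
        P {ω | a ≤ minDist (fun i => X i ω) z ∧ minDist (fun i => X i ω) z < s} := by
  have hs : 0 < s := ha.trans_lt has
  have hmd := measurable_minDist_comp h.measurable z
  have hU : {ω | a ≤ minDist (fun i => X i ω) z} =
      {ω | a ≤ minDist (fun i => X i ω) z ∧ minDist (fun i => X i ω) z < s} ∪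
        {ω | s ≤ minDist (fun i => X i ω) z} := by
    ext ω
    simp only [mem_ofPred_eq, mem_union]
    constructor
    · intro h1
      exact (lt_or_ge (minDist (fun i => X i ω) z) s).imp (fun h2 => ⟨h1, h2⟩) id
    · rintro (h1 | h1)
      exacts [h1.1, has.le.trans h1]
  have hd : Disjoint {ω | a ≤ minDist (fun i => X i ω) z ∧ minDist (fun i => X i ω) z < s}
        {ω | s ≤ minDist (fun i => X i ω) z} := by
    rw [Set.disjoint_left]
    rintro ω ⟨_, h1⟩ h2
    exact absurd h1 (not_lt.2 h2)
  have hms : MeasurableSet {ω | s ≤ minDist (fun i => X i ω) z} := measurableSet_le measurable_const hmd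
  have h1 := setLIntegral_outerFactor hlam h hf z ha has.le hs
  have h2 := setLIntegral_outerFactor hlam h hf z hs.le le_rfl hs
  rw [← measure_le_minDist hlam h z ha, hU, lintegral_union hms hd, measure_union hd hms, h2,
    ← measure_le_minDist hlam h z hs.le, add_mul] at h1
  rw [mul_comm (expNeg _)]
  refine (ENNReal.add_left_inj ?_).1 h1
  exact ENNReal.mul_ne_top (measure_ne_top _ _) (expNeg_ne_top _)

lemma lintegral_eq_tsum_fiber {K : Ω → ℕ} (hK : Measurable K) (H : Ω → ℝ≥0∞) :
    ∫⁻ ω, H ω ∂P = ∑' k, ∫⁻ ω in K ⁻¹' {k}, H ω ∂P := by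
  rw [← lintegral_iUnion (fun k => hK (measurableSet_singleton k))
    (fun i j hij => Disjoint.preimage _ (by simpa using hij)), ← preimage_iUnion,
    iUnion_of_singleton, preimage_univ, setLIntegral_univ]

/-- The least multiple of `1 / (n + 1)` that exceeds `r`. -/
def gridAbove (n : ℕ) (r : ℝ) : ℝ := (⌊r * (n + 1)⌋₊ + 1 : ℝ) / (n + 1)

lemma measurable_gridAbove (n : ℕ) : Measurable (gridAbove n) := by
  unfold gridAbove
  have : Measurable fun r : ℝ => ⌊r * (n + 1)⌋₊ := Nat.measurable_floor.comp (by fun_prop)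
  have h2 : Measurable fun r : ℝ => (⌊r * (n + 1)⌋₊ : ℝ) := measurable_from_top.comp this
  fun_prop

lemma lt_gridAbove (n : ℕ) (r : ℝ) : r < gridAbove n r := by
  rw [gridAbove, lt_div_iff₀ (by positivity)]
  exact Nat.lt_floor_add_one _

lemma gridAbove_le (n : ℕ) {r : ℝ} (hr : 0 ≤ r) : gridAbove n r ≤ r + 1 / (n + 1) := by
  rw [gridAbove, add_div]
  gcongr
  rw [div_le_iff₀ (by positivity)]
  exact Nat.floor_le (by positivity)

lemma tendsto_gridAbove {r : ℝ} (hr : 0 ≤ r) : Tendsto (fun n => gridAbove n r) atTop (𝓝 r) := by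
  refine tendsto_of_tendsto_of_tendsto_of_le_of_le tendsto_const_nhds ?_
    (fun n => (lt_gridAbove n r).le) (fun n => gridAbove_le n hr)
  simpa using tendsto_const_nhds.add (tendsto_one_div_add_atTop_nhds_zero_nat (𝕜 := ℝ))

/-- Discrete conditioning on the nearest distance: between consecutive grid values the outer radius
is constant, so the slab identity applies there. -/
lemma lintegral_outerFactor_gridAbove [IsProbabilityMeasure P] (hlam : 0 ≤ lam)
    (h : IsPoissonProcess X (planeIntensity lam) P) {f : ℝ → ℝ≥0∞} (hf : Measurable f) (z : Plane)
    (g : ℝ → ℝ≥0∞) (n : ℕ) :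
    ∫⁻ ω, g (gridAbove n (minDist (fun i => X i ω) z)) *
        outerFactor f z (gridAbove n (minDist (fun i => X i ω) z)) (fun i => X i ω) ∂P =
      ∫⁻ ω, g (gridAbove n (minDist (fun i => X i ω) z)) *
        expNeg (ENNReal.ofReal (lam * gridAbove n (minDist (fun i => X i ω) z) ^ 2) *
          outerIntegral f) ∂P := by
  have hmd := measurable_minDist_comp h.measurable z
  have hK : Measurable fun ω => ⌊minDist (fun i => X i ω) z * (n + 1)⌋₊ :=
    Nat.measurable_floor.comp (by fun_prop)
  rw [lintegral_eq_tsum_fiber hK, lintegral_eq_tsum_fiber hK (P := P)]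
  refine tsum_congr fun k => ?_
  have hset : (fun ω => ⌊minDist (fun i => X i ω) z * (n + 1)⌋₊) ⁻¹' {k} =
      {ω | (k : ℝ) / (n + 1) ≤ minDist (fun i => X i ω) z ∧
        minDist (fun i => X i ω) z < ((k : ℝ) + 1) / (n + 1)} := by
    ext ω
    simp only [mem_preimage, mem_singleton_iff, mem_ofPred_eq]
    rw [Nat.floor_eq_iff (mul_nonneg (minDist_nonneg _ _) (by positivity)),
      div_le_iff₀ (by positivity), lt_div_iff₀ (by positivity)]
  have hgrid : ∀ ω ∈ (fun ω => ⌊minDist (fun i => X i ω) z * (n + 1)⌋₊) ⁻¹' {k},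
      gridAbove n (minDist (fun i => X i ω) z) = ((k : ℝ) + 1) / (n + 1) := fun ω hω => by
    have : ⌊minDist (fun i => X i ω) z * (n + 1)⌋₊ = k := hω
    rw [gridAbove, this]
  have hm := hK (measurableSet_singleton k)
  have hW : Measurable fun ω => outerFactor f z (((k : ℝ) + 1) / (n + 1)) (fun i => X i ω) :=
    (measurable_outerFactor hf z).comp
      (measurable_const.prodMk (measurable_pi_iff.2 h.measurable))
  trans ∫⁻ ω in (fun ω => ⌊minDist (fun i => X i ω) z * (n + 1)⌋₊) ⁻¹' {k},
    g (((k : ℝ) + 1) / (n + 1)) * outerFactor f z (((k : ℝ) + 1) / (n + 1)) (fun i => X i ω) ∂P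
  · exact setLIntegral_congr_fun hm fun ω hω => by simp only [hgrid ω hω]
  trans ∫⁻ ω in (fun ω => ⌊minDist (fun i => X i ω) z * (n + 1)⌋₊) ⁻¹' {k},
    g (((k : ℝ) + 1) / (n + 1)) *
      expNeg (ENNReal.ofReal (lam * (((k : ℝ) + 1) / (n + 1)) ^ 2) * outerIntegral f) ∂P
  · rw [lintegral_const_mul _ hW, lintegral_const, Measure.restrict_apply_univ, hset,
      setLIntegral_outerFactor_slab hlam h hf z (by positivity) (by gcongr; linarith), mul_assoc]
  · exact setLIntegral_congr_fun hm fun ω hω => by simp only [hgrid ω hω]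

/-- The factor contributed by the interferers, relative to the distance of the nearest point. -/
def interfererFactor (f : ℝ → ℝ≥0∞) (z : Plane) (x : ℕ → Plane) : ℝ≥0∞ :=
  expNeg (∑' i, if i = serving x z then 0 else f (dist (x i) z / dist (x (serving x z)) z))

/-- This is the identity at the grid radius, in the limit of vanishing mesh. The grid radius lies
strictly above the nearest distance, which excludes the nearest point for every mesh; any other
point is strictly farther and is eventually included. The decay of `f` dominates the series inside
the exponential. -/
theorem lintegral_interfererFactor [IsProbabilityMeasure P] (hlam : 0 ≤ lam)
    (h : IsPoissonProcess X (planeIntensity lam) P) {f : ℝ → ℝ≥0∞} (hf : Measurable f)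
    (hfc : ∀ u, 0 < u → ContinuousAt f u) {C α : ℝ} (hC : 0 ≤ C) (hα : 2 < α)
    (hfb : ∀ u, 0 < u → f u ≤ ENNReal.ofReal (C * u ^ (-α))) (z : Plane)
    {g : ℝ → ℝ≥0∞} (hg : Measurable g) (hgc : ∀ u, 0 < u → ContinuousAt g u) (hg1 : ∀ u, g u ≤ 1)
    (hout : outerIntegral f ≠ ∞) :
    ∫⁻ ω, g (minDist (fun i => X i ω) z) * interfererFactor f z (fun i => X i ω) ∂P =
      ∫⁻ ω, g (minDist (fun i => X i ω) z) *
        expNeg (ENNReal.ofReal (lam * minDist (fun i => X i ω) z ^ 2) * outerIntegral f) ∂P := by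
  have hmd := measurable_minDist_comp h.measurable z
  have hgood : ∀ᵐ ω ∂P, 0 < minDist (fun i => X i ω) z ∧
      (∀ i, i ≠ serving (fun i => X i ω) z → minDist (fun i => X i ω) z < dist (X i ω) z) ∧
      dist (X (serving (fun i => X i ω) z) ω) z = minDist (fun i => X i ω) z ∧
      ∑' i, ENNReal.ofReal (dist (X i ω) z ^ (-α)) < ∞ := by
    filter_upwards [ae_finite_ball hlam h z, ae_ne_center h z, ae_injective_dist hlam h z,
      ae_tsum_dist_rpow_lt_top hlam h z hα] with ω h1 h2 h3 h4
    have h5 := dist_serving (x := fun i => X i ω) h1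
    refine ⟨?_, fun i hi => ?_, h5, h4⟩
    · rw [← h5]; exact dist_pos.2 (h2 _)
    · refine lt_of_le_of_ne (le_minDist_iff.1 le_rfl i) ?_
      rw [← h5]
      exact h3 _ _ hi.symm
  have hgr : Measurable fun ω => (fun n => gridAbove n (minDist (fun i => X i ω) z)) :=
    measurable_pi_iff.2 fun n => (measurable_gridAbove n).comp hmd
  have hL : Tendsto (fun n => ∫⁻ ω, g (gridAbove n (minDist (fun i => X i ω) z)) *
        outerFactor f z (gridAbove n (minDist (fun i => X i ω) z)) (fun i => X i ω) ∂P) atTop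
      (𝓝 (∫⁻ ω, g (minDist (fun i => X i ω) z) * interfererFactor f z (fun i => X i ω) ∂P)) := by
    refine tendsto_lintegral_of_dominated_convergence (fun _ => 1)
      (fun n => (hg.comp ((measurable_gridAbove n).comp hmd)).mul
        ((measurable_outerFactor hf z).comp (((measurable_gridAbove n).comp hmd).prodMk
          (measurable_pi_iff.2 h.measurable))))
      (fun n => ae_of_all _ fun ω => mul_le_one' (hg1 _) (expNeg_le_one _)) (by simp) ?_
    filter_upwards [hgood] with ω ⟨h0, h1, h2, h3⟩
    set r := minDist (fun i => X i ω) z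
    refine ENNReal.Tendsto.mul ((hgc r h0).tendsto.comp (tendsto_gridAbove h0.le))
      (Or.inr (expNeg_ne_top _)) ?_ (Or.inr ((hg1 r).trans_lt (by simp)).ne)
    refine (continuous_expNeg.tendsto _).comp ?_
    simp_rw [← MeasureTheory.lintegral_count]
    -- The grid radius is at most `r + 1`, so each term is at most `C (r + 1)^α d^{-α}`, summable on
    -- the good event.
    refine tendsto_lintegral_of_dominated_convergence
      (fun i => ENNReal.ofReal (C * (r + 1) ^ α) * ENNReal.ofReal (dist (X i ω) z ^ (-α)))
      (fun n => measurable_from_top) (fun n => ae_of_all _ fun i => ?_) ?_ (ae_of_all _ fun i => ?_)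
    · simp only
      split_ifs with hi
      · have hgp : 0 < gridAbove n r := h0.trans (lt_gridAbove n r)
        have hdp : 0 < dist (X i ω) z := hgp.trans_le hi
        refine (hfb _ (by positivity)).trans ?_
        rw [← ENNReal.ofReal_mul (by positivity)]
        refine ENNReal.ofReal_le_ofReal ?_
        rw [Real.div_rpow hdp.le hgp.le, Real.rpow_neg hgp.le, div_inv_eq_mul, mul_comm (_ ^ (-α)),
          ← mul_assoc]
        gcongr
        refine (gridAbove_le n h0.le).trans ?_
        gcongr
        rw [div_le_one (by positivity)]
        linarith [(Nat.cast_nonneg n : (0 : ℝ) ≤ n)]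
      · exact zero_le
    · rw [MeasureTheory.lintegral_count, ENNReal.tsum_mul_left]
      exact ENNReal.mul_ne_top ENNReal.ofReal_ne_top h3.ne
    · simp only [h2]
      by_cases hi : i = serving (fun i => X i ω) z
      · simp only [hi, if_true]
        refine tendsto_const_nhds.congr fun n => ?_
        rw [if_neg]
        rw [h2, not_le]
        exact lt_gridAbove n r
      · simp only [hi, if_false]
        have hri := h1 i hi
        have he : ∀ᶠ n in atTop, gridAbove n r ≤ dist (X i ω) z :=
          ((tendsto_gridAbove h0.le).eventually (gt_mem_nhds hri)).mono fun n hn => le_of_lt hn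
        refine Tendsto.congr' (he.mono fun n hn => (if_pos hn).symm) ?_
        refine (hfc _ (div_pos (h0.trans hri) h0)).tendsto.comp ?_
        exact tendsto_const_nhds.div (tendsto_gridAbove h0.le) h0.ne'
  have hR : Tendsto (fun n => ∫⁻ ω, g (gridAbove n (minDist (fun i => X i ω) z)) *
        expNeg (ENNReal.ofReal (lam * gridAbove n (minDist (fun i => X i ω) z) ^ 2) *
          outerIntegral f) ∂P) atTop
      (𝓝 (∫⁻ ω, g (minDist (fun i => X i ω) z) *
        expNeg (ENNReal.ofReal (lam * minDist (fun i => X i ω) z ^ 2) * outerIntegral f) ∂P)) := by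
    refine tendsto_lintegral_of_dominated_convergence (fun _ => 1)
      (fun n => ?_)
      (fun n => ae_of_all _ fun ω => mul_le_one' (hg1 _) (expNeg_le_one _)) (by simp) ?_
    · have h1 : Measurable fun ω => gridAbove n (minDist (fun i => X i ω) z) :=
        (measurable_gridAbove n).comp hmd
      exact (hg.comp h1).mul (measurable_expNeg.comp (by fun_prop))
    filter_upwards [hgood] with ω ⟨h0, _⟩
    refine ENNReal.Tendsto.mul ((hgc _ h0).tendsto.comp (tendsto_gridAbove h0.le))
      (Or.inr (expNeg_ne_top _)) ?_ (Or.inr ((hg1 _).trans_lt (by simp)).ne)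
    refine (continuous_expNeg.tendsto _).comp ?_
    refine ENNReal.Tendsto.mul_const ?_ (Or.inr hout)
    refine (ENNReal.continuous_ofReal.tendsto _).comp ?_
    exact ((tendsto_gridAbove h0.le).pow 2).const_mul lam
  simp_rw [lintegral_outerFactor_gridAbove hlam h hf z g] at hL
  exact tendsto_nhds_unique hL hR

/-- The Rayleigh law of the distance of the nearest point. -/
theorem map_minDist [IsProbabilityMeasure P] (hlam : 0 < lam)
    (h : IsPoissonProcess X (planeIntensity lam) P) (z : Plane) :
    P.map (fun ω => minDist (fun i => X i ω) z) = (volume.restrict (Ioi (0 : ℝ))).withDensity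
      fun r => ENNReal.ofReal (2 * Real.pi * lam * r * Real.exp (-(Real.pi * lam * r ^ 2))) := by
  have hmd := measurable_minDist_comp h.measurable z
  have := Measure.isProbabilityMeasure_map (μ := P) hmd.aemeasurable
  -- Tails suffice: the void probability is the tail, and the density is minus its derivative.
  -- Distances are nonnegative, hence `max a 0` below.
  refine Measure.ext_of_Ici _ _ fun a => ?_
  have h1 : P.map (fun ω => minDist (fun i => X i ω) z) (Ici a) =
      ENNReal.ofReal (Real.exp (-(Real.pi * lam * (max a 0) ^ 2))) := by
    rw [Measure.map_apply hmd measurableSet_Ici]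
    have : (fun ω => minDist (fun i => X i ω) z) ⁻¹' Ici a =
        {ω | max a 0 ≤ minDist (fun i => X i ω) z} := by
      ext ω; simp [minDist_nonneg]
    rw [this, measure_le_minDist hlam.le h z (le_max_right _ _), expNeg_ofReal (by positivity),
      mul_comm lam]
  have hderiv : ∀ x : ℝ, HasDerivAt (fun r => -Real.exp (-(Real.pi * lam * r ^ 2)))
      (2 * Real.pi * lam * x * Real.exp (-(Real.pi * lam * x ^ 2))) x := fun x => by
    have := (((hasDerivAt_pow 2 x).const_mul (Real.pi * lam)).neg.exp).neg
    refine this.congr_deriv ?_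
    norm_num
    ring
  have hlim : Tendsto (fun r => -Real.exp (-(Real.pi * lam * r ^ 2))) atTop (𝓝 (-0)) := by
    refine Tendsto.neg (Real.tendsto_exp_atBot.comp (tendsto_neg_atTop_atBot.comp ?_))
    exact (tendsto_pow_atTop two_ne_zero).const_mul_atTop (by positivity)
  have hnn : ∀ x ∈ Ioi (max a 0),
      0 ≤ 2 * Real.pi * lam * x * Real.exp (-(Real.pi * lam * x ^ 2)) := fun x hx => by
    have : 0 < x := (le_max_right _ _).trans_lt hx
    positivity
  have hint := integrableOn_Ioi_deriv_of_nonneg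
    (hderiv (max a 0)).continuousAt.continuousWithinAt (fun x _ => hderiv x) hnn hlim
  rw [h1, withDensity_apply _ measurableSet_Ici, Measure.restrict_restrict measurableSet_Ici]
  have hset : (Ici a ∩ Ioi 0 : Set ℝ) =ᵐ[volume] Ioi (max a 0) := by
    rw [← Ioi_inter_Ioi]
    exact Ioi_ae_eq_Ici.symm.inter (ae_eq_refl _)
  rw [setLIntegral_congr hset, ← ofReal_integral_eq_lintegral_ofReal hint
    ((ae_restrict_iff' measurableSet_Ioi).2 (ae_of_all _ hnn)),
    integral_Ioi_of_hasDerivAt_of_nonneg (hderiv (max a 0)).continuousAt.continuousWithinAt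
      (fun x _ => hderiv x) hnn hlim]
  simp

end

end RISNoma

namespace RISNoma

noncomputable section

open Filter Topology

/-! ### The Gamma law -/

lemma measurable_gammaPDF (a r : ℝ) : Measurable (gammaPDF a r) :=
  (measurable_gammaPDFReal a r).ennreal_ofReal

lemma hasDerivAt_exp_neg_mul (c x : ℝ) :
    HasDerivAt (fun x => Real.exp (-(c * x))) (-(c * Real.exp (-(c * x)))) x := by
  have h : HasDerivAt (fun x : ℝ => -(c * x)) (-c) x := by
    simpa using ((hasDerivAt_id x).const_mul c).fun_neg
  refine h.exp.congr_deriv ?_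
  ring

lemma lintegral_gammaMeasure {a r : ℝ} (F : ℝ → ℝ≥0∞) (hF : Measurable F) :
    ∫⁻ x, F x ∂(gammaMeasure a r) = ∫⁻ x, gammaPDF a r x * F x := by
  rw [gammaMeasure, lintegral_withDensity_eq_lintegral_mul _ (measurable_gammaPDF a r) hF]
  rfl

/-- Exponential tilting changes the rate from `r` to `r + s`. The constant `(1 + s/r)^{-a}` is kept
as an exponential so that products over interferers become sums. -/
lemma gammaPDF_mul_expNeg {a r s : ℝ} (ha : 0 < a) (hr : 0 < r) (hs : 0 ≤ s) (x : ℝ) :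
    gammaPDF a r x * expNeg (ENNReal.ofReal (s * x)) =
      expNeg (ENNReal.ofReal (a * Real.log (1 + s / r))) * gammaPDF a (r + s) x := by
  have hrs : 0 < 1 + s / r := by positivity
  have hlog : 0 ≤ Real.log (1 + s / r) := Real.log_nonneg (by linarith [div_nonneg hs hr.le])
  rcases lt_or_ge x 0 with hx | hx
  · rw [gammaPDF_of_neg hx, gammaPDF_of_neg hx, zero_mul, mul_zero]
  · rw [gammaPDF_of_nonneg hx, gammaPDF_of_nonneg hx, expNeg_ofReal (by positivity),
      expNeg_ofReal (by positivity), ← ENNReal.ofReal_mul (by have := Real.Gamma_pos_of_pos ha; positivity),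
      ← ENNReal.ofReal_mul (by positivity)]
    congr 1
    have h1 : Real.exp (-(a * Real.log (1 + s / r))) * (r + s) ^ a = r ^ a := by
      have h2 : r + s = r * (1 + s / r) := by field_simp
      rw [h2, Real.mul_rpow hr.le hrs.le, Real.rpow_def_of_pos hrs, mul_left_comm, ← Real.exp_add]
      rw [show -(a * Real.log (1 + s / r)) + Real.log (1 + s / r) * a = 0 by ring, Real.exp_zero,
        mul_one]
    rw [← h1, show -((r + s) * x) = -(r * x) + -(s * x) by ring, Real.exp_add]
    ring

/-- The Laplace transform of the Gamma law. -/
lemma lintegral_expNeg_gammaMeasure {a r s : ℝ} (ha : 0 < a) (hr : 0 < r) (hs : 0 ≤ s) :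
    ∫⁻ x, expNeg (ENNReal.ofReal (s * x)) ∂(gammaMeasure a r) =
      expNeg (ENNReal.ofReal (a * Real.log (1 + s / r))) := by
  rw [lintegral_gammaMeasure (fun x => expNeg (ENNReal.ofReal (s * x)))
    (measurable_expNeg.comp (by fun_prop))]
  simp_rw [gammaPDF_mul_expNeg ha hr hs]
  rw [lintegral_const_mul _ (measurable_gammaPDF _ _),
    lintegral_gammaPDF_eq_one ha (by positivity), mul_one]

/-- Multiplication by `x` raises the shape by one, at the cost of the factor `a / r`. -/
lemma lintegral_id_gammaMeasure {a r : ℝ} (ha : 0 < a) (hr : 0 < r) :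
    ∫⁻ x, ENNReal.ofReal x ∂(gammaMeasure a r) = ENNReal.ofReal (a / r) := by
  rw [lintegral_gammaMeasure _ ENNReal.measurable_ofReal]
  have : ∀ x, gammaPDF a r x * ENNReal.ofReal x = ENNReal.ofReal (a / r) * gammaPDF (a + 1) r x := by
    intro x
    rcases lt_or_ge x 0 with hx | hx
    · rw [gammaPDF_of_neg hx, gammaPDF_of_neg hx, zero_mul, mul_zero]
    · have hG := Real.Gamma_pos_of_pos ha
      rw [gammaPDF_of_nonneg hx, gammaPDF_of_nonneg hx, ← ENNReal.ofReal_mul (by positivity),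
        ← ENNReal.ofReal_mul (by positivity)]
      congr 1
      rw [Real.Gamma_add_one ha.ne', Real.rpow_add hr, Real.rpow_one]
      have hxp : x ^ (a + 1 - 1) = x ^ (a - 1) * x := by
        rw [show a + 1 - 1 = a - 1 + 1 by ring]
        rcases hx.eq_or_lt with rfl | hx
        · rw [mul_zero, Real.zero_rpow (by linarith)]
        · rw [Real.rpow_add hx, Real.rpow_one]
      rw [hxp]
      field_simp
  simp_rw [this]
  rw [lintegral_const_mul _ (measurable_gammaPDF _ _),
    lintegral_gammaPDF_eq_one (by positivity) hr, mul_one]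

/-! ### Alzer's inequality -/

lemma integral_exp_neg_mul {u : ℝ} (hu : u ≠ 0) :
    ∫ s in (0 : ℝ)..1, Real.exp (-(u * s)) = (1 - Real.exp (-u)) / u := by
  have h : ∀ s ∈ uIcc (0 : ℝ) 1,
      HasDerivAt (fun s => -(Real.exp (-(u * s)) / u)) (Real.exp (-(u * s))) s := fun s _ => by
    refine ((hasDerivAt_exp_neg_mul u s).div_const u).fun_neg.congr_deriv ?_
    field_simp
  rw [intervalIntegral.integral_eq_sub_of_hasDerivAt h
    (Continuous.intervalIntegrable (by fun_prop) _ _)]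
  simp
  ring

/-- Jensen's inequality on `[0, 1]` for the convex power `v / u ≥ 1`, as `(1 - e^{-u})/u` is the
mean of `e^{-us}`. Equivalently `((1 - e^{-u})/u)^{1/u}` increases in `u`. -/
lemma rpow_div_le_of_le {u v : ℝ} (hu : 0 < u) (huv : u ≤ v) :
    ((1 - Real.exp (-u)) / u) ^ (v / u) ≤ (1 - Real.exp (-v)) / v := by
  have hv : 0 < v := hu.trans_le huv
  rw [← integral_exp_neg_mul hu.ne', ← integral_exp_neg_mul hv.ne',
    intervalIntegral.integral_of_le zero_le_one, intervalIntegral.integral_of_le zero_le_one]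
  have hprob : IsProbabilityMeasure (volume.restrict (Ioc (0 : ℝ) 1)) := ⟨by simp⟩
  have hpow : ∀ s : ℝ, Real.exp (-(u * s)) ^ (v / u) = Real.exp (-(v * s)) := fun s => by
    rw [← Real.exp_mul]
    congr 1
    field_simp
  have hint : ∀ w : ℝ, Integrable (fun s => Real.exp (-(w * s))) (volume.restrict (Ioc (0 : ℝ) 1)) :=
    fun w => (intervalIntegrable_iff_integrableOn_Ioc_of_le zero_le_one).1
      (Continuous.intervalIntegrable (by fun_prop) _ _)
  have := (convexOn_rpow ((one_le_div hu).2 huv)).map_integral_le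
    (μ := volume.restrict (Ioc (0 : ℝ) 1)) (f := fun s => Real.exp (-(u * s)))
    (Real.continuous_rpow_const (by positivity)).continuousOn isClosed_Ici
    (ae_of_all _ fun s => (Real.exp_pos _).le) (hint u)
    (by simpa only [Function.comp_def, hpow] using hint v)
  simpa only [hpow] using this

lemma eta_pos {m : ℕ} (hm : 1 ≤ m) : 0 < eta m := by
  have : (0 : ℝ) < m := by exact_mod_cast hm
  unfold eta; positivity

/-- This value of `η` gives the Gamma distribution function and `(1 - e^{-ηx})^m` the same leading
term at zero. -/
lemma eta_pow {m : ℕ} (hm : 1 ≤ m) : eta m ^ m = (m : ℝ) ^ m / (Nat.factorial m : ℝ) := by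
  have hm0 : (m : ℝ) ≠ 0 := by positivity
  rw [eta, mul_pow, ← Real.rpow_natCast (_ ^ (_ : ℝ)), ← Real.rpow_mul (by positivity),
    show -(1 / (m : ℝ)) * m = -1 by field_simp, Real.rpow_neg_one, div_eq_mul_inv]

lemma cdf_gammaMeasure_natCast {m : ℕ} (hm : 1 ≤ m) {x : ℝ} (hx : 0 ≤ x) :
    cdf (gammaMeasure m m) x =
      ∫ t in (0 : ℝ)..x, m * eta m * ((eta m * t) ^ (m - 1) * Real.exp (-(m * t))) := by
  have hm0 : (0 : ℝ) < m := by exact_mod_cast hm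
  rw [cdf_gammaMeasure_eq_integral hm0 hm0, intervalIntegral.integral_of_le hx]
  have h1 : ∫ t in Iic x, gammaPDFReal m m t = ∫ t in Ioc 0 x, gammaPDFReal m m t := by
    refine setIntegral_eq_of_subset_of_ae_sdiff_eq_zero measurableSet_Iic.nullMeasurableSet
      Ioc_subset_Iic_self ?_
    have h0 : ∀ᵐ t : ℝ, t ≠ 0 := by simp [ae_iff]
    filter_upwards [h0] with t ht htx
    have : ¬ 0 ≤ t := fun h => htx.2 ⟨lt_of_le_of_ne h ht.symm, htx.1⟩
    simp [gammaPDFReal, this]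
  rw [h1]
  refine setIntegral_congr_fun measurableSet_Ioc fun t ht => ?_
  simp only [gammaPDFReal, if_pos ht.1.le]
  obtain ⟨k, rfl⟩ : ∃ k, m = k + 1 := ⟨m - 1, by omega⟩
  have he := eta_pow hm
  rw [Nat.add_sub_cancel, show (((k + 1 : ℕ) : ℝ) - 1) = (k : ℝ) by push_cast; ring,
    Real.rpow_natCast, Real.rpow_natCast, mul_pow,
    show ((k + 1 : ℕ) : ℝ) * eta (k + 1) * (eta (k + 1) ^ k * t ^ k * Real.exp (-((k + 1 : ℕ) * t))) =
      ((k + 1 : ℕ) : ℝ) * eta (k + 1) ^ (k + 1) * t ^ k * Real.exp (-((k + 1 : ℕ) * t)) by ring, he,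
    Nat.factorial_succ]
  have hG : Real.Gamma ((k + 1 : ℕ) : ℝ) = Nat.factorial k := by
    push_cast; exact Real.Gamma_nat_eq_factorial k
  rw [hG]
  push_cast
  field_simp

/-- Alzer's inequality. -/
theorem one_sub_exp_pow_le_cdf_gammaMeasure {m : ℕ} (hm : 1 ≤ m) {x : ℝ} (hx : 0 ≤ x) :
    (1 - Real.exp (-(eta m * x))) ^ m ≤ cdf (gammaMeasure m m) x := by
  have hm0 : (0 : ℝ) < m := by exact_mod_cast hm
  have hη := eta_pos hm
  set η := eta m with hηdef
  let q : ℝ → ℝ := fun t => m * η * ((η * t) ^ (m - 1) * Real.exp (-(m * t)))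
  have hq : Continuous q := by fun_prop
  -- `D` vanishes at `0` and at infinity. If `D x < 0`, the mean value theorem gives `c < x` with
  -- `D' c < 0`; the derivative stays nonpositive beyond `c`, so the limit `0` would be at most `D
  -- x`.
  let D : ℝ → ℝ := fun x => (∫ t in (0 : ℝ)..x, q t) - (1 - Real.exp (-(η * x))) ^ m
  let D' : ℝ → ℝ := fun x => m * η * ((η * x) ^ (m - 1) * Real.exp (-(m * x)) -
    Real.exp (-(η * x)) * (1 - Real.exp (-(η * x))) ^ (m - 1))
  have hD : ∀ x, HasDerivAt D (D' x) x := fun x => by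
    have h1 := (hq.integral_hasStrictDerivAt 0 x).hasDerivAt
    have h2 := ((hasDerivAt_exp_neg_mul η x).const_sub 1).fun_pow m
    refine (h1.sub h2).congr_deriv ?_
    simp only [q, D']
    ring
  have hD0 : D 0 = 0 := by simp [D, (show m ≠ 0 by omega)]
  have hDlim : Tendsto D atTop (𝓝 0) := by
    have h1 : Tendsto (fun x : ℝ => (1 - Real.exp (-(η * x))) ^ m) atTop (𝓝 ((1 - 0) ^ m)) := by
      refine ((tendsto_const_nhds).sub ?_).pow m
      exact Real.tendsto_exp_atBot.comp
        (tendsto_neg_atTop_atBot.comp (tendsto_id.const_mul_atTop hη))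
    have h2 := (tendsto_cdf_atTop (gammaMeasure m m)).sub h1
    simp only [sub_zero, one_pow, sub_self] at h2
    refine h2.congr' ?_
    filter_upwards [eventually_ge_atTop 0] with x hx
    rw [cdf_gammaMeasure_natCast hm hx]
  by_contra! hlt
  have hDx : D x < 0 := by
    simp only [D]
    rw [← cdf_gammaMeasure_natCast hm hx]
    linarith
  have hx0 : 0 < x := lt_of_le_of_ne hx (by rintro rfl; linarith)
  obtain ⟨c, hc, hcs⟩ := exists_hasDerivAt_eq_slope D D' hx0
    (fun y _ => (hD y).continuousAt.continuousWithinAt) (fun y _ => hD y)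
  have hneg : D' c < 0 := by
    rw [hcs, hD0]
    exact div_neg_of_neg_of_pos (by linarith) (by linarith)
  -- With `ψ(u) = (1 - e^{-u})/u`, the sign of `D' y` is that of `1 - e^{(m-η)y} ψ(ηy)^{m-1}`.
  have hfac : ∀ y, 0 < y → D' y = m * η * ((η * y) ^ (m - 1) * Real.exp (-(m * y)) *
      (1 - Real.exp ((m - η) * y) * ((1 - Real.exp (-(η * y))) / (η * y)) ^ (m - 1))) := fun y hy => by
    have h1 : (1 - Real.exp (-(η * y))) ^ (m - 1) =
        (η * y) ^ (m - 1) * ((1 - Real.exp (-(η * y))) / (η * y)) ^ (m - 1) := by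
      rw [← mul_pow, mul_div_cancel₀ _ (by positivity)]
    have h2 : Real.exp (-(η * y)) = Real.exp (-(m * y)) * Real.exp ((m - η) * y) := by
      rw [← Real.exp_add]; congr 1; ring
    simp only [D']
    rw [h1]
    nth_rewrite 1 [h2]
    ring
  have hdown : ∀ y, c ≤ y → D' y ≤ 0 := fun y hcy => by
    have hc0 : 0 < c := hc.1
    have hy0 : 0 < y := hc0.trans_le hcy
    have hpos : ∀ w, 0 < w → 0 < m * η * ((η * w) ^ (m - 1) * Real.exp (-(m * w))) := fun w hw => by
      positivity
    have hψ : ∀ w, 0 < w → 0 < (1 - Real.exp (-(η * w))) / (η * w) := fun w hw => by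
      have : Real.exp (-(η * w)) < 1 := Real.exp_zero ▸ Real.exp_lt_exp.2 (by have := mul_pos hη hw; linarith)
      exact div_pos (by linarith) (by positivity)
    rw [hfac y hy0, ← mul_assoc]
    rw [hfac c hc0, ← mul_assoc] at hneg
    have hA : 1 < Real.exp ((m - η) * c) * ((1 - Real.exp (-(η * c))) / (η * c)) ^ (m - 1) := by
      by_contra! hA
      exact absurd hneg (not_lt.2 (mul_nonneg (hpos c hc0).le (by linarith)))
    refine mul_nonpos_of_nonneg_of_nonpos (hpos y hy0).le (sub_nonpos.2 ?_)
    have hJ := rpow_div_le_of_le (mul_pos hη hc0) (mul_le_mul_of_nonneg_left hcy hη.le)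
    have hexp : η * y / (η * c) = y / c := by field_simp
    rw [hexp] at hJ
    have hyc : 1 ≤ y / c := (one_le_div hc0).2 hcy
    -- Raise the inequality at `c` to the power `y/c ≥ 1`; Jensen bounds `ψ(ηc)^{y/c}` by `ψ(ηy)`.
    calc (1 : ℝ) ≤ (Real.exp ((m - η) * c) *
          ((1 - Real.exp (-(η * c))) / (η * c)) ^ (m - 1)) ^ (y / c) :=
          Real.one_le_rpow hA.le (by linarith)
      _ = Real.exp ((m - η) * y) * (((1 - Real.exp (-(η * c))) / (η * c)) ^ (y / c)) ^ (m - 1) := by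
          rw [Real.mul_rpow (Real.exp_nonneg _) (pow_nonneg (hψ c hc0).le _), ← Real.exp_mul]
          congr 1
          · congr 1; field_simp
          · rw [← Real.rpow_natCast, ← Real.rpow_natCast, ← Real.rpow_mul (hψ c hc0).le,
              ← Real.rpow_mul (hψ c hc0).le, mul_comm (y / c)]
      _ ≤ _ := by
          gcongr
          exact Real.rpow_nonneg (hψ c hc0).le _
  have hanti : AntitoneOn D (Ici c) := by
    refine antitoneOn_of_deriv_nonpos (convex_Ici c)
      (fun y _ => (hD y).continuousAt.continuousWithinAt)
      (fun y _ => (hD y).differentiableAt.differentiableWithinAt) fun y hy => ?_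
    rw [(hD y).deriv]
    rw [interior_Ici] at hy
    exact hdown y (le_of_lt hy)
  have : 0 ≤ D x := by
    refine le_of_tendsto hDlim ?_
    filter_upwards [eventually_ge_atTop x] with y hy
    exact hanti hc.2.le (hc.2.le.trans hy) hy
  linarith

end

end RISNoma

namespace RISNoma

noncomputable section

open Filter Topology

/-! ### The hypergeometric function as an integral -/

/-- The binomial series at `-w`, read as a hypergeometric series with equal parameters `1, 1` that
cancel. -/
lemma hasSum_ascPochhammer (b : ℝ) {w : ℝ} (hw : |w| < 1) :
    HasSum (fun k : ℕ => (ascPochhammer ℝ k).eval b / (Nat.factorial k : ℝ) * w ^ k)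
      ((1 - w) ^ (-b)) := by
  have h := (Real.one_add_rpow_hasFPowerSeriesOnBall_zero (a := -b)).hasSum (y := -w) (by
    rw [← ENNReal.ofReal_one, Metric.eball_ofReal]
    simpa using hw)
  rw [binomialSeries_eq_ordinaryHypergeometricSeries (b := (1 : ℝ))
    (fun k => by have : (0 : ℝ) ≤ k := Nat.cast_nonneg k; linarith)] at h
  rw [zero_add, ← sub_eq_add_neg] at h
  refine h.congr_fun fun k => ?_
  have h1 : (ascPochhammer ℝ k).eval (1 : ℝ) ≠ 0 := (ascPochhammer_pos k 1 one_pos).ne'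
  simp only [FormalMultilinearSeries.compContinuousLinearMap_apply, Function.comp_def, neg_neg]
  simp only [neg_neg, FunLike.coe_neg, Pi.neg_apply, ContinuousLinearMap.id_apply]
  rw [ordinaryHypergeometricSeries_apply_eq]
  simp only [smul_eq_mul]
  field_simp

/-- The quotient `(-δ)_k / (1-δ)_k` telescopes to `-δ/(k-δ)`, leaving a binomial coefficient. -/
lemma ordinaryHypergeometric_term {δ : ℝ} (hδ0 : 0 < δ) (hδ1 : δ < 1) (b : ℝ) (k : ℕ) :
    ((Nat.factorial k : ℝ)⁻¹ * (ascPochhammer ℝ k).eval (-δ) * (ascPochhammer ℝ k).eval b *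
      ((ascPochhammer ℝ k).eval (1 - δ))⁻¹) =
      -δ / (k - δ) * ((ascPochhammer ℝ k).eval b / (Nat.factorial k : ℝ)) := by
  have h1 : ∀ k : ℕ, (ascPochhammer ℝ k).eval (-δ) * (k - δ) = -δ * (ascPochhammer ℝ k).eval (1 - δ) := by
    intro k
    induction k with
    | zero => simp
    | succ k ih =>
      rw [ascPochhammer_succ_eval, ascPochhammer_succ_eval]
      push_cast
      linear_combination (1 - δ + k) * ih
  have h2 : (ascPochhammer ℝ k).eval (1 - δ) ≠ 0 := (ascPochhammer_pos k _ (by linarith)).ne'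
  have h3 : (k : ℝ) - δ ≠ 0 := by
    rcases Nat.eq_zero_or_pos k with rfl | hk
    · simpa using hδ0.ne'
    · have : (1 : ℝ) ≤ k := by exact_mod_cast hk
      linarith
  field_simp
  linear_combination (ascPochhammer ℝ k).eval b * h1 k

/-- Applying `w d/dw - δ` multiplies the `k`-th term by `k - δ`, which cancels the denominator and
leaves `-δ` times a binomial series. Termwise differentiation is legitimate on a ball of radius `r <
1` because `kδ/|k - δ|` is bounded. -/
lemma exists_hasDerivAt_ordinaryHypergeometric {δ : ℝ} (hδ0 : 0 < δ) (hδ1 : δ < 1) (b : ℝ)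
    {w : ℝ} (hw : |w| < 1) :
    ∃ G', HasDerivAt (fun w => ordinaryHypergeometric (-δ) b (1 - δ) w) G' w ∧
      w * G' = δ * ordinaryHypergeometric (-δ) b (1 - δ) w - δ * (1 - w) ^ (-b) := by
  set β : ℕ → ℝ := fun k => (ascPochhammer ℝ k).eval b / (Nat.factorial k : ℝ) with hβ
  have hG : (fun w => ordinaryHypergeometric (-δ) b (1 - δ) w) =
      fun w => ∑' k : ℕ, -δ / (k - δ) * β k * w ^ k := by
    funext w
    rw [ordinaryHypergeometric_eq_tsum]
    refine tsum_congr fun k => ?_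
    rw [ordinaryHypergeometric_term hδ0 hδ1, smul_eq_mul]
  obtain ⟨r, hwr, hr1⟩ := exists_between hw
  have hr0 : 0 < r := (abs_nonneg w).trans_lt hwr
  have hc : ∀ k : ℕ, |(k : ℝ) * (-δ / (k - δ))| ≤ δ / (1 - δ) := fun k => by
    rcases Nat.eq_zero_or_pos k with rfl | hk
    · have : 0 < 1 - δ := by linarith
      simp; positivity
    · have hk1 : (1 : ℝ) ≤ k := by exact_mod_cast hk
      have h1 : 0 < (k : ℝ) - δ := by linarith
      rw [neg_div, mul_neg, abs_neg, abs_of_pos (by positivity), ← mul_div_assoc,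
        div_le_div_iff₀ h1 (by linarith)]
      nlinarith [mul_nonneg (mul_nonneg hδ0.le hδ0.le) (sub_nonneg.2 hk1)]
  have hc' : ∀ k : ℕ, |-δ / ((k : ℝ) - δ)| ≤ 1 + δ / (1 - δ) := fun k => by
    have h0 : 0 < δ / (1 - δ) := div_pos hδ0 (by linarith)
    rcases Nat.eq_zero_or_pos k with rfl | hk
    · have : |-δ / (((0 : ℕ) : ℝ) - δ)| = 1 := by
        rw [Nat.cast_zero, zero_sub, div_self (by linarith), abs_one]
      linarith
    · have hk1 : (1 : ℝ) ≤ k := by exact_mod_cast hk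
      have := hc k
      rw [abs_mul, abs_of_nonneg (by positivity : (0 : ℝ) ≤ k)] at this
      have h2 : |-δ / ((k : ℝ) - δ)| ≤ k * |-δ / ((k : ℝ) - δ)| := by
        nlinarith [abs_nonneg (-δ / ((k : ℝ) - δ))]
      linarith
  have hsum : ∀ w : ℝ, |w| < 1 → HasSum (fun k => β k * w ^ k) ((1 - w) ^ (-b)) :=
    fun w hw => hasSum_ascPochhammer b hw
  have hsr : Summable fun k => |β k * r ^ k| := (hsum r (by rwa [abs_of_pos hr0])).summable.abs
  have hGs : ∀ w : ℝ, |w| < 1 → Summable fun k : ℕ => -δ / (k - δ) * β k * w ^ k := fun w hw => by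
    refine Summable.of_norm_bounded ((hsum w hw).summable.abs.mul_left (1 + δ / (1 - δ))) fun k => ?_
    rw [mul_assoc, Real.norm_eq_abs, abs_mul]
    exact mul_le_mul_of_nonneg_right (hc' k) (abs_nonneg _)
  have hder := hasDerivAt_tsum_of_isPreconnected (u := fun k => δ / (1 - δ) / r * |β k * r ^ k|)
    (g := fun (k : ℕ) w => -δ / (k - δ) * β k * w ^ k)
    (g' := fun (k : ℕ) w => -δ / (k - δ) * β k * (k * w ^ (k - 1)))
    (t := Metric.ball (0 : ℝ) r) (hsr.mul_left _) Metric.isOpen_ball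
    (convex_ball 0 r).isPreconnected (fun k y _ => (hasDerivAt_pow k y).const_mul _)
    (fun k y hy => by
      have hyr : |y| < r := by simpa using hy
      rcases Nat.eq_zero_or_pos k with rfl | hk
      · have h0 : 0 < δ / (1 - δ) := div_pos hδ0 (by linarith)
        simp only [Nat.cast_zero, zero_mul, mul_zero, norm_zero]
        positivity
      · rw [Real.norm_eq_abs, show -δ / ((k : ℝ) - δ) * β k * (k * y ^ (k - 1)) =
          (k * (-δ / (k - δ))) * (β k * y ^ (k - 1)) by ring, abs_mul,
          show δ / (1 - δ) / r * |β k * r ^ k| = δ / (1 - δ) * (|β k * r ^ k| / r) by ring]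
        refine mul_le_mul (hc k) ?_ (abs_nonneg _) (div_pos hδ0 (by linarith)).le
        rw [abs_mul, abs_mul, mul_div_assoc]
        refine mul_le_mul_of_nonneg_left ?_ (abs_nonneg _)
        rw [abs_pow, abs_pow, abs_of_pos hr0, le_div_iff₀ hr0]
        calc |y| ^ (k - 1) * r ≤ r ^ (k - 1) * r := by gcongr
          _ = r ^ k := by rw [← pow_succ, Nat.sub_add_cancel hk])
    (Metric.mem_ball_self hr0) (hGs 0 (by simp)) (y := w) (by simpa using hwr)
  refine ⟨_, by rw [hG]; exact hder, ?_⟩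
  have h2 : (fun w => ordinaryHypergeometric (-δ) b (1 - δ) w) w =
    ∑' k : ℕ, -δ / (k - δ) * β k * w ^ k := congrFun hG w
  simp only at h2
  rw [h2, ← (hsum w hw).tsum_eq, ← tsum_mul_left, ← tsum_mul_left, ← tsum_mul_left,
    ← ((hGs w hw).mul_left δ).tsum_sub ((hsum w hw).summable.mul_left δ)]
  refine tsum_congr fun k => ?_
  have h3 : (k : ℝ) - δ ≠ 0 := by
    rcases Nat.eq_zero_or_pos k with rfl | hk
    · simpa using hδ0.ne'
    · have : (1 : ℝ) ≤ k := by exact_mod_cast hk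
      linarith
  rcases Nat.eq_zero_or_pos k with rfl | hk
  · simp only [Nat.cast_zero, zero_sub, pow_zero]
    field_simp
    ring
  · have : w ^ k = w * w ^ (k - 1) := by rw [← pow_succ', Nat.sub_add_cancel hk]
    rw [this]
    field_simp
    ring

/-- A solution of `t Q' = δ Q - δ (1 + t) ^ (-m)` with `Q 0 = 1` that is differentiable at zero is
an integral. -/
lemma integral_Ioi_one_of_ode {δ α m κ κ₀ : ℝ} (hδ0 : 0 < δ) (hδ1 : δ < 1) (hαδ : α * δ = 2)
    (hm : 0 ≤ m) (hκ : 0 < κ) (hκ₀ : κ < κ₀) {Q Q' : ℝ → ℝ} (hQ0 : Q 0 = 1)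
    (hQ : ∀ t, 0 ≤ t → t < κ₀ → HasDerivAt Q (Q' t) t)
    (hode : ∀ t, 0 < t → t < κ₀ → t * Q' t = δ * Q t - δ * (1 + t) ^ (-m)) :
    IntegrableOn (fun u => 2 * u * (1 - (1 + κ * u ^ (-α)) ^ (-m))) (Ioi 1) ∧
      ∫ u in Ioi 1, 2 * u * (1 - (1 + κ * u ^ (-α)) ^ (-m)) = Q κ - 1 := by
  have hα : 0 < α := by
    by_contra! h
    nlinarith
  -- The integrating factor `t^{-δ}` gives `Φ' = δ t^{-δ-1}(1 - (1+t)^{-m})`; the substitution `t =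
  -- κ u^{-α}` with `αδ = 2` turns this into the integrand.
  let Φ : ℝ → ℝ := fun t => t ^ (-δ) * (Q t - 1)
  have hΦ : ∀ t, 0 < t → t < κ₀ → HasDerivAt Φ (δ * t ^ (-δ - 1) * (1 - (1 + t) ^ (-m))) t := by
    intro t ht ht'
    have h1 := (Real.hasDerivAt_rpow_const (p := -δ) (Or.inl ht.ne')).mul ((hQ t ht.le ht').sub_const 1)
    refine h1.congr_deriv ?_
    have h2 : t ^ (-δ) = t ^ (-δ - 1) * t := by
      rw [← Real.rpow_add_one ht.ne']; congr 1; ring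
    rw [h2]
    linear_combination t ^ (-δ - 1) * hode t ht ht'
  -- Differentiability at zero gives `Q t - 1 = O(t)`, which beats `t^{-δ}` because `δ < 1`.
  have hΦ0 : Tendsto Φ (𝓝[>] 0) (𝓝 0) := by
    have h1 : Tendsto (fun t => t⁻¹ * (Q t - 1)) (𝓝[>] 0) (𝓝 (Q' 0)) := by
      have := (hQ 0 le_rfl (hκ.trans hκ₀)).tendsto_slope_zero_right
      simpa [hQ0] using this
    have h2 : Tendsto (fun t : ℝ => t ^ (1 - δ)) (𝓝[>] 0) (𝓝 0) := by
      have := (Real.continuousAt_rpow_const 0 (1 - δ) (Or.inr (by linarith))).tendsto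
      rw [Real.zero_rpow (by linarith)] at this
      exact this.mono_left nhdsWithin_le_nhds
    have h3 := h2.mul h1
    rw [zero_mul] at h3
    refine h3.congr' ?_
    filter_upwards [self_mem_nhdsWithin] with t ht
    have ht : 0 < t := ht
    simp only [Φ]
    rw [← mul_assoc]
    congr 1
    rw [← Real.rpow_neg_one t, ← Real.rpow_add ht]
    congr 1; ring
  let ψ : ℝ → ℝ := fun u => κ * u ^ (-α)
  have hψ0 : ∀ u, 0 < u → 0 < ψ u := fun u hu => by positivity
  have hψ1 : ∀ u, 1 ≤ u → ψ u < κ₀ := fun u hu => by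
    refine lt_of_le_of_lt ?_ hκ₀
    have := Real.rpow_le_one_of_one_le_of_nonpos hu (neg_nonpos.2 hα.le)
    simp only [ψ]
    nlinarith
  have hψlim : Tendsto ψ atTop (𝓝[>] 0) := by
    refine tendsto_nhdsWithin_iff.2 ⟨?_, ?_⟩
    · simpa using (tendsto_rpow_neg_atTop hα).const_mul κ
    · filter_upwards [eventually_gt_atTop 0] with u hu using hψ0 u hu
  have hF : ∀ u, 1 ≤ u → HasDerivAt (fun u => -(κ ^ δ * Φ (ψ u)))
      (2 * u * (1 - (1 + κ * u ^ (-α)) ^ (-m))) u := by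
    intro u hu
    have hu0 : 0 < u := one_pos.trans_le hu
    have h1 : HasDerivAt ψ (κ * (-α * u ^ (-α - 1))) u :=
      (Real.hasDerivAt_rpow_const (Or.inl hu0.ne')).const_mul κ
    have h2 := (((hΦ (ψ u) (hψ0 u hu0) (hψ1 u hu)).comp u h1).const_mul (κ ^ δ)).fun_neg
    refine h2.congr_deriv ?_
    have h3 : κ ^ δ * (ψ u ^ (-δ - 1)) * (κ * u ^ (-α - 1)) = u := by
      simp only [ψ]
      rw [Real.mul_rpow hκ.le (by positivity), ← Real.rpow_mul hu0.le]
      have e1 : κ ^ δ * κ ^ (-δ - 1) * κ = 1 := by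
        rw [← Real.rpow_add hκ, ← Real.rpow_add_one hκ.ne']
        ring_nf
        exact Real.rpow_zero κ
      have e2 : u ^ (-α * (-δ - 1)) * u ^ (-α - 1) = u := by
        rw [← Real.rpow_add hu0]
        have : -α * (-δ - 1) + (-α - 1) = 1 := by linear_combination hαδ
        rw [this, Real.rpow_one]
      calc κ ^ δ * (κ ^ (-δ - 1) * u ^ (-α * (-δ - 1))) * (κ * u ^ (-α - 1))
          = (κ ^ δ * κ ^ (-δ - 1) * κ) * (u ^ (-α * (-δ - 1)) * u ^ (-α - 1)) := by ring
        _ = u := by rw [e1, e2, one_mul]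
    calc _ = (α * δ) * (κ ^ δ * (ψ u ^ (-δ - 1)) * (κ * u ^ (-α - 1))) *
          (1 - (1 + ψ u) ^ (-m)) := by ring
      _ = _ := by rw [h3, hαδ]
  have hnn : ∀ u ∈ Ioi (1 : ℝ), 0 ≤ 2 * u * (1 - (1 + κ * u ^ (-α)) ^ (-m)) := fun u hu => by
    have hu0 : 0 < u := one_pos.trans hu
    have := hψ0 u hu0
    have h1 : (1 + κ * u ^ (-α)) ^ (-m) ≤ 1 :=
      Real.rpow_le_one_of_one_le_of_nonpos (by simp only [ψ] at this; linarith) (by linarith)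
    exact mul_nonneg (by positivity) (by linarith)
  have hlim : Tendsto (fun u => -(κ ^ δ * Φ (ψ u))) atTop (𝓝 (-(κ ^ δ * 0))) :=
    ((hΦ0.comp hψlim).const_mul _).neg
  refine ⟨integrableOn_Ioi_deriv_of_nonneg (hF 1 le_rfl).continuousAt.continuousWithinAt
    (fun u hu => hF u (le_of_lt hu)) hnn hlim, ?_⟩
  rw [integral_Ioi_of_hasDerivAt_of_nonneg (hF 1 le_rfl).continuousAt.continuousWithinAt
    (fun u hu => hF u (le_of_lt hu)) hnn hlim]
  simp only [ψ, Φ, Real.one_rpow, mul_one, mul_zero, neg_zero, zero_sub, neg_neg]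
  rw [← mul_assoc, ← Real.rpow_add hκ, add_neg_cancel, Real.rpow_zero, one_mul]

/-- The integral that the hypergeometric function represents. -/
theorem integral_eq_gaussHyp {α κ : ℝ} (hα : 2 < α) (m : ℕ) (hκ : 0 ≤ κ) :
    IntegrableOn (fun u => 2 * u * (1 - (1 + κ * u ^ (-α)) ^ (-(m : ℝ)))) (Ioi 1) ∧
      ∫ u in Ioi 1, 2 * u * (1 - (1 + κ * u ^ (-α)) ^ (-(m : ℝ))) =
        gaussHyp (-(2 / α)) m (1 - 2 / α) (-κ) - 1 := by
  have hα0 : 0 < α := by linarith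
  set δ := 2 / α with hδ
  have hδ0 : 0 < δ := by positivity
  have hδ1 : δ < 1 := by rw [hδ, div_lt_one hα0]; exact hα
  have hαδ : α * δ = 2 := by rw [hδ]; field_simp
  have hm : (0 : ℝ) ≤ m := Nat.cast_nonneg m
  rcases hκ.eq_or_lt with rfl | hκ
  · simp [gaussHyp]
  unfold gaussHyp
  split_ifs with h1
  · have hex : ∀ t : ℝ, 0 ≤ t → t < 1 → |-t| < 1 := fun t h0 h1 => by
      rwa [abs_neg, abs_of_nonneg h0]
    choose! G' hG using fun t (ht : |t| < 1) =>
      exists_hasDerivAt_ordinaryHypergeometric hδ0 hδ1 m ht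
    -- The series branch, `κ < 1`: `Q t = F(-t)` solves the equation up to `κ₀ = 1`.
    refine integral_Ioi_one_of_ode hδ0 hδ1 hαδ hm hκ (by linarith : κ < 1)
      (Q := fun t => ordinaryHypergeometric (-δ) m (1 - δ) (-t)) (Q' := fun t => -G' (-t)) (by simp)
      (fun t h0 h1 => ?_) (fun t h0 h1 => ?_)
    · have := (hG (-t) (hex t h0 h1)).1.comp t (hasDerivAt_neg t)
      exact this.congr_deriv (by ring)
    · have := (hG (-t) (hex t h0.le h1)).2
      rw [sub_neg_eq_add] at this
      linear_combination this
  · have hex : ∀ t : ℝ, 0 ≤ t → |t / (1 + t)| < 1 := fun t h0 => by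
      rw [abs_of_nonneg (by positivity), div_lt_one (by positivity)]
      linarith
    choose! G' hG using fun t (ht : |t| < 1) =>
      exists_hasDerivAt_ordinaryHypergeometric hδ0 hδ1 (1 - δ - m) ht
    have hval : -κ / (-κ - 1) = κ / (1 + κ) := by
      rw [← neg_div_neg_eq]; congr 1 <;> ring
    rw [hval, neg_neg, sub_neg_eq_add]
    have hdw : ∀ t : ℝ, 0 ≤ t → HasDerivAt (fun t : ℝ => t / (1 + t)) (1 / (1 + t) ^ 2) t := fun t h0 => by
      have := (hasDerivAt_id t).fun_div ((hasDerivAt_id t).const_add 1) (by simp only [id]; positivity)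
      refine this.congr_deriv ?_
      simp
    have hdp : ∀ t : ℝ, 0 ≤ t → HasDerivAt (fun t : ℝ => (1 + t) ^ δ) (δ * (1 + t) ^ (δ - 1)) t :=
      fun t h0 => by
        have := ((hasDerivAt_id t).const_add 1).rpow_const (p := δ) (Or.inl (by simp only [id]; positivity))
        refine this.congr_deriv ?_
        simp
    -- The Pfaff expression satisfies the same equation for all `t > 0` with the same initial value,
    -- so Pfaff's transformation itself need not be proved.
    refine integral_Ioi_one_of_ode hδ0 hδ1 hαδ hm hκ (lt_add_one κ)
      (Q := fun t => (1 + t) ^ δ * ordinaryHypergeometric (-δ) (1 - δ - m) (1 - δ) (t / (1 + t)))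
      (Q' := fun t => δ * (1 + t) ^ (δ - 1) *
        ordinaryHypergeometric (-δ) (1 - δ - m) (1 - δ) (t / (1 + t)) +
        (1 + t) ^ δ * (G' (t / (1 + t)) * (1 / (1 + t) ^ 2))) (by simp)
      (fun t h0 _ => (hdp t h0).mul ((hG _ (hex t h0)).1.comp t (hdw t h0))) (fun t h0 _ => ?_)
    have h2 := (hG _ (hex t h0.le)).2
    have ht : 0 < 1 + t := by positivity
    have h3 : (1 - t / (1 + t)) ^ (-(1 - δ - (m : ℝ))) = (1 + t) ^ (1 - δ - (m : ℝ)) := by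
      have : 1 - t / (1 + t) = (1 + t)⁻¹ := by field_simp; ring
      rw [this, Real.inv_rpow ht.le, ← Real.rpow_neg ht.le, neg_neg]
    rw [h3] at h2
    have h4 : (1 + t) ^ δ = (1 + t) ^ (δ - 1) * (1 + t) := by
      rw [← Real.rpow_add_one ht.ne']; congr 1; ring
    have h5 : (1 + t) ^ (-(m : ℝ)) = (1 + t) ^ (δ - 1) * (1 + t) ^ (1 - δ - (m : ℝ)) := by
      rw [← Real.rpow_add ht]; congr 1; ring
    rw [h4, h5]
    have h6 : t * ((1 + t) ^ (δ - 1) * (1 + t) * (G' (t / (1 + t)) * (1 / (1 + t) ^ 2))) =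
        (1 + t) ^ (δ - 1) * (t / (1 + t) * G' (t / (1 + t))) := by
      field_simp
    rw [mul_add, h6, h2]
    ring

end

end RISNoma

namespace RISNoma

noncomputable section

open Filter Topology

/-! ### The Laplace exponent of an interferer -/

/-- `m log (1 + κ u ^ (-α))`, the exponent of an interferer at relative distance `u`. -/
def interfererExponent (m : ℕ) (κ α u : ℝ) : ℝ≥0∞ :=
  ENNReal.ofReal (m * Real.log (1 + κ * u ^ (-α)))

lemma measurable_interfererExponent (m : ℕ) (κ α : ℝ) : Measurable (interfererExponent m κ α) := by
  unfold interfererExponent; fun_prop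

lemma continuousAt_interfererExponent (m : ℕ) {κ α u : ℝ} (hκ : 0 ≤ κ) (hu : 0 < u) :
    ContinuousAt (interfererExponent m κ α) u := by
  have h1 : ContinuousAt (fun u : ℝ => u ^ (-α)) u := Real.continuousAt_rpow_const _ _ (Or.inl hu.ne')
  have h2 : 1 + κ * u ^ (-α) ≠ 0 := by positivity
  exact ENNReal.continuous_ofReal.continuousAt.comp
    (continuousAt_const.mul ((continuousAt_const.add (continuousAt_const.mul h1)).log h2))

lemma interfererExponent_le (m : ℕ) {κ α u : ℝ} (hκ : 0 ≤ κ) (hu : 0 < u) :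
    interfererExponent m κ α u ≤ ENNReal.ofReal ((m * κ) * u ^ (-α)) := by
  refine ENNReal.ofReal_le_ofReal ?_
  rw [mul_assoc]
  refine mul_le_mul_of_nonneg_left ?_ (Nat.cast_nonneg m)
  have := Real.log_le_sub_one_of_pos (show 0 < 1 + κ * u ^ (-α) by positivity)
  linarith

lemma one_sub_expNeg_interfererExponent (m : ℕ) {κ α u : ℝ} (hκ : 0 ≤ κ) (hu : 0 < u) :
    1 - expNeg (interfererExponent m κ α u) =
      ENNReal.ofReal (1 - (1 + κ * u ^ (-α)) ^ (-(m : ℝ))) := by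
  have h0 : 0 ≤ κ * u ^ (-α) := by positivity
  rw [interfererExponent, expNeg_ofReal (mul_nonneg (Nat.cast_nonneg m) (Real.log_nonneg (by linarith))),
    ← ENNReal.ofReal_one, ← ENNReal.ofReal_sub _ (Real.exp_nonneg _),
    Real.rpow_def_of_pos (show 0 < 1 + κ * u ^ (-α) by linarith)]
  congr 3
  ring

/-- Polar coordinates reduce the planar integral to the radial one. The lower bound comes from the
nonnegative integrand and later makes `β₂` positive. -/
theorem outerIntegral_interfererExponent (m : ℕ) {κ α : ℝ} (hκ : 0 ≤ κ) (hα : 2 < α) :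
    1 ≤ gaussHyp (-(2 / α)) m (1 - 2 / α) (-κ) ∧
    outerIntegral (interfererExponent m κ α) =
      ENNReal.ofReal (Real.pi * (gaussHyp (-(2 / α)) m (1 - 2 / α) (-κ) - 1)) := by
  obtain ⟨hint, hval⟩ := integral_eq_gaussHyp hα m hκ
  let q : ℝ → ℝ := fun u => 1 - (1 + κ * u ^ (-α)) ^ (-(m : ℝ))
  have hq0 : ∀ u, 0 < u → 0 ≤ q u := fun u hu => by
    have h0 : 0 ≤ κ * u ^ (-α) := by positivity
    have h1 : (1 + κ * u ^ (-α)) ^ (-(m : ℝ)) ≤ 1 :=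
      Real.rpow_le_one_of_one_le_of_nonpos (by linarith) (by simp)
    simp only [q]; linarith
  have hge : 1 ≤ gaussHyp (-(2 / α)) m (1 - 2 / α) (-κ) := by
    have : 0 ≤ ∫ u in Ioi 1, 2 * u * (1 - (1 + κ * u ^ (-α)) ^ (-(m : ℝ))) := by
      refine setIntegral_nonneg measurableSet_Ioi fun u hu => ?_
      have hu0 : (0 : ℝ) < u := one_pos.trans hu
      exact mul_nonneg (by positivity) (hq0 u hu0)
    linarith
  refine ⟨hge, ?_⟩
  let F : ℝ → ℝ := (Ici 1).indicator q
  have hF0 : ∀ u, 0 ≤ F u := fun u => indicator_nonneg (fun v hv => hq0 v (one_pos.trans_le hv)) u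
  have hint' : IntegrableOn (fun u => u * q u) (Ioi 1) := by
    refine (hint.const_mul (1 / 2)).congr (ae_of_all _ fun u => ?_)
    simp only [q]; ring
  have hyF : (fun y : ℝ => y ^ (2 - 1) • F y) = (Ici 1).indicator fun u => u * q u := by
    funext y
    by_cases hy : (1 : ℝ) ≤ y
    · simp [F, indicator_of_mem (show y ∈ Ici (1 : ℝ) from hy)]
    · simp [F, indicator_of_notMem (show y ∉ Ici (1 : ℝ) from hy)]
  have hsub : (Ioi 0 ∩ Ici 1 : Set ℝ) = Ici 1 := by
    ext y; simp only [mem_inter_iff, mem_Ioi, mem_Ici]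
    exact ⟨fun h => h.2, fun h => ⟨one_pos.trans_le h, h⟩⟩
  have hFint : Integrable (fun x : Plane => F ‖x‖) := by
    rw [integrable_fun_norm_addHaar, finrank_euclideanSpace, Fintype.card_fin, hyF, IntegrableOn,
      integrable_indicator_iff measurableSet_Ici, IntegrableOn,
      Measure.restrict_restrict measurableSet_Ici, inter_comm, hsub]
    exact (integrableOn_Ici_iff_integrableOn_Ioi enorm_ne_top).2 hint'
  have hFval : ∫ x : Plane, F ‖x‖ =
      Real.pi * (gaussHyp (-(2 / α)) m (1 - 2 / α) (-κ) - 1) := by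
    rw [integral_fun_norm_addHaar, finrank_euclideanSpace, Fintype.card_fin, hyF,
      setIntegral_indicator measurableSet_Ici, hsub, integral_Ici_eq_integral_Ioi, Measure.real,
      volume_ball_plane 0 zero_le_one, ENNReal.toReal_ofReal (by positivity), ← hval]
    simp only [nsmul_eq_mul, smul_eq_mul, one_pow, mul_one, Nat.cast_ofNat]
    have h2 : ∫ u in Ioi 1, 2 * u * (1 - (1 + κ * u ^ (-α)) ^ (-(m : ℝ))) =
        2 * ∫ u in Ioi 1, u * q u := by
      rw [← integral_const_mul]
      refine integral_congr_ae (ae_of_all _ fun u => ?_)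
      simp only [q]; ring
    rw [h2]
    ring
  rw [← hFval, ofReal_integral_eq_lintegral_ofReal hFint (ae_of_all _ fun x => hF0 _)]
  refine lintegral_congr fun x => ?_
  by_cases hx : 1 ≤ ‖x‖
  · rw [if_pos hx, one_sub_expNeg_interfererExponent m hκ (one_pos.trans_le hx)]
    simp [F, q, hx]
  · rw [if_neg hx]
    simp [F, hx]

/-! ### Independence and conditioning -/

section Independence

variable {Ω A B : Type*} [MeasurableSpace Ω] [MeasurableSpace A] [MeasurableSpace B]
  {P : Measure Ω} [IsProbabilityMeasure P] {f : Ω → A} {g : Ω → B}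

/-- Fubini for the joint law: averaging over `f` with `g` frozen does the work of conditional
expectation. -/
lemma lintegral_comp_of_indepFun (hf : Measurable f) (hg : Measurable g) (h : IndepFun f g P)
    {F : A → B → ℝ≥0∞} (hF : Measurable fun q : A × B => F q.1 q.2) :
    ∫⁻ ω, F (f ω) (g ω) ∂P = ∫⁻ ω, ∫⁻ ω', F (f ω') (g ω) ∂P ∂P := by
  have : IsProbabilityMeasure (P.map f) := Measure.isProbabilityMeasure_map hf.aemeasurable
  have : IsProbabilityMeasure (P.map g) := Measure.isProbabilityMeasure_map hg.aemeasurable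
  have h1 := (indepFun_iff_map_prod_eq_prod_map_map hf.aemeasurable hg.aemeasurable).1 h
  have h2 : ∫⁻ ω, F (f ω) (g ω) ∂P = ∫⁻ q, F q.1 q.2 ∂(P.map fun ω => (f ω, g ω)) :=
    (lintegral_map hF (hf.prodMk hg)).symm
  rw [h2, h1, lintegral_prod_symm _ hF.aemeasurable,
    lintegral_map (Measurable.lintegral_prod_left' hF) hg]
  refine lintegral_congr fun ω => ?_
  have h3 : Measurable fun a => F a (g ω) := hF.comp measurable_prodMk_right
  rw [lintegral_map h3 hf]

/-- The null sets available for each frozen value of `g` need not have a null union; the product law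
controls them jointly. -/
lemma ae_of_indepFun (hf : Measurable f) (hg : Measurable g) (h : IndepFun f g P)
    {p : A → B → Prop} (hp : MeasurableSet {q : A × B | p q.1 q.2})
    (hae : ∀ᵐ ω ∂P, ∀ᵐ ω' ∂P, p (f ω') (g ω)) : ∀ᵐ ω ∂P, p (f ω) (g ω) := by
  have : IsProbabilityMeasure (P.map f) := Measure.isProbabilityMeasure_map hf.aemeasurable
  have : IsProbabilityMeasure (P.map g) := Measure.isProbabilityMeasure_map hg.aemeasurable
  have hI := lintegral_comp_of_indepFun hf hg h (F := fun a b =>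
    {q : A × B | p q.1 q.2}ᶜ.indicator 1 (a, b)) (measurable_one.indicator hp.compl)
  have h0 : ∫⁻ ω, ∫⁻ ω', {q : A × B | p q.1 q.2}ᶜ.indicator (1 : A × B → ℝ≥0∞) (f ω', g ω) ∂P ∂P = 0 := by
    rw [lintegral_congr_ae (g := fun _ => 0), lintegral_zero]
    filter_upwards [hae] with ω hω
    rw [lintegral_congr_ae (g := fun _ => 0), lintegral_zero]
    filter_upwards [hω] with ω' hω'
    exact indicator_of_notMem (by simpa using hω') _
  have hm : Measurable fun ω => {q : A × B | p q.1 q.2}ᶜ.indicator (1 : A × B → ℝ≥0∞) (f ω, g ω) :=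
    (measurable_one.indicator hp.compl).comp (hf.prodMk hg)
  rw [h0, lintegral_eq_zero_iff hm] at hI
  filter_upwards [hI] with ω hω
  by_contra hn
  have : (f ω, g ω) ∈ {q : A × B | p q.1 q.2}ᶜ := hn
  simp [this] at hω

end Independence

/-! ### Nakagami fading -/

section Fading

variable {Ω : Type*} [MeasurableSpace Ω] {P : Measure Ω} {m : ℕ} {h : ℕ → Ω → ℂ}

lemma lintegral_gain (hh : IsNakagamiFading m h P) (i : ℕ) {F : ℝ → ℝ≥0∞} (hF : Measurable F) :
    ∫⁻ ω, F (‖h i ω‖ ^ 2) ∂P = ∫⁻ x, F x ∂(gammaMeasure m m) := by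
  have hm : Measurable fun ω => ‖h i ω‖ ^ 2 := (hh.measurable i).norm.pow_const 2
  rw [← hh.law i, lintegral_map hF hm]

/-- Independence factors the partial sums into Gamma Laplace transforms; the exponentials are
bounded by one, so the limit passes. -/
lemma lintegral_expNeg_tsum_gain [IsProbabilityMeasure P] (hm : 1 ≤ m) (hh : IsNakagamiFading m h P)
    {c : ℕ → ℝ} (hc : ∀ i, 0 ≤ c i) :
    ∫⁻ ω, expNeg (∑' i, ENNReal.ofReal (c i * ‖h i ω‖ ^ 2)) ∂P =
      expNeg (∑' i, ENNReal.ofReal (m * Real.log (1 + c i / m))) := by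
  have hm0 : (0 : ℝ) < m := by exact_mod_cast hm
  have hmeas : ∀ i, Measurable fun z : ℂ => ENNReal.ofReal (c i * ‖z‖ ^ 2) := fun i => by fun_prop
  have hL : Tendsto (fun n => ∫⁻ ω, expNeg (∑ i ∈ Finset.range n, ENNReal.ofReal (c i * ‖h i ω‖ ^ 2)) ∂P)
      atTop (𝓝 (∫⁻ ω, expNeg (∑' i, ENNReal.ofReal (c i * ‖h i ω‖ ^ 2)) ∂P)) := by
    refine tendsto_lintegral_of_dominated_convergence (fun _ => 1)
      (fun n => measurable_expNeg.comp (Finset.measurable_sum _ fun i _ => (hmeas i).comp (hh.measurable i)))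
      (fun n => ae_of_all _ fun ω => expNeg_le_one _) (by simp) (ae_of_all _ fun ω => ?_)
    exact (continuous_expNeg.tendsto _).comp (ENNReal.tendsto_nat_tsum _)
  have hR : Tendsto (fun n => expNeg (∑ i ∈ Finset.range n, ENNReal.ofReal (m * Real.log (1 + c i / m))))
      atTop (𝓝 (expNeg (∑' i, ENNReal.ofReal (m * Real.log (1 + c i / m))))) :=
    (continuous_expNeg.tendsto _).comp (ENNReal.tendsto_nat_tsum _)
  refine tendsto_nhds_unique hL (hR.congr fun n => ?_)
  simp_rw [expNeg_sum]
  have hind := hh.indep.comp (fun i z => expNeg (ENNReal.ofReal (c i * ‖z‖ ^ 2)))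
    (fun i => measurable_expNeg.comp (hmeas i))
  have := lintegral_prod_eq_prod_lintegral_of_indepFun (Finset.range n) _ hind
    (fun i => (measurable_expNeg.comp (hmeas i)).comp (hh.measurable i))
  simp only [Function.comp_def] at this
  rw [this]
  refine Finset.prod_congr rfl fun i _ => ?_
  rw [lintegral_gain hh i (F := fun x => expNeg (ENNReal.ofReal (c i * x)))
    (measurable_expNeg.comp (by fun_prop)), lintegral_expNeg_gammaMeasure hm0 hm0 (hc i)]

lemma ae_tsum_gain_lt_top [IsProbabilityMeasure P] (hm : 1 ≤ m) (hh : IsNakagamiFading m h P)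
    {c : ℕ → ℝ} (hc : ∀ i, 0 ≤ c i) (hsum : ∑' i, ENNReal.ofReal (c i) < ∞) :
    ∀ᵐ ω ∂P, ∑' i, ENNReal.ofReal (c i * ‖h i ω‖ ^ 2) < ∞ := by
  have hm0 : (0 : ℝ) < m := by exact_mod_cast hm
  have hmeas : ∀ i, Measurable fun z : ℂ => ENNReal.ofReal (c i * ‖z‖ ^ 2) := fun i => by fun_prop
  refine ae_lt_top_of_le_lintegral_expNeg
    (Measurable.tsum fun i => (hmeas i).comp (hh.measurable i)) hsum.ne fun n => ?_
  have hn : (n + 1 : ℝ≥0∞)⁻¹ = ENNReal.ofReal ((n + 1 : ℝ)⁻¹) := by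
    rw [ENNReal.ofReal_inv_of_pos (by positivity), ENNReal.ofReal_add (by positivity) zero_le_one,
      ENNReal.ofReal_natCast, ENNReal.ofReal_one]
  have hn0 : 0 ≤ (n + 1 : ℝ)⁻¹ := by positivity
  rw [hn]
  simp_rw [← ENNReal.tsum_mul_left, ← ENNReal.ofReal_mul hn0, ← mul_assoc]
  rw [lintegral_expNeg_tsum_gain hm hh (fun i => mul_nonneg hn0 (hc i))]
  refine expNeg_antitone (ENNReal.tsum_le_tsum fun i => ENNReal.ofReal_le_ofReal ?_)
  have hci := hc i
  have := Real.log_le_sub_one_of_pos (show 0 < 1 + (n + 1 : ℝ)⁻¹ * c i / m by positivity)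
  calc (m : ℝ) * Real.log (1 + (n + 1 : ℝ)⁻¹ * c i / m) ≤ m * ((n + 1 : ℝ)⁻¹ * c i / m) := by
        gcongr; linarith
    _ = _ := by field_simp

/-- The σ-algebra is left free, and gains with zero coefficient are exempt, so that the σ-algebra of
all gains but one can be used. -/
lemma measurable_tsum_gain {Ω' : Type*} [MeasurableSpace Ω'] {h : ℕ → Ω' → ℂ} {c : ℕ → ℝ}
    (hh : ∀ i, c i ≠ 0 → Measurable (h i)) :
    Measurable fun ω => ∑' i, ENNReal.ofReal (c i * ‖h i ω‖ ^ 2) := by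
  refine Measurable.tsum fun i => ?_
  by_cases hi : c i = 0
  · simp [hi]
  · have h2 : Measurable fun z : ℂ => ENNReal.ofReal (c i * ‖z‖ ^ 2) := by fun_prop
    exact h2.comp (hh i hi)

/-- With zero weight on the `k`-th gain, the sum is measurable with respect to the remaining ones.
-/
lemma indepFun_gain_tsum [IsProbabilityMeasure P] (hh : IsNakagamiFading m h P) (k : ℕ)
    {c : ℕ → ℝ} (hck : c k = 0) :
    IndepFun (fun ω => ‖h k ω‖ ^ 2) (fun ω => ∑' i, ENNReal.ofReal (c i * ‖h i ω‖ ^ 2)) P := by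
  have hle : ∀ i, MeasurableSpace.comap (h i) inferInstance ≤ (inferInstance : MeasurableSpace Ω) :=
    fun i => (hh.measurable i).comap_le
  have hI := indep_iSup_of_disjoint hle hh.indep.iIndep
    (S := {k}) (T := {k}ᶜ) disjoint_compl_right
  rw [IndepFun_iff_Indep]
  refine indep_of_indep_of_le_left (indep_of_indep_of_le_right hI ?_) ?_
  · refine Measurable.comap_le (@measurable_tsum_gain Ω
      (⨆ i ∈ ({k}ᶜ : Set ℕ), MeasurableSpace.comap (h i) inferInstance) h c fun i hi => ?_)
    have hik : i ≠ k := fun h => hi (h ▸ hck)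
    exact Measurable.mono (comap_measurable (h i)) (le_iSup₂_of_le i hik le_rfl) le_rfl
  · have h2 : Measurable fun z : ℂ => ‖z‖ ^ 2 := by fun_prop
    exact Measurable.comap_le (h2.comp
      (Measurable.mono (comap_measurable (h k)) (le_iSup₂_of_le k rfl le_rfl) le_rfl))

end Fading

/-! ### Positivity of the parameters -/

/-- The sum of cosines is `2 cos(θ/2) cos((2ρ-1)θ/2)`, and both angles lie strictly between `-π/2`
and `π/2`. -/
lemma Params.meanC_pos (p : Params) : 0 < p.meanC := by
  have hpi := Real.pi_pos
  refine mul_pos (by positivity) ?_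
  refine intervalIntegral.intervalIntegral_pos_of_pos_on
    (Continuous.intervalIntegrable (by fun_prop) _ _) (fun θ hθ => ?_) hpi
  have hL := p.L_pos
  have h1 := p.rhoA_pos
  have h2 := p.rhoA_lt
  obtain ⟨h3, h4⟩ := hθ
  have h5 : 0 < p.rhoA * θ := mul_pos h1 h3
  have h6 : p.rhoA * θ < θ := by nlinarith
  have hcos : 0 < Real.cos (p.rhoA * θ) + Real.cos ((1 - p.rhoA) * θ) := by
    rw [Real.cos_add_cos]
    refine mul_pos (mul_pos two_pos ?_) ?_
    · exact Real.cos_pos_of_mem_Ioo ⟨by linarith, by linarith⟩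
    · exact Real.cos_pos_of_mem_Ioo ⟨by linarith, by linarith⟩
  positivity

lemma Params.lossT_pos (p : Params) {x z : Plane} (hx : x ≠ z) (hz : z ≠ 0) : 0 < p.lossT x z := by
  have := p.meanC_pos
  have h1 := dist_pos.2 hx
  have h2 := norm_pos_iff.2 hz
  unfold Params.lossT
  positivity

lemma Params.lossT_nonneg (p : Params) (x z : Plane) : 0 ≤ p.lossT x z := by
  have := p.meanC_pos
  unfold Params.lossT
  positivity

end

end RISNoma

namespace RISNoma

noncomputable section

open Filter Topology

/-! ### Measurability of the network functionals -/

lemma measurable_serving : Measurable fun q : (ℕ → Plane) × Plane => serving q.1 q.2 := by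
  have hS : ∀ i, MeasurableSet {q : (ℕ → Plane) × Plane | ∀ j, dist (q.1 i) q.2 ≤ dist (q.1 j) q.2} := by
    intro i
    have : {q : (ℕ → Plane) × Plane | ∀ j, dist (q.1 i) q.2 ≤ dist (q.1 j) q.2} =
        ⋂ j, {q | dist (q.1 i) q.2 ≤ dist (q.1 j) q.2} := by
      ext q; simp
    rw [this]
    exact MeasurableSet.iInter fun j => measurableSet_le (by fun_prop) (by fun_prop)
  refine measurable_of_Iio fun n => ?_
  -- Without a minimizer `serving` is `sInf ∅ = 0`, which is below `n` exactly when `0 < n`.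
  have hset : (fun q : (ℕ → Plane) × Plane => serving q.1 q.2) ⁻¹' Iio n =
      (⋃ i ∈ Iio n, {q : (ℕ → Plane) × Plane | ∀ j, dist (q.1 i) q.2 ≤ dist (q.1 j) q.2}) ∪
        {q | 0 < n ∧ ∀ i, ¬ ∀ j, dist (q.1 i) q.2 ≤ dist (q.1 j) q.2} := by
    ext q
    simp only [mem_preimage, mem_Iio, mem_union, mem_iUnion, mem_ofPred_eq, exists_prop]
    constructor
    · intro h
      by_cases hne : {i | ∀ j, dist (q.1 i) q.2 ≤ dist (q.1 j) q.2}.Nonempty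
      · exact Or.inl ⟨_, h, Nat.sInf_mem hne⟩
      · refine Or.inr ⟨by omega, fun i hi => hne ⟨i, hi⟩⟩
    · rintro (⟨i, hi, hq⟩ | ⟨hn, hq⟩)
      · exact (Nat.sInf_le (show i ∈ {i | ∀ j, dist (q.1 i) q.2 ≤ dist (q.1 j) q.2} from hq)).trans_lt hi
      · have : {i | ∀ j, dist (q.1 i) q.2 ≤ dist (q.1 j) q.2} = ∅ := by
          ext i; simpa using hq i
        rw [serving, this, Nat.sInf_empty]
        exact hn
  rw [hset]
  refine (MeasurableSet.biUnion (to_countable _) fun i _ => hS i).union ?_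
  by_cases hn : 0 < n
  · simp only [hn, true_and]
    have : {q : (ℕ → Plane) × Plane | ∀ i, ¬ ∀ j, dist (q.1 i) q.2 ≤ dist (q.1 j) q.2} =
        ⋂ i, {q : (ℕ → Plane) × Plane | ∀ j, dist (q.1 i) q.2 ≤ dist (q.1 j) q.2}ᶜ := by
      ext q; simp
    rw [this]
    exact MeasurableSet.iInter fun i => (hS i).compl
  · simp [hn]

lemma measurable_apply_of_nat {A B : Type*} [MeasurableSpace A] [MeasurableSpace B]
    {F : ℕ → A → B} (hF : ∀ i, Measurable (F i)) {K : A → ℕ} (hK : Measurable K) :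
    Measurable fun a => F (K a) a := by
  have h : Measurable fun q : ℕ × A => F q.1 q.2 := measurable_from_prod_countable_right hF
  exact h.comp (hK.prodMk measurable_id)

lemma measurable_nearest :
    Measurable fun q : (ℕ → Plane) × Plane => q.1 (serving q.1 q.2) :=
  measurable_apply_of_nat (F := fun i (q : (ℕ → Plane) × Plane) => q.1 i)
    (fun i => by fun_prop) measurable_serving

namespace Params

variable (p : Params)

lemma measurable_lossT : Measurable fun q : Plane × Plane => p.lossT q.1 q.2 := by
  unfold lossT; fun_prop

/-- Coefficient of the gain `|h i|²` in the interference at the typical user. -/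
def interfCoeff (x : ℕ → Plane) (z : Plane) (i : ℕ) : ℝ :=
  if i = serving x z then 0 else p.rhoT * (p.Pb * p.lossT (x i) z)

lemma interfCoeff_nonneg (x : ℕ → Plane) (z : Plane) (i : ℕ) : 0 ≤ p.interfCoeff x z i := by
  have h1 := p.lossT_nonneg (x i) z
  have h2 := p.Pb_pos
  have h3 := p.rhoT_nonneg
  unfold interfCoeff
  split_ifs <;> positivity

lemma interfT_eq_tsum (x : ℕ → Plane) (z : Plane) (h : ℕ → ℂ) :
    p.interfT x z h = ∑' i, ENNReal.ofReal (p.interfCoeff x z i * ‖h i‖ ^ 2) := by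
  rw [interfT, ← ENNReal.tsum_mul_left]
  refine tsum_congr fun i => ?_
  unfold interfCoeff
  split_ifs with hi
  · simp
  · rw [← ENNReal.ofReal_mul p.rhoT_nonneg]
    congr 1; ring

lemma measurable_interfT :
    Measurable fun q : (ℕ → ℂ) × ((ℕ → Plane) × Plane) => p.interfT q.2.1 q.2.2 q.1 := by
  simp_rw [interfT_eq_tsum]
  refine Measurable.tsum fun i => ?_
  have hs : Measurable fun q : (ℕ → ℂ) × ((ℕ → Plane) × Plane) => serving q.2.1 q.2.2 :=
    measurable_serving.comp measurable_snd
  have hl : Measurable fun q : (ℕ → ℂ) × ((ℕ → Plane) × Plane) => p.lossT (q.2.1 i) q.2.2 :=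
    p.measurable_lossT.comp (f := fun q : (ℕ → ℂ) × ((ℕ → Plane) × Plane) => (q.2.1 i, q.2.2))
      (by fun_prop)
  have hc : Measurable fun q : (ℕ → ℂ) × ((ℕ → Plane) × Plane) => p.interfCoeff q.2.1 q.2.2 i :=
    Measurable.ite (measurableSet_eq_fun measurable_const hs) measurable_const (by fun_prop)
  fun_prop

/-- The level with which the gain of the associated base station is compared, for the overall
threshold `u`. -/
def levelOf (u : ℝ) (h : ℕ → ℂ) (q : (ℕ → Plane) × Plane) : ℝ :=
  u * ((p.interfT q.1 q.2 h).toReal + p.sigma ^ 2) / (p.Pb * p.lossT (q.1 (serving q.1 q.2)) q.2)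

lemma measurable_levelOf (u : ℝ) :
    Measurable fun q : (ℕ → ℂ) × ((ℕ → Plane) × Plane) => p.levelOf u q.1 q.2 := by
  have h0 : Measurable fun q : (ℕ → Plane) × Plane => p.lossT (q.1 (serving q.1 q.2)) q.2 := by
    have h := measurable_nearest.prodMk (measurable_snd (α := ℕ → Plane) (β := Plane))
    have h' := p.measurable_lossT.comp h
    exact h'
  have h1 : Measurable fun q : (ℕ → ℂ) × ((ℕ → Plane) × Plane) =>
      p.lossT (q.2.1 (serving q.2.1 q.2.2)) q.2.2 := h0.comp measurable_snd
  have h2 := p.measurable_interfT.ennreal_toReal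
  unfold levelOf
  fun_prop

lemma levelOf_nonneg {u : ℝ} (hu : 0 ≤ u) (h : ℕ → ℂ) (q : (ℕ → Plane) × Plane) :
    0 ≤ p.levelOf u h q := by
  have h1 := p.lossT_nonneg (q.1 (serving q.1 q.2)) q.2
  have h2 := p.Pb_pos
  unfold levelOf
  positivity

/-- Configurations without the exceptional behaviour of probability zero. -/
def Regular (q : (ℕ → Plane) × Plane) : Prop :=
  q.2 ≠ 0 ∧ (∀ i, q.1 i ≠ q.2) ∧ ∑' i, ENNReal.ofReal (dist (q.1 i) q.2 ^ (-p.alphaT)) < ∞ ∧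
    dist (q.1 (serving q.1 q.2)) q.2 = minDist q.1 q.2

lemma measurableSet_regular : MeasurableSet {q | p.Regular q} := by
  have h1 : MeasurableSet {q : (ℕ → Plane) × Plane | q.2 ≠ 0} :=
    (measurable_snd (measurableSet_singleton 0)).compl
  have h2 : MeasurableSet {q : (ℕ → Plane) × Plane | ∀ i, q.1 i ≠ q.2} := by
    have : {q : (ℕ → Plane) × Plane | ∀ i, q.1 i ≠ q.2} = ⋂ i, {q | q.1 i = q.2}ᶜ := by
      ext q; simp
    rw [this]
    exact MeasurableSet.iInter fun i => (measurableSet_eq_fun (by fun_prop) (by fun_prop)).compl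
  have h3 : MeasurableSet {q : (ℕ → Plane) × Plane |
      ∑' i, ENNReal.ofReal (dist (q.1 i) q.2 ^ (-p.alphaT)) < ∞} :=
    measurableSet_lt (Measurable.tsum fun i => by fun_prop) measurable_const
  have h4 : MeasurableSet {q : (ℕ → Plane) × Plane |
      dist (q.1 (serving q.1 q.2)) q.2 = minDist q.1 q.2} :=
    measurableSet_eq_fun (measurable_nearest.dist measurable_snd) measurable_minDist
  exact h1.inter (h2.inter (h3.inter h4))

variable {p} {q : (ℕ → Plane) × Plane}

lemma Regular.lossT_pos (hq : p.Regular q) (i : ℕ) : 0 < p.lossT (q.1 i) q.2 :=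
  p.lossT_pos (hq.2.1 i) hq.1

lemma Regular.tsum_interfCoeff_lt_top (hq : p.Regular q) :
    ∑' i, ENNReal.ofReal (p.interfCoeff q.1 q.2 i) < ∞ := by
  have hPb := p.Pb_pos
  have hr := p.rhoT_nonneg
  have hC := p.meanC_pos
  have hle : ∀ i, ENNReal.ofReal (p.interfCoeff q.1 q.2 i) ≤
      ENNReal.ofReal (p.rhoT * (p.Pb * (p.meanC * ‖q.2‖ ^ (-p.alphaT)))) *
        ENNReal.ofReal (dist (q.1 i) q.2 ^ (-p.alphaT)) := fun i => by
    rw [← ENNReal.ofReal_mul (by positivity)]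
    refine ENNReal.ofReal_le_ofReal ?_
    unfold interfCoeff
    split_ifs
    · positivity
    · rw [lossT, Real.mul_rpow dist_nonneg (norm_nonneg _)]
      exact le_of_eq (by ring)
  refine (ENNReal.tsum_le_tsum hle).trans_lt ?_
  rw [ENNReal.tsum_mul_left]
  exact ENNReal.mul_lt_top ENNReal.ofReal_lt_top hq.2.2.1

lemma Regular.levelOf_pos (hq : p.Regular q) {u : ℝ} (hu : 0 < u) (h : ℕ → ℂ) :
    0 < p.levelOf u h q := by
  have h1 := hq.lossT_pos (serving q.1 q.2)
  have h2 := p.Pb_pos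
  have h3 := p.sigma_pos
  unfold levelOf
  have : 0 ≤ (p.interfT q.1 q.2 h).toReal := ENNReal.toReal_nonneg
  positivity

/-! ### Averaging over the fading for fixed positions -/

section Fading

variable {Ω : Type*} [MeasurableSpace Ω] {P : Measure Ω} [IsProbabilityMeasure P] {h : ℕ → Ω → ℂ}

lemma Regular.ae_interfT_lt_top (hq : p.Regular q) (hh : IsNakagamiFading p.mT h P) :
    ∀ᵐ ω ∂P, p.interfT q.1 q.2 (fun i => h i ω) < ∞ := by
  simp_rw [interfT_eq_tsum]
  exact ae_tsum_gain_lt_top p.mT_pos hh (p.interfCoeff_nonneg _ _) hq.tsum_interfCoeff_lt_top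

/-- Averaging over the fading turns the exponential of the level into the product of the
contributions of noise and interferers. -/
lemma Regular.lintegral_expNeg_levelOf (hq : p.Regular q) (hh : IsNakagamiFading p.mT h P)
    {u t : ℝ} (hu : 0 ≤ u) (ht : 0 ≤ t) :
    ∫⁻ ω, expNeg (ENNReal.ofReal (t * p.levelOf u (fun i => h i ω) q)) ∂P =
      expNeg (ENNReal.ofReal (t * u * p.sigma ^ 2 / (p.Pb * p.meanC) * ‖q.2‖ ^ p.alphaT *
        minDist q.1 q.2 ^ p.alphaT)) *
      interfererFactor (interfererExponent p.mT (p.rhoT * t * u / p.mT) p.alphaT) q.2 q.1 := by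
  obtain ⟨x, z⟩ := q
  set s := serving x z with hs
  have hPb := p.Pb_pos
  have hC := p.meanC_pos
  have hloss : 0 < p.lossT (x s) z := hq.lossT_pos s
  have hz : 0 < ‖z‖ := norm_pos_iff.2 hq.1
  have hmin : dist (x s) z = minDist x z := hq.2.2.2
  have hds : ∀ i, 0 < dist (x i) z := fun i => dist_pos.2 (hq.2.1 i)
  have hm0 : (0 : ℝ) < p.mT := by exact_mod_cast p.mT_pos
  set a : ℝ := t * u / (p.Pb * p.lossT (x s) z) with ha
  have ha0 : 0 ≤ a := by positivity
  have hsplit : ∀ᵐ ω ∂P, expNeg (ENNReal.ofReal (t * p.levelOf u (fun i => h i ω) (x, z))) =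
      expNeg (ENNReal.ofReal (a * p.sigma ^ 2)) *
        expNeg (∑' i, ENNReal.ofReal (a * p.interfCoeff x z i * ‖h i ω‖ ^ 2)) := by
    filter_upwards [hq.ae_interfT_lt_top hh] with ω hω
    rw [← expNeg_add]
    congr 1
    have h1 : t * p.levelOf u (fun i => h i ω) (x, z) =
        a * p.sigma ^ 2 + a * (p.interfT x z fun i => h i ω).toReal := by
      simp only [levelOf, ha, hs]; ring
    rw [h1, ENNReal.ofReal_add (by positivity) (by positivity),
      ENNReal.ofReal_mul (p := a) (q := ENNReal.toReal _) ha0, ENNReal.ofReal_toReal hω.ne, interfT_eq_tsum,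
      ← ENNReal.tsum_mul_left]
    congr 1
    refine tsum_congr fun i => ?_
    rw [← ENNReal.ofReal_mul ha0, mul_assoc]
  have hmeas : Measurable fun ω => expNeg (∑' i, ENNReal.ofReal (a * p.interfCoeff x z i * ‖h i ω‖ ^ 2)) :=
    measurable_expNeg.comp (measurable_tsum_gain fun i _ => hh.measurable i)
  rw [lintegral_congr_ae hsplit, lintegral_const_mul _ hmeas,
    lintegral_expNeg_tsum_gain p.mT_pos hh (fun i => mul_nonneg ha0 (p.interfCoeff_nonneg x z i))]
  have hpow : (dist (x s) z * ‖z‖) ^ p.alphaT * (dist (x s) z * ‖z‖) ^ (-p.alphaT) = 1 := by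
    rw [← Real.rpow_add (mul_pos (hds s) hz), add_neg_cancel, Real.rpow_zero]
  have hne : (dist (x s) z * ‖z‖) ^ (-p.alphaT) ≠ 0 := (Real.rpow_pos_of_pos (mul_pos (hds s) hz) _).ne'
  congr 1
  · congr 2
    simp only
    rw [← hmin, mul_assoc _ (‖z‖ ^ p.alphaT), ← Real.mul_rpow (norm_nonneg _) dist_nonneg, mul_comm ‖z‖, ha,
      lossT]
    have h2 : (dist (x s) z * ‖z‖) ^ p.alphaT = 1 / (dist (x s) z * ‖z‖) ^ (-p.alphaT) := by
      rw [eq_div_iff hne]; exact hpow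
    rw [h2]
    field_simp
  · rw [interfererFactor]
    congr 1
    refine tsum_congr fun i => ?_
    unfold interfCoeff interfererExponent
    split_ifs with hi
    · simp
    -- The factor `‖z‖^{-α}` cancels between interferer and serving station, leaving the ratio of
    -- distances.
    · congr 4
      rw [ha, lossT, lossT, Real.div_rpow (hds i).le (hds s).le,
        Real.mul_rpow (hds i).le hz.le, Real.mul_rpow (hds s).le hz.le]
      have h3 : ‖z‖ ^ (-p.alphaT) ≠ 0 := (Real.rpow_pos_of_pos hz _).ne'
      have h4 : dist (x s) z ^ (-p.alphaT) ≠ 0 := (Real.rpow_pos_of_pos (hds s) _).ne'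
      field_simp

/-- The gain of the associated base station is independent of the interference. -/
lemma measure_levelOf_lt (hh : IsNakagamiFading p.mT h P) (u : ℝ)
    (q : (ℕ → Plane) × Plane) :
    P {ω | p.levelOf u (fun i => h i ω) q < ‖h (serving q.1 q.2) ω‖ ^ 2} =
      ∫⁻ ω, ENNReal.ofReal (1 - cdf (gammaMeasure p.mT p.mT) (p.levelOf u (fun i => h i ω) q)) ∂P := by
  have hm0 : (0 : ℝ) < p.mT := by exact_mod_cast p.mT_pos
  have : IsProbabilityMeasure (gammaMeasure p.mT p.mT) := isProbabilityMeasure_gammaMeasure hm0 hm0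
  set s := serving q.1 q.2 with hs
  let L : ℝ≥0∞ → ℝ := fun y => u * (y.toReal + p.sigma ^ 2) / (p.Pb * p.lossT (q.1 s) q.2)
  have hL : Measurable L := by
    have := ENNReal.measurable_toReal
    simp only [L]; fun_prop
  have hlev : ∀ ω, p.levelOf u (fun i => h i ω) q =
      L (∑' i, ENNReal.ofReal (p.interfCoeff q.1 q.2 i * ‖h i ω‖ ^ 2)) := fun ω => by
    rw [levelOf, interfT_eq_tsum]
  have hind := indepFun_gain_tsum hh s (c := p.interfCoeff q.1 q.2) (by simp [interfCoeff, hs])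
  have hgm : Measurable fun ω => ‖h s ω‖ ^ 2 := (hh.measurable s).norm.pow_const 2
  have him : Measurable fun ω => ∑' i, ENNReal.ofReal (p.interfCoeff q.1 q.2 i * ‖h i ω‖ ^ 2) :=
    measurable_tsum_gain fun i _ => hh.measurable i
  have hset : MeasurableSet {r : ℝ × ℝ≥0∞ | L r.2 < r.1} :=
    measurableSet_lt (hL.comp measurable_snd) measurable_fst
  have hF := lintegral_comp_of_indepFun hgm him hind
    (F := fun a y => {r : ℝ × ℝ≥0∞ | L r.2 < r.1}.indicator 1 (a, y)) (measurable_one.indicator hset)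
  simp_rw [hlev]
  have hE : MeasurableSet {ω | L (∑' i, ENNReal.ofReal (p.interfCoeff q.1 q.2 i * ‖h i ω‖ ^ 2)) < ‖h s ω‖ ^ 2} :=
    measurableSet_lt (hL.comp him) hgm
  rw [← lintegral_indicator_one hE]
  refine Eq.trans (lintegral_congr fun ω => ?_) (hF.trans (lintegral_congr fun ω => ?_))
  · simp [indicator]
  · rw [lintegral_gain hh s (F := fun a => {r : ℝ × ℝ≥0∞ | L r.2 < r.1}.indicator 1
      (a, ∑' i, ENNReal.ofReal (p.interfCoeff q.1 q.2 i * ‖h i ω‖ ^ 2)))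
      ((measurable_one.indicator hset).comp measurable_prodMk_right)]
    set ℓ := L (∑' i, ENNReal.ofReal (p.interfCoeff q.1 q.2 i * ‖h i ω‖ ^ 2)) with hℓ
    have : ∀ a : ℝ, {r : ℝ × ℝ≥0∞ | L r.2 < r.1}.indicator (1 : ℝ × ℝ≥0∞ → ℝ≥0∞)
        (a, ∑' i, ENNReal.ofReal (p.interfCoeff q.1 q.2 i * ‖h i ω‖ ^ 2)) =
        (Iic ℓ)ᶜ.indicator 1 a := fun a => by
      simp [indicator, hℓ]
    simp_rw [this]
    rw [lintegral_indicator_one measurableSet_Iic.compl, prob_compl_eq_one_sub measurableSet_Iic,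
      ← ofReal_cdf, ENNReal.ofReal_sub _ (cdf_nonneg _ _), ENNReal.ofReal_one]

end Fading

end Params

end

end RISNoma

namespace RISNoma

noncomputable section

open Filter Topology

/-! ### Averaging over the positions -/

/-- `∫ x exp (-b x ^ α) exp (-c x ^ 2) dx` over the positive half-line. -/
def radialIntegral (α b c : ℝ) : ℝ :=
  ∫ x in Ioi (0 : ℝ), x * Real.exp (-(b * x ^ α)) * Real.exp (-(c * x ^ 2))

lemma integrableOn_mul_exp_sq {c : ℝ} (hc : 0 < c) :
    IntegrableOn (fun x : ℝ => x * Real.exp (-(c * x ^ 2))) (Ioi 0) := by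
  have := (integrable_mul_exp_neg_mul_sq hc).integrableOn (s := Ioi (0 : ℝ))
  simpa only [neg_mul] using this

lemma radial_le {α b c x : ℝ} (hb : 0 ≤ b) (hx : 0 < x) :
    x * Real.exp (-(b * x ^ α)) * Real.exp (-(c * x ^ 2)) ≤ x * Real.exp (-(c * x ^ 2)) := by
  have h1 : Real.exp (-(b * x ^ α)) ≤ 1 := Real.exp_le_one_iff.2 (by
    have : 0 ≤ b * x ^ α := by positivity
    linarith)
  have := mul_le_mul_of_nonneg_left h1 hx.le
  rw [mul_one] at this
  exact mul_le_mul_of_nonneg_right this (Real.exp_nonneg _)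

lemma integrableOn_radial {α b c : ℝ} (hb : 0 ≤ b) (hc : 0 < c) :
    IntegrableOn (fun x : ℝ => x * Real.exp (-(b * x ^ α)) * Real.exp (-(c * x ^ 2))) (Ioi 0) := by
  refine (integrableOn_mul_exp_sq hc).mono' (by fun_prop) ?_
  refine (ae_restrict_iff' measurableSet_Ioi).2 (ae_of_all _ fun x hx => ?_)
  have hx : 0 < x := hx
  rw [Real.norm_of_nonneg (by positivity)]
  exact radial_le hb hx

lemma radialIntegral_nonneg (α b c : ℝ) : 0 ≤ radialIntegral α b c :=
  setIntegral_nonneg measurableSet_Ioi fun x hx => by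
    have hx : 0 < x := hx
    positivity

lemma radialIntegral_le {α b c : ℝ} (hb : 0 ≤ b) (hc : 0 < c) :
    radialIntegral α b c ≤ ∫ x in Ioi (0 : ℝ), x * Real.exp (-(c * x ^ 2)) :=
  setIntegral_mono_on (integrableOn_radial hb hc) (integrableOn_mul_exp_sq hc) measurableSet_Ioi
    fun _ hx => radial_le hb hx

lemma stronglyMeasurable_radialIntegral (α c : ℝ) :
    StronglyMeasurable fun b => radialIntegral α b c := by
  unfold radialIntegral
  refine StronglyMeasurable.integral_prod_right (f := fun b x : ℝ =>
    x * Real.exp (-(b * x ^ α)) * Real.exp (-(c * x ^ 2))) ?_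
  refine Measurable.stronglyMeasurable ?_
  fun_prop

variable {Ω : Type*} [MeasurableSpace Ω] {P : Measure Ω}

/-- The Rayleigh density supplies `exp(-πλr²)` and the interferers `exp(-πλ(G-1)r²)`, so the
exponent becomes `πλG r²`. -/
lemma lintegral_expNeg_mul_interfererFactor [IsProbabilityMeasure P] {lam α κ b : ℝ} {m : ℕ} {X : ℕ → Ω → Plane}
    (hlam : 0 < lam) (h : IsPoissonProcess X (planeIntensity lam) P) (z : Plane) (hα : 2 < α)
    (hκ : 0 ≤ κ) (hb : 0 ≤ b) :
    ∫⁻ ω, expNeg (ENNReal.ofReal (b * minDist (fun i => X i ω) z ^ α)) *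
        interfererFactor (interfererExponent m κ α) z (fun i => X i ω) ∂P =
      ENNReal.ofReal (2 * Real.pi * lam *
        radialIntegral α b (Real.pi * lam * gaussHyp (-(2 / α)) m (1 - 2 / α) (-κ))) := by
  obtain ⟨hG, hout⟩ := outerIntegral_interfererExponent m hκ hα
  set G := gaussHyp (-(2 / α)) m (1 - 2 / α) (-κ)
  have hα0 : 0 < α := by linarith
  have hg : Measurable fun r : ℝ => expNeg (ENNReal.ofReal (b * r ^ α)) :=
    measurable_expNeg.comp (by fun_prop)
  have hgc : ∀ u, 0 < u → ContinuousAt (fun r : ℝ => expNeg (ENNReal.ofReal (b * r ^ α))) u := fun u hu =>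
    continuous_expNeg.continuousAt.comp (ENNReal.continuous_ofReal.continuousAt.comp
      (continuousAt_const.mul (Real.continuousAt_rpow_const _ _ (Or.inl hu.ne'))))
  rw [lintegral_interfererFactor hlam.le h (measurable_interfererExponent m κ α)
    (fun u hu => continuousAt_interfererExponent m hκ hu) (C := m * κ) (by positivity) hα
    (fun u hu => interfererExponent_le m hκ hu) z (g := fun r => expNeg (ENNReal.ofReal (b * r ^ α)))
    hg hgc (fun u => expNeg_le_one _) (by rw [hout]; exact ENNReal.ofReal_ne_top), hout]
  have hk : Measurable fun r : ℝ => expNeg (ENNReal.ofReal (b * r ^ α)) *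
      expNeg (ENNReal.ofReal (lam * r ^ 2) * ENNReal.ofReal (Real.pi * (G - 1))) :=
    hg.mul (measurable_expNeg.comp (by fun_prop))
  rw [← lintegral_map hk (measurable_minDist_comp h.measurable z), map_minDist hlam h z,
    lintegral_withDensity_eq_lintegral_mul _ (by fun_prop) hk, radialIntegral, ← integral_const_mul,
    ofReal_integral_eq_lintegral_ofReal]
  · refine setLIntegral_congr_fun measurableSet_Ioi fun r hr => ?_
    have hr : 0 < r := hr
    have hG0 : 0 ≤ Real.pi * (G - 1) := mul_nonneg Real.pi_pos.le (by linarith)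
    simp only [Pi.mul_apply]
    rw [← ENNReal.ofReal_mul (by positivity), expNeg_ofReal (by positivity),
      expNeg_ofReal (by positivity), ← ENNReal.ofReal_mul (by positivity),
      ← ENNReal.ofReal_mul (by positivity)]
    congr 1
    have h1 : Real.exp (-(Real.pi * lam * G * r ^ 2)) =
        Real.exp (-(Real.pi * lam * r ^ 2)) * Real.exp (-(lam * r ^ 2 * (Real.pi * (G - 1)))) := by
      rw [← Real.exp_add]; congr 1; ring
    rw [h1]
    ring
  · exact (integrableOn_radial hb (by have := Real.pi_pos; positivity)).const_mul _
  · refine (ae_restrict_iff' measurableSet_Ioi).2 (ae_of_all _ fun r hr => ?_)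
    have hr : 0 < r := hr
    have := Real.pi_pos
    positivity

lemma integral_uniform_disc {R : ℝ} (hR : 0 < R) {Z : Ω → Plane} (hZ : Measurable Z)
    (hU : pdf.IsUniform Z (Metric.ball (0 : Plane) R) P volume) {K : ℝ → ℝ} (hK : Measurable K) :
    ∫ ω, K ‖Z ω‖ ∂P = ∫ y in (0 : ℝ)..R, K y * (2 * y / R ^ 2) := by
  have hπ := Real.pi_pos
  have h1 : ∫ ω, K ‖Z ω‖ ∂P = ∫ z, K ‖z‖ ∂(P.map Z) :=
    (integral_map hZ.aemeasurable (hK.comp measurable_norm).aestronglyMeasurable).symm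
  rw [h1, show P.map Z = _ from hU, ProbabilityTheory.cond, integral_smul_measure,
    volume_ball_plane 0 hR.le, ← ENNReal.ofReal_inv_of_pos (by positivity),
    ENNReal.toReal_ofReal (by positivity)]
  have h2 : ∫ z in Metric.ball (0 : Plane) R, K ‖z‖ =
      ∫ z : Plane, (Iio R).indicator K ‖z‖ := by
    rw [← integral_indicator Metric.isOpen_ball.measurableSet]
    refine integral_congr_ae (ae_of_all _ fun z => ?_)
    simp [indicator]
  rw [h2, integral_fun_norm_addHaar, finrank_euclideanSpace, Fintype.card_fin, Measure.real,
    volume_ball_plane 0 zero_le_one, ENNReal.toReal_ofReal (by positivity)]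
  have h3 : (fun y : ℝ => y ^ (2 - 1) • (Iio R).indicator K y) =
      (Iio R).indicator fun y => y * K y := by
    funext y
    by_cases hy : y < R <;> simp [indicator, hy]
  rw [h3, setIntegral_indicator measurableSet_Iio, Ioi_inter_Iio,
    intervalIntegral.integral_of_le hR.le, ← integral_Ioc_eq_integral_Ioo, nsmul_eq_mul]
  simp only [smul_eq_mul, one_pow, mul_one, Nat.cast_ofNat]
  have h4 : (fun y => K y * (2 * y / R ^ 2)) = fun y => (2 / R ^ 2) * (y * K y) := by
    funext y; ring
  rw [h4, integral_const_mul]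
  field_simp

/-! ### The random network and the Laplace transform of its level -/

namespace Network

variable {p : Params} (N : Network p P)

lemma measurable_positions : Measurable fun ω => ((fun i => N.X i ω : ℕ → Plane), N.Z ω) :=
  (measurable_pi_iff.2 N.poisson.measurable).prodMk N.measurable_Z

lemma measurable_fading : Measurable fun ω i => N.h i ω :=
  measurable_pi_iff.2 N.nakagami_h.measurable

lemma indepFun_h_positions :
    IndepFun (fun ω i => N.h i ω) (fun ω => ((fun i => N.X i ω : ℕ → Plane), N.Z ω)) P :=
  N.indep_h.comp (φ := id) (ψ := fun q : (ℕ → Plane) × Plane × Plane => (q.1, q.2.1)) measurable_id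
    (by fun_prop)

lemma indepFun_g_positions :
    IndepFun (fun ω i => N.g i ω) (fun ω => ((fun i => N.X i ω : ℕ → Plane), N.Z ω)) P :=
  N.indep_g.comp (φ := id)
    (ψ := fun q : (ℕ → Plane) × Plane × Plane × (ℕ → ℂ) => (q.1, q.2.1)) measurable_id
    (by fun_prop)

lemma ae_Z_ne_zero : ∀ᵐ ω ∂P, N.Z ω ≠ 0 := by
  have hpos := volume_ball_plane 0 p.RL_pos.le
  have hRL := p.RL_pos
  have hac := N.uniform_Z.absolutelyContinuous
  have h0 : P.map N.Z {0} = 0 := hac (by simp)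
  rw [Measure.map_apply N.measurable_Z (measurableSet_singleton 0)] at h0
  exact measure_mono_null (fun ω hω => by simpa using hω) h0

lemma ae_regular [IsProbabilityMeasure P] : ∀ᵐ ω ∂P, p.Regular ((fun i => N.X i ω), N.Z ω) := by
  refine ae_of_indepFun (p := fun x z => p.Regular (x, z)) (measurable_pi_iff.2 N.poisson.measurable)
    N.measurable_Z N.indep_XZ p.measurableSet_regular ?_
  filter_upwards [N.ae_Z_ne_zero] with ω hω
  filter_upwards [ae_finite_ball p.lam_pos.le N.poisson (N.Z ω), ae_ne_center N.poisson (N.Z ω),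
    ae_tsum_dist_rpow_lt_top p.lam_pos.le N.poisson (N.Z ω) p.alphaT_gt] with ω' h1 h2 h3
  exact ⟨hω, h2, h3, dist_serving (x := fun i => N.X i ω') h1⟩

lemma ae_interf_lt_top [IsProbabilityMeasure P] : ∀ᵐ ω ∂P, N.interf ω < ∞ := by
  refine ae_of_indepFun (p := fun (h : ℕ → ℂ) (q : (ℕ → Plane) × Plane) => p.interfT q.1 q.2 h < ∞)
    N.measurable_fading N.measurable_positions N.indepFun_h_positions
    (measurableSet_lt p.measurable_interfT measurable_const) ?_
  filter_upwards [N.ae_regular] with ω hω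
  exact hω.ae_interfT_lt_top N.nakagami_h

lemma upsilon_pos : 0 < N.upsilon :=
  lt_max_of_lt_left (lt_max_of_lt_right (div_pos p.thT_pos p.aT_pos))

lemma level_eq (ω : Ω) :
    N.level ω = p.levelOf N.upsilon (fun i => N.h i ω) ((fun i => N.X i ω), N.Z ω) := rfl

lemma measurable_level : Measurable N.level := by
  have h := (p.measurable_levelOf N.upsilon).comp (N.measurable_fading.prodMk N.measurable_positions)
  rw [show N.level = _ from funext N.level_eq]
  exact h

lemma level_nonneg (ω : Ω) : 0 ≤ N.level ω := by
  rw [level_eq]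
  exact p.levelOf_nonneg N.upsilon_pos.le _ _

lemma ae_level_pos [IsProbabilityMeasure P] : ∀ᵐ ω ∂P, 0 < N.level ω := by
  filter_upwards [N.ae_regular] with ω hω
  exact hω.levelOf_pos N.upsilon_pos _

/-- The Laplace transform of the level. -/
lemma integral_exp_neg_level [IsProbabilityMeasure P] {t : ℝ} (ht : 0 ≤ t) :
    ∫ ω, Real.exp (-(t * N.level ω)) ∂P =
      2 * Real.pi * p.lam * ∫ y in (0 : ℝ)..p.RL,
        radialIntegral p.alphaT (t * N.upsilon * p.sigma ^ 2 / (p.Pb * p.meanC) * y ^ p.alphaT)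
          (Real.pi * p.lam * gaussHyp (-(2 / p.alphaT)) p.mT (1 - 2 / p.alphaT)
            (-(p.rhoT * t * N.upsilon / p.mT))) * (2 * y / p.RL ^ 2) := by
  have hu := N.upsilon_pos
  have hC := p.meanC_pos
  have hPb := p.Pb_pos
  have hm0 : (0 : ℝ) < p.mT := by exact_mod_cast p.mT_pos
  have hrho := p.rhoT_nonneg
  have hlam := p.lam_pos
  have hπ := Real.pi_pos
  set b := t * N.upsilon * p.sigma ^ 2 / (p.Pb * p.meanC) with hb
  have hb0 : 0 ≤ b := by positivity
  set κ := p.rhoT * t * N.upsilon / p.mT with hκ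
  have hκ0 : 0 ≤ κ := by positivity
  set c := Real.pi * p.lam * gaussHyp (-(2 / p.alphaT)) p.mT (1 - 2 / p.alphaT) (-κ)
  let K : ℝ → ℝ := fun y => 2 * Real.pi * p.lam * radialIntegral p.alphaT (b * y ^ p.alphaT) c
  have hK : Measurable K := by
    have h1 := (stronglyMeasurable_radialIntegral p.alphaT c).measurable
    exact (h1.comp (by fun_prop : Measurable fun y : ℝ => b * y ^ p.alphaT)).const_mul _
  have hK0 : ∀ y, 0 ≤ K y := fun y => mul_nonneg (by positivity) (radialIntegral_nonneg _ _ _)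
  have hF : Measurable fun q : (ℕ → ℂ) × ((ℕ → Plane) × Plane) =>
      expNeg (ENNReal.ofReal (t * p.levelOf N.upsilon q.1 q.2)) :=
    measurable_expNeg.comp ((p.measurable_levelOf N.upsilon).const_mul t).ennreal_ofReal
  -- Average over the fading with all positions frozen.
  have h1 : ∫⁻ ω, expNeg (ENNReal.ofReal (t * N.level ω)) ∂P =
      ∫⁻ ω, expNeg (ENNReal.ofReal (b * ‖N.Z ω‖ ^ p.alphaT *
        minDist (fun i => N.X i ω) (N.Z ω) ^ p.alphaT)) *
      interfererFactor (interfererExponent p.mT κ p.alphaT) (N.Z ω) (fun i => N.X i ω) ∂P := by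
    simp_rw [level_eq]
    rw [lintegral_comp_of_indepFun N.measurable_fading N.measurable_positions N.indepFun_h_positions
      (F := fun h q => expNeg (ENNReal.ofReal (t * p.levelOf N.upsilon h q))) hF]
    refine lintegral_congr_ae ?_
    filter_upwards [N.ae_regular] with ω hω
    exact hω.lintegral_expNeg_levelOf N.nakagami_h hu.le ht
  have hF2 : Measurable fun q : (ℕ → Plane) × Plane => expNeg (ENNReal.ofReal (b * ‖q.2‖ ^ p.alphaT *
        minDist q.1 q.2 ^ p.alphaT)) *
      interfererFactor (interfererExponent p.mT κ p.alphaT) q.2 q.1 := by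
    have hmd := measurable_minDist
    refine (measurable_expNeg.comp (by fun_prop)).mul (measurable_expNeg.comp ?_)
    refine Measurable.tsum fun i => Measurable.ite
      (measurableSet_eq_fun measurable_const measurable_serving) measurable_const ?_
    have h2 : Measurable fun q : (ℕ → Plane) × Plane => dist (q.1 (serving q.1 q.2)) q.2 :=
      measurable_nearest.dist measurable_snd
    exact (measurable_interfererExponent p.mT κ p.alphaT).comp (by fun_prop)
  -- Average over the base stations with the surface frozen.
  have h2 : ∫⁻ ω, expNeg (ENNReal.ofReal (t * N.level ω)) ∂P = ∫⁻ ω, ENNReal.ofReal (K ‖N.Z ω‖) ∂P := by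
    rw [h1, lintegral_comp_of_indepFun (measurable_pi_iff.2 N.poisson.measurable) N.measurable_Z
      N.indep_XZ (F := fun x z => expNeg (ENNReal.ofReal (b * ‖z‖ ^ p.alphaT *
        minDist x z ^ p.alphaT)) *
      interfererFactor (interfererExponent p.mT κ p.alphaT) z x) hF2]
    refine lintegral_congr fun ω => ?_
    exact lintegral_expNeg_mul_interfererFactor p.lam_pos N.poisson (N.Z ω) p.alphaT_gt hκ0
      (by positivity)
  have h3 : ∫ ω, Real.exp (-(t * N.level ω)) ∂P = ∫ ω, K ‖N.Z ω‖ ∂P := by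
    have hm1 : Measurable fun ω => Real.exp (-(t * N.level ω)) :=
      ((N.measurable_level.const_mul t).fun_neg).exp
    have hm2 : Measurable fun ω => K ‖N.Z ω‖ := hK.comp N.measurable_Z.norm
    rw [integral_eq_lintegral_of_nonneg_ae (ae_of_all _ fun ω => (Real.exp_nonneg _))
      hm1.aestronglyMeasurable, integral_eq_lintegral_of_nonneg_ae (ae_of_all _ fun ω => hK0 _)
      hm2.aestronglyMeasurable, ← h2]
    congr 1
    refine lintegral_congr fun ω => ?_
    rw [expNeg_ofReal (mul_nonneg ht (N.level_nonneg ω))]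
  rw [h3, integral_uniform_disc p.RL_pos N.measurable_Z N.uniform_Z hK,
    ← intervalIntegral.integral_const_mul]
  refine intervalIntegral.integral_congr fun y _ => ?_
  simp only [K]
  ring

end Network

end

end RISNoma

namespace RISNoma

noncomputable section

open Filter Topology

/-! ### Binomial expansion and the analytic formula -/

lemma one_sub_one_sub_pow (m : ℕ) (E : ℝ) :
    1 - (1 - E) ^ m = ∑ n ∈ Finset.Icc 1 m, (-1 : ℝ) ^ (n + 1) * (m.choose n : ℝ) * E ^ n := by
  have h1 : (1 - E) ^ m = ∑ n ∈ Finset.range (m + 1), (-1 : ℝ) ^ n * (m.choose n : ℝ) * E ^ n := by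
    rw [sub_eq_neg_add, add_pow]
    refine Finset.sum_congr rfl fun n _ => ?_
    rw [neg_pow, one_pow]; ring
  have h2 : Finset.Icc 1 m = (Finset.range m).map (addRightEmbedding 1) := by
    rw [Finset.range_eq_Ico, Finset.map_add_right_Ico, zero_add]
    rfl
  rw [h1, Finset.sum_range_succ', h2, Finset.sum_map]
  simp only [addRightEmbedding_apply, pow_zero, Nat.choose_zero_right, Nat.cast_one, mul_one]
  rw [sub_add_eq_sub_sub_swap, sub_self, zero_sub, ← Finset.sum_neg_distrib]
  refine Finset.sum_congr rfl fun n _ => ?_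
  ring

namespace Network

variable {Ω : Type*} [MeasurableSpace Ω] {P : Measure Ω} {p : Params} (N : Network p P)

lemma beta2_pos (n : ℕ) : 0 < N.beta2 n := by
  have hu := N.upsilon_pos
  have hη := eta_pos p.mT_pos
  have hm0 : (0 : ℝ) < p.mT := by exact_mod_cast p.mT_pos
  have hrho := p.rhoT_nonneg
  have hG := (outerIntegral_interfererExponent p.mT
    (by positivity : 0 ≤ p.rhoT * n * eta p.mT * N.upsilon / p.mT) p.alphaT_gt).1
  have := p.lam_pos
  have := Real.pi_pos
  unfold beta2
  positivity

lemma beta1_nonneg (n : ℕ) : 0 ≤ N.beta1 n := by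
  have hu := N.upsilon_pos
  have hη := eta_pos p.mT_pos
  have hC := p.meanC_pos
  have hPb := p.Pb_pos
  unfold beta1
  positivity

lemma formula_eq_sum :
    N.formula = ∑ n ∈ Finset.Icc 1 p.mT, (-1 : ℝ) ^ (n + 1) * (p.mT.choose n : ℝ) *
      (2 * Real.pi * p.lam * ∫ y in (0 : ℝ)..p.RL,
        radialIntegral p.alphaT (N.beta0 n y) (N.beta2 n) * N.densityRU y) := by
  have hRL := p.RL_pos
  have hb0 : ∀ n y, 0 ≤ y → 0 ≤ N.beta0 n y := fun n y hy =>
    mul_nonneg (N.beta1_nonneg n) (Real.rpow_nonneg hy _)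
  have hinner : ∀ y ∈ uIcc 0 p.RL, (∫ x in Ioi (0 : ℝ), ∑ n ∈ Finset.Icc 1 p.mT,
      (-1 : ℝ) ^ (n + 1) * (p.mT.choose n : ℝ) * x *
        Real.exp (-(N.beta0 n y * x ^ p.alphaT)) * Real.exp (-(N.beta2 n * x ^ 2))) *
        N.densityRU y =
      ∑ n ∈ Finset.Icc 1 p.mT, (-1 : ℝ) ^ (n + 1) * (p.mT.choose n : ℝ) *
        (radialIntegral p.alphaT (N.beta0 n y) (N.beta2 n) * N.densityRU y) := by
    intro y hy
    rw [uIcc_of_le hRL.le] at hy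
    have hterm : ∀ (n : ℕ) (x : ℝ), (-1 : ℝ) ^ (n + 1) * (p.mT.choose n : ℝ) * x *
        Real.exp (-(N.beta0 n y * x ^ p.alphaT)) * Real.exp (-(N.beta2 n * x ^ 2)) =
        (-1 : ℝ) ^ (n + 1) * (p.mT.choose n : ℝ) * (x *
        Real.exp (-(N.beta0 n y * x ^ p.alphaT)) * Real.exp (-(N.beta2 n * x ^ 2))) :=
      fun n x => by ring
    simp_rw [hterm]
    rw [integral_finsetSum _ fun n _ =>
      (integrableOn_radial (hb0 n y hy.1) (N.beta2_pos n)).const_mul _, Finset.sum_mul]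
    refine Finset.sum_congr rfl fun n _ => ?_
    rw [integral_const_mul, mul_assoc _ (integral _ _)]
    rfl
  rw [formula, intervalIntegral.integral_congr hinner, intervalIntegral.integral_finsetSum]
  · rw [Finset.mul_sum]
    refine Finset.sum_congr rfl fun n _ => ?_
    rw [intervalIntegral.integral_const_mul]
    ring
  · intro n _
    refine IntervalIntegrable.const_mul ?_ _
    rw [intervalIntegrable_iff_integrableOn_Ioc_of_le hRL.le]
    have hmeas : Measurable fun y =>
        radialIntegral p.alphaT (N.beta0 n y) (N.beta2 n) * N.densityRU y := by
      have h1 := (stronglyMeasurable_radialIntegral p.alphaT (N.beta2 n)).measurable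
      have h2 : Measurable fun y => N.beta0 n y := by unfold beta0; fun_prop
      have h3 : Measurable fun y => N.densityRU y := by unfold densityRU; fun_prop
      exact (h1.comp h2).mul h3
    refine Measure.integrableOn_of_bounded (M := (∫ x in Ioi (0 : ℝ),
      x * Real.exp (-(N.beta2 n * x ^ 2))) * (2 * p.RL / p.RL ^ 2)) (by simp)
      hmeas.aestronglyMeasurable ?_
    refine (ae_restrict_iff' measurableSet_Ioc).2 (ae_of_all _ fun y hy => ?_)
    have hy0 : 0 < y := hy.1
    have hyR : y ≤ p.RL := hy.2
    have h0 := radialIntegral_nonneg p.alphaT (N.beta0 n y) (N.beta2 n)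
    have h1 := radialIntegral_le (α := p.alphaT) (hb0 n y hy0.le) (N.beta2_pos n)
    have h2 : 0 ≤ N.densityRU y := by unfold densityRU; positivity
    have h3 : N.densityRU y ≤ 2 * p.RL / p.RL ^ 2 := by unfold densityRU; gcongr
    rw [Real.norm_of_nonneg (mul_nonneg h0 h2)]
    exact mul_le_mul h1 h3 h2 (h0.trans h1)

lemma measurable_cdf_level :
    Measurable fun ω => cdf (gammaMeasure p.mT p.mT) (N.level ω) :=
  (monotone_cdf (gammaMeasure p.mT p.mT)).measurable.comp N.measurable_level

lemma exp_neg_level_mem (ω : Ω) : 0 ≤ 1 - Real.exp (-(eta p.mT * N.level ω)) ∧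
    1 - Real.exp (-(eta p.mT * N.level ω)) ≤ 1 := by
  have h1 := mul_nonneg (eta_pos p.mT_pos).le (N.level_nonneg ω)
  exact ⟨sub_nonneg.2 (Real.exp_le_one_iff.2 (by linarith)), sub_le_self _ (Real.exp_nonneg _)⟩

variable [IsProbabilityMeasure P]

lemma integrable_of_measurable_of_bounded {f : Ω → ℝ} (hf : Measurable f)
    (h0 : ∀ ω, 0 ≤ f ω) (h1 : ∀ ω, f ω ≤ 1) : Integrable f P :=
  Integrable.of_bound hf.aestronglyMeasurable 1
    (ae_of_all _ fun ω => by rw [Real.norm_of_nonneg (h0 ω)]; exact h1 ω)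

theorem integral_eq_formula :
    ∫ ω, (1 - (1 - Real.exp (-(eta p.mT * N.level ω))) ^ p.mT) ∂P = N.formula := by
  have hη := eta_pos p.mT_pos
  have hpow : ∀ (n : ℕ) ω, Real.exp (-(eta p.mT * N.level ω)) ^ n =
      Real.exp (-((n * eta p.mT) * N.level ω)) := fun n ω => by
    rw [← Real.exp_nat_mul]; congr 1; ring
  simp_rw [one_sub_one_sub_pow, hpow]
  have hint : ∀ n : ℕ, Integrable (fun ω => Real.exp (-((n * eta p.mT) * N.level ω))) P := fun n =>
    integrable_of_measurable_of_bounded ((N.measurable_level.const_mul _).fun_neg).exp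
      (fun ω => Real.exp_nonneg _) (fun ω => Real.exp_le_one_iff.2 (by
        have := N.level_nonneg ω
        have : 0 ≤ (n * eta p.mT) * N.level ω := by positivity
        linarith))
  rw [integral_finsetSum _ fun n _ => (hint n).const_mul _, formula_eq_sum]
  refine Finset.sum_congr rfl fun n _ => ?_
  rw [integral_const_mul, N.integral_exp_neg_level (by positivity : 0 ≤ n * eta p.mT)]
  congr 2
  refine intervalIntegral.integral_congr fun y _ => ?_
  simp only [beta0, beta1, beta2, densityRU, mul_assoc]

/-! ### Finiteness of the mean orthogonal ratio -/

/-- Dropping the interference bounds the ratio by a constant times the serving gain, since the link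
length is fixed. The serving index depends on the positions only, so that gain still has mean one.
-/
theorem meanOmaC_lt_top : N.meanOmaC < ∞ := by
  have hPb := p.Pb_pos
  have hC := p.C_pos
  have hr := p.rC_pos
  have hσ := p.sigma_pos
  have hm0 : (0 : ℝ) < p.mC := by exact_mod_cast p.mC_pos
  set c : ℝ := p.Pb * (p.C * p.rC ^ (-p.alphaC)) / p.sigma ^ 2 with hc
  have hc0 : 0 ≤ c := by positivity
  have hle : ∀ᵐ ω ∂P, p.omaC (fun i => N.X i ω) (N.Z ω) (N.Y ω) (fun i => N.g i ω) ≤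
      ENNReal.ofReal (c * ‖N.g (serving (fun i => N.X i ω) (N.Z ω)) ω‖ ^ 2) := by
    filter_upwards [N.dist_Y] with ω hω
    rw [Params.omaC, Params.lossC, hω]
    refine (ENNReal.div_le_div_left le_add_self _).trans ?_
    rw [← ENNReal.ofReal_div_of_pos (by positivity)]
    refine ENNReal.ofReal_le_ofReal (le_of_eq ?_)
    rw [hc]; ring
  refine (lintegral_mono_ae hle).trans_lt ?_
  have hF : Measurable fun q : (ℕ → ℂ) × ((ℕ → Plane) × Plane) =>
      ENNReal.ofReal (c * ‖q.1 (serving q.2.1 q.2.2)‖ ^ 2) := by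
    have h1 : Measurable fun q : (ℕ → ℂ) × ((ℕ → Plane) × Plane) => q.1 (serving q.2.1 q.2.2) :=
      measurable_apply_of_nat (F := fun i (q : (ℕ → ℂ) × ((ℕ → Plane) × Plane)) => q.1 i)
        (fun i => by fun_prop) (measurable_serving.comp measurable_snd)
    fun_prop
  rw [lintegral_comp_of_indepFun (measurable_pi_iff.2 N.nakagami_g.measurable)
    N.measurable_positions N.indepFun_g_positions
    (F := fun g q => ENNReal.ofReal (c * ‖g (serving q.1 q.2)‖ ^ 2)) hF]
  have hmean : ∀ k, ∫⁻ ω', ENNReal.ofReal (c * ‖N.g k ω'‖ ^ 2) ∂P = ENNReal.ofReal c := fun k => by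
    simp_rw [ENNReal.ofReal_mul hc0]
    rw [lintegral_gain N.nakagami_g k (F := fun x => ENNReal.ofReal c * ENNReal.ofReal x)
      (by fun_prop), lintegral_const_mul _ ENNReal.measurable_ofReal,
      lintegral_id_gammaMeasure hm0 hm0, div_self hm0.ne', ENNReal.ofReal_one, mul_one]
  simp_rw [hmean]
  simp

/-! ### The coverage probability -/

/-- Coverage means that the gain of the associated base station exceeds the level. -/
lemma ae_coverage_iff : ∀ᵐ ω ∂P,
    (ENNReal.ofReal p.thSIC < p.sinrSIC (fun i => N.X i ω) (N.Z ω) (fun i => N.h i ω) ∧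
      ENNReal.ofReal p.thT < p.sinrT (fun i => N.X i ω) (N.Z ω) (fun i => N.h i ω) ∧
      N.meanOmaC < p.omaT (fun i => N.X i ω) (N.Z ω) (fun i => N.h i ω)) ↔
    N.level ω < ‖N.h (serving (fun i => N.X i ω) (N.Z ω)) ω‖ ^ 2 := by
  filter_upwards [N.ae_regular, N.ae_interf_lt_top] with ω hq hI
  have hPb := p.Pb_pos
  have hσ := p.sigma_pos
  have haT := p.aT_pos
  have haC : 0 < p.aC := haT.trans p.aT_lt_aC
  have hloss := hq.lossT_pos (serving (fun i => N.X i ω) (N.Z ω))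
  have hSIC : 0 < p.aC - p.thSIC * p.aT := by linarith [p.thSIC_lt]
  have hinterf : p.interfT (fun i => N.X i ω) (N.Z ω) (fun i => N.h i ω) =
      ENNReal.ofReal (N.interf ω).toReal := (ENNReal.ofReal_toReal hI.ne).symm
  have hlev : N.level ω = N.upsilon * ((N.interf ω).toReal + p.sigma ^ 2) /
    (p.Pb * p.lossT (N.X (serving (fun i => N.X i ω) (N.Z ω)) ω) (N.Z ω)) := rfl
  have hS : p.signalT (fun i => N.X i ω) (N.Z ω) (fun i => N.h i ω) =
      ‖N.h (serving (fun i => N.X i ω) (N.Z ω)) ω‖ ^ 2 *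
        (p.Pb * p.lossT (N.X (serving (fun i => N.X i ω) (N.Z ω)) ω) (N.Z ω)) := by
    rw [Params.signalT]; ring
  have hS0 : 0 ≤ p.signalT (fun i => N.X i ω) (N.Z ω) (fun i => N.h i ω) := by
    rw [hS]; positivity
  rw [hlev, div_lt_iff₀ (mul_pos hPb hloss), ← hS, Params.sinrSIC, Params.sinrT, Params.omaT, hinterf]
  set S := p.signalT (fun i => N.X i ω) (N.Z ω) (fun i => N.h i ω)
  have hI0 : 0 ≤ (N.interf ω).toReal := ENNReal.toReal_nonneg
  set I := (N.interf ω).toReal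
  have hD : 0 < I + p.sigma ^ 2 := by positivity
  -- Finiteness matters: `toReal` of `∞` would be `0` and drop this threshold from `Υ`.
  have hmo : N.meanOmaC = ENNReal.ofReal N.meanOmaC.toReal :=
    (ENNReal.ofReal_toReal N.meanOmaC_lt_top.ne).symm
  have hU : N.upsilon * (I + p.sigma ^ 2) < S ↔
      (p.thSIC / (p.aC - p.thSIC * p.aT) * (I + p.sigma ^ 2) < S ∧
        p.thT / p.aT * (I + p.sigma ^ 2) < S) ∧ N.meanOmaC.toReal * (I + p.sigma ^ 2) < S := by
    rw [upsilon, ← lt_div_iff₀ hD, max_lt_iff, max_lt_iff, lt_div_iff₀ hD, lt_div_iff₀ hD,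
      lt_div_iff₀ hD]
  rw [← ENNReal.ofReal_add (by positivity) hI0, ← ENNReal.ofReal_add (by positivity) (by positivity),
    ← ENNReal.ofReal_add hI0 (by positivity), ← ENNReal.ofReal_div_of_pos (by positivity),
    ← ENNReal.ofReal_div_of_pos hD, ← ENNReal.ofReal_div_of_pos hD,
    ENNReal.ofReal_lt_ofReal_iff_of_nonneg p.thSIC_pos.le,
    ENNReal.ofReal_lt_ofReal_iff_of_nonneg p.thT_pos.le, hmo,
    ENNReal.ofReal_lt_ofReal_iff_of_nonneg ENNReal.toReal_nonneg,
    lt_div_iff₀ (by positivity), lt_div_iff₀ hD, lt_div_iff₀ hD, hU,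
    div_mul_eq_mul_div, div_mul_eq_mul_div, div_lt_iff₀ hSIC, div_lt_iff₀ haT, and_assoc]
  -- Clearing denominators, the cancellation condition reads `γ(I + σ²) < (a_c - γ a_t) S` with `γ`
  -- its threshold.
  refine and_congr ?_ (and_congr ?_ Iff.rfl)
  · constructor <;> intro h <;> linarith
  · constructor <;> intro h <;> linarith

/-- With the positions frozen, the serving gain is independent of the level and exceeds it with
conditional probability `1 - F_m`. -/
theorem coverage_eq :
    N.coverage = ∫ ω, (1 - cdf (gammaMeasure p.mT p.mT) (N.level ω)) ∂P := by
  have hset : MeasurableSet {q : (ℕ → ℂ) × ((ℕ → Plane) × Plane) |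
      p.levelOf N.upsilon q.1 q.2 < ‖q.1 (serving q.2.1 q.2.2)‖ ^ 2} := by
    have h1 : Measurable fun q : (ℕ → ℂ) × ((ℕ → Plane) × Plane) => q.1 (serving q.2.1 q.2.2) :=
      measurable_apply_of_nat (F := fun i (q : (ℕ → ℂ) × ((ℕ → Plane) × Plane)) => q.1 i)
        (fun i => by fun_prop) (measurable_serving.comp measurable_snd)
    exact measurableSet_lt (p.measurable_levelOf _) (by fun_prop)
  have hcdf : Measurable fun q : (ℕ → ℂ) × ((ℕ → Plane) × Plane) =>
      ENNReal.ofReal (1 - cdf (gammaMeasure p.mT p.mT) (p.levelOf N.upsilon q.1 q.2)) := by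
    have h1 := (monotone_cdf (gammaMeasure p.mT p.mT)).measurable.comp
      (p.measurable_levelOf N.upsilon)
    exact (h1.const_sub 1).ennreal_ofReal
  have hmeas : P {ω | N.level ω < ‖N.h (serving (fun i => N.X i ω) (N.Z ω)) ω‖ ^ 2} =
      ∫⁻ ω, ENNReal.ofReal (1 - cdf (gammaMeasure p.mT p.mT) (N.level ω)) ∂P := by
    have hE : MeasurableSet {ω | N.level ω < ‖N.h (serving (fun i => N.X i ω) (N.Z ω)) ω‖ ^ 2} :=
      (N.measurable_fading.prodMk N.measurable_positions) hset
    have h1 := lintegral_comp_of_indepFun N.measurable_fading N.measurable_positions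
      N.indepFun_h_positions (F := fun h q => {q : (ℕ → ℂ) × ((ℕ → Plane) × Plane) |
        p.levelOf N.upsilon q.1 q.2 < ‖q.1 (serving q.2.1 q.2.2)‖ ^ 2}.indicator 1 (h, q))
      (measurable_one.indicator hset)
    have h2 := lintegral_comp_of_indepFun N.measurable_fading N.measurable_positions
      N.indepFun_h_positions (F := fun h q =>
        ENNReal.ofReal (1 - cdf (gammaMeasure p.mT p.mT) (p.levelOf N.upsilon h q))) hcdf
    simp_rw [level_eq]
    rw [h2, ← lintegral_indicator_one (by simpa only [level_eq] using hE)]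
    refine Eq.trans (lintegral_congr fun ω => ?_) (h1.trans (lintegral_congr fun ω => ?_))
    · simp [indicator]
    · rw [← Params.measure_levelOf_lt N.nakagami_h N.upsilon]
      have hE' : MeasurableSet {ω' | p.levelOf N.upsilon (fun i => N.h i ω')
          ((fun i => N.X i ω), N.Z ω) < ‖N.h (serving (fun i => N.X i ω) (N.Z ω)) ω'‖ ^ 2} :=
        (N.measurable_fading.prodMk measurable_const) hset
      rw [← lintegral_indicator_one hE']
      refine lintegral_congr fun ω' => ?_
      simp [indicator]
  have hcov : N.coverage =
      P.real {ω | N.level ω < ‖N.h (serving (fun i => N.X i ω) (N.Z ω)) ω‖ ^ 2} := by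
    refine measureReal_congr ?_
    filter_upwards [N.ae_coverage_iff] with ω hω
    exact propext hω
  rw [hcov, Measure.real, hmeas, integral_eq_lintegral_of_nonneg_ae
    (ae_of_all _ fun ω => sub_nonneg.2 (cdf_le_one _ _))
    (N.measurable_cdf_level.const_sub 1).aestronglyMeasurable]

lemma integrable_cdf_level : Integrable (fun ω => 1 - cdf (gammaMeasure p.mT p.mT) (N.level ω)) P :=
  integrable_of_measurable_of_bounded (N.measurable_cdf_level.const_sub 1)
    (fun _ => sub_nonneg.2 (cdf_le_one _ _)) (fun _ => sub_le_self _ (cdf_nonneg _ _))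

lemma integrable_one_sub_pow :
    Integrable (fun ω => 1 - (1 - Real.exp (-(eta p.mT * N.level ω))) ^ p.mT) P :=
  integrable_of_measurable_of_bounded
    (((((N.measurable_level.const_mul _).fun_neg).exp.const_sub 1).pow_const _).const_sub 1)
    (fun ω => sub_nonneg.2 (pow_le_one₀ (N.exp_neg_level_mem ω).1 (N.exp_neg_level_mem ω).2))
    (fun ω => sub_le_self _ (pow_nonneg (N.exp_neg_level_mem ω).1 _))

theorem coverage_le_formula : N.coverage ≤ N.formula := by
  rw [N.coverage_eq, ← N.integral_eq_formula]
  refine integral_mono N.integrable_cdf_level N.integrable_one_sub_pow fun ω => ?_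
  exact sub_le_sub_left (one_sub_exp_pow_le_cdf_gammaMeasure p.mT_pos (N.level_nonneg ω)) 1

theorem formula_sub_coverage_le : N.formula - N.coverage ≤ gammaGap p.mT := by
  -- The real supremum in `gammaGap` bounds its family only if that family is bounded above.
  have hbdd : BddAbove (range fun x : Ioi (0 : ℝ) => cdf (gammaMeasure p.mT p.mT) (x : ℝ) -
      (1 - Real.exp (-(eta p.mT * (x : ℝ)))) ^ p.mT) := by
    refine ⟨1, ?_⟩
    rintro _ ⟨⟨x, hx⟩, rfl⟩
    have h1 := mul_nonneg (eta_pos p.mT_pos).le (le_of_lt hx)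
    have h2 : 0 ≤ (1 - Real.exp (-(eta p.mT * x))) ^ p.mT :=
      pow_nonneg (sub_nonneg.2 (Real.exp_le_one_iff.2 (by linarith))) _
    have h3 := cdf_le_one (gammaMeasure p.mT p.mT) x
    simp only
    linarith
  rw [N.coverage_eq, ← N.integral_eq_formula,
    ← integral_sub N.integrable_one_sub_pow N.integrable_cdf_level]
  calc _ ≤ ∫ _, gammaGap p.mT ∂P := by
        refine integral_mono_ae (N.integrable_one_sub_pow.sub N.integrable_cdf_level)
          (integrable_const _) ?_
        -- The supremum runs over `x > 0`; noise and a positive threshold keep the level off zero.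
        filter_upwards [N.ae_level_pos] with ω hω
        refine le_trans (le_of_eq ?_) (le_ciSup hbdd ⟨N.level ω, hω⟩)
        simp only
        ring
    _ = gammaGap p.mT := by simp

end Network

end

end RISNoma

theorem theorem1 {Ω : Type*} [MeasurableSpace Ω] (P : MeasureTheory.Measure Ω)
    [MeasureTheory.IsProbabilityMeasure P] (p : RISNoma.Params) (N : RISNoma.Network p P) :
    N.meanOmaC < ∞ ∧
    (∀ᵐ ω ∂P, N.interf ω < ∞) ∧
    ∫ ω, (1 - (1 - Real.exp (-(RISNoma.eta p.mT * N.level ω))) ^ p.mT) ∂P = N.formula ∧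
    N.coverage ≤ N.formula ∧
    N.formula - N.coverage ≤ RISNoma.gammaGap p.mT :=
  ⟨N.meanOmaC_lt_top, N.ae_interf_lt_top, N.integral_eq_formula, N.coverage_le_formula,
    N.formula_sub_coverage_le⟩
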